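/- Let $(X_k,Y_k)_{k\in\mathbb N}$ be an iid sequence of pairs of real random variables, $(X,Y)$ a generic pair. For a sample of size $n$, rearrange the data such that $X_{(1)}\le\dots\le X_{(n)}$, with ties broken uniformly at random (independently of everything else), let $r_i=\#\{j: Y_{(j)}\le Y_{(i)}\}$ and $l_i=\#\{j: Y_{(j)}\ge Y_{(i)}\}$, and let Chatterjee's rank correlation be $$\xi_n = 1-\frac{3\sum_{i=1}^{n-1}|r_{i+1}-r_i|}{n^2-1}\ \text{ if } Y_1,\dots,Y_n \text{ are distinct},\qquad \xi_n = 1-\frac{n\sum_{i=1}^{n-1}|r_{i+1}-r_i|}{2\sum_{i=1}^n l_i(n-l_i)}\ \text{ otherwise}$$ (with $0/0:=0$, so that $\xi_n=1$ if all $Y_i$ coincide or $n\le 1$). Put $T_n=\sqrt n\,(\xi_n-\mathbb E\xi_n)$. Given $(X_1,Y_1),\dots,(X_n,Y_n)$, draw $m=m(n)$ of these $n$ pairs uniformly at random without replacement, let $\xi_m^*$ be Chatterjee's rank correlation of the drawn sample (ties again broken at random), put $T^*_{m,n}=\sqrt m\,\bigl(\xi_m^*-\mathbb E[\xi_m^*\mid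 (X_1,Y_1),\dots,(X_n,Y_n)]\bigr)$, and let $F^*_{m,n}$ be the distribution function of $T^*_{m,n}$ conditional on $(X_1,Y_1),\dots,(X_n,Y_n)$. Let $\Phi$ be the standard normal distribution function. (i) If $T_n\to\mathcal N(0,\sigma^2)$ in distribution for some $\sigma>0$, then for every choice of $m=m(n)$ with $m\to\infty$ and $m=o(\sqrt n)$, $$\sup_{x\in\mathbb R}\bigl|F^*_{m,n}(x)-\Phi(x/\sigma)\bigr|\longrightarrow 0\quad\text{in probability as } n\to\infty .$$ (ii) If $(X,Y)$ has a continuous distribution function and there is no measurable function $f$ with $Y=f(X)$ almost surely, then there is a $\sigma>0$ such that $T_n\to\mathcal N(0,\sigma^2)$ in distribution, and for every choice of $m=m(n)$ with $m\to\infty$ and $m=o(n)$ the same convergence of $\sup_{x\in\mathbb R}|F^*_{m,n}(x)-\Phi(x/\sigma)|$ to $0$ in probability holds. -/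

import Mathlib

open MeasureTheory ProbabilityTheory Filter Topology Asymptotics
open scoped NNReal ENNReal

noncomputable section

namespace RankBootstrap

/-- Finite sets of permutations and of injections carry the discrete σ-algebra. -/
instance permMeasurableSpace (n : ℕ) : MeasurableSpace (Equiv.Perm (Fin n)) := ⊤

instance embeddingMeasurableSpace (m n : ℕ) : MeasurableSpace (Fin m ↪ Fin n) := ⊤

/-- The order in which a sample `z` of points `(x, y)` is listed when it is rearranged so that the
`x`-coordinates increase. Ties among the `x`-coordinates are broken by the priorities `ρ`: the
points are sorted by `(x i, ρ i)` lexicographically. When `ρ` is a uniformly distributed random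
permutation, this is a uniformly distributed element of the set of all permutations `τ` for which
`i ↦ x (τ i)` is monotone, i.e. ties are broken at random. -/
def ordering {n : ℕ} (z : Fin n → ℝ × ℝ) (ρ : Equiv.Perm (Fin n)) : Equiv.Perm (Fin n) :=
  Tuple.sort (fun i => toLex ((z i).1, ρ i))

/-- The rearranged sample `Y_(1), …, Y_(n)`. -/
def rearrangedY {n : ℕ} (z : Fin n → ℝ × ℝ) (ρ : Equiv.Perm (Fin n)) : Fin n → ℝ :=
  fun i => (z (ordering z ρ i)).2

open Classical in
/-- `r_i`, the rank of `y i`: the number of `j` with `y j ≤ y i`. -/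
def lowerRank {n : ℕ} (y : Fin n → ℝ) (i : Fin n) : ℕ :=
  (Finset.univ.filter (fun j => y j ≤ y i)).card

open Classical in
/-- `l_i`, the number of `j` with `y j ≥ y i`. -/
def upperRank {n : ℕ} (y : Fin n → ℝ) (i : Fin n) : ℕ :=
  (Finset.univ.filter (fun j => y i ≤ y j)).card

/-- `∑_{i=1}^{n-1} |r_{i+1} - r_i|`. -/
def rankVariation {n : ℕ} (y : Fin n → ℝ) : ℝ :=
  ∑ i : Fin (n - 1),
    |(lowerRank y ⟨i.val + 1, by omega⟩ : ℝ) - (lowerRank y ⟨i.val, by omega⟩ : ℝ)|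

open Classical in
/-- Chatterjee's rank correlation `ξ_n` of the sample `z`, with ties among the `x`-coordinates
broken by `ρ`. If `n ≤ 1` or all the `y`-coordinates coincide, the quotient vanishes or has the form
`0 / 0`, which is read as `0`, and `ξ_n = 1`. -/
def xi {n : ℕ} (z : Fin n → ℝ × ℝ) (ρ : Equiv.Perm (Fin n)) : ℝ :=
  let y := rearrangedY z ρ
  if Function.Injective y then
    1 - 3 * rankVariation y / ((n : ℝ) ^ 2 - 1)
  else
    1 - (n : ℝ) * rankVariation y /
      (2 * ∑ i, (upperRank y i : ℝ) * ((n : ℝ) - (upperRank y i : ℝ)))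

/-- The law of the random tie-breaking: the uniform distribution on the permutations. -/
def tieMeasure (n : ℕ) : Measure (Equiv.Perm (Fin n)) := uniformOn Set.univ

instance tieMeasure_isProbabilityMeasure (n : ℕ) : IsProbabilityMeasure (tieMeasure n) :=
  isProbabilityMeasure_uniformOn Set.finite_univ Set.univ_nonempty

section Sample

variable {Ω : Type*} [MeasurableSpace Ω]

/-- The observed sample of the first `n` pairs. -/
def sample (X Y : ℕ → Ω → ℝ) (n : ℕ) (ω : Ω) : Fin n → ℝ × ℝ :=
  fun i => (X i ω, Y i ω)

/-- The probability measure governing the process and an independent random tie-breaking. -/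
def sampleMeasure (P : Measure Ω) (n : ℕ) : Measure (Ω × Equiv.Perm (Fin n)) :=
  P.prod (tieMeasure n)

instance sampleMeasure_isProbabilityMeasure (P : Measure Ω) [IsProbabilityMeasure P] (n : ℕ) :
    IsProbabilityMeasure (sampleMeasure P n) := by
  unfold sampleMeasure; infer_instance

/-- `ξ_n` as a random variable. -/
def xiStat (X Y : ℕ → Ω → ℝ) (n : ℕ) (p : Ω × Equiv.Perm (Fin n)) : ℝ :=
  xi (sample X Y n p.1) p.2

/-- `T_n = √n (ξ_n - 𝔼 ξ_n)`. -/
def T (P : Measure Ω) (X Y : ℕ → Ω → ℝ) (n : ℕ) (p : Ω × Equiv.Perm (Fin n)) : ℝ :=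
  √(n : ℝ) * (xiStat X Y n p - ∫ q, xiStat X Y n q ∂(sampleMeasure P n))

/-- `T_n` converges in distribution to the centred normal law with variance `σ²`. -/
def TConvergesTo (P : Measure Ω) [IsProbabilityMeasure P] (X Y : ℕ → Ω → ℝ) (σ : ℝ≥0) : Prop :=
  TendstoInDistribution (T P X Y) atTop (fun x : ℝ => x) (sampleMeasure P)
    (gaussianReal 0 (σ ^ 2))

end Sample

section Bootstrap

/-- The law of the bootstrap randomness given the data: the indices of the `m` observations drawn
without replacement from `n` are a uniformly distributed injection, and the ties in the bootstrap
sample are broken by an independent uniformly distributed permutation. -/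
def bootMeasure (m n : ℕ) : Measure ((Fin m ↪ Fin n) × Equiv.Perm (Fin m)) :=
  (uniformOn Set.univ).prod (tieMeasure m)

/-- `ξ_m^*` as a function of the bootstrap randomness, for given data `z`. -/
def bootXi {m n : ℕ} (z : Fin n → ℝ × ℝ) (b : (Fin m ↪ Fin n) × Equiv.Perm (Fin m)) : ℝ :=
  xi (fun i => z (b.1 i)) b.2

/-- `T_{m,n}^* = √m (ξ_m^* - 𝔼[ξ_m^* | data])` for given data `z`. -/
def bootT {m n : ℕ} (z : Fin n → ℝ × ℝ) (b : (Fin m ↪ Fin n) × Equiv.Perm (Fin m)) : ℝ :=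
  √(m : ℝ) * (bootXi z b - ∫ c, bootXi z c ∂(bootMeasure m n))

/-- `F_{m,n}^*(x)`: the conditional distribution function of `T_{m,n}^*`, given the data `z`. -/
def bootCDF (m : ℕ) {n : ℕ} (z : Fin n → ℝ × ℝ) (x : ℝ) : ℝ :=
  (bootMeasure m n).real {b | bootT z b ≤ x}

/-- `sup_x |F_{m,n}^*(x) - Φ(x / σ)|` for given data `z`. -/
def kolmogorovError (σ : ℝ≥0) (m : ℕ) {n : ℕ} (z : Fin n → ℝ × ℝ) : ℝ :=
  ⨆ x : ℝ, |bootCDF m z x - cdf (gaussianReal 0 1) (x / σ)|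

/-- Consistency of the bootstrap with sample sizes `m n`: `sup_x |F_{m,n}^*(x) - Φ(x / σ)| → 0`
in probability. -/
def BootstrapConsistent {Ω : Type*} [MeasurableSpace Ω] (P : Measure Ω) (X Y : ℕ → Ω → ℝ)
    (σ : ℝ≥0) (m : ℕ → ℕ) : Prop :=
  TendstoInMeasure P (fun n ω => kolmogorovError σ (m n) (sample X Y n ω)) atTop (fun _ => 0)

end Bootstrap

end RankBootstrap

end

set_option linter.unusedSectionVars false

/-! Given the data, the bootstrap distribution function is an average over all ordered subsamples of
size $m$, evaluated at a randomly shifted argument (`bootCDF_eq`). Without the shift it is a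
U-statistic with kernel in $[0,1]$ and mean $P(T_m\le x)$. Hoeffding's device, which writes such an
average as a mean over permutations of means over $\lfloor n/m\rfloor$ disjoint blocks, bounds its
variance by $1/\lfloor n/m\rfloor$ (`integral_sq_subsampleMean_sub_le`). The shift is $\sqrt m$
times a centred U-statistic with kernel `meanXi`, and its second moment is at most
$2m^2\,\mathrm{varXi}(m)/n$. The normal distribution function is Lipschitz, so closeness at finitely
many points survives a small shift and becomes uniform (`exists_finset_close`). Consistency
therefore follows from the central limit theorem for $T_n$ together with $m/n\to0$ and
$m^2\,\mathrm{varXi}(m)/n\to0$ (`BootstrapConsistent.of_varXi`). In (i), boundedness of $\xi_m$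
gives $\mathrm{varXi}\le 9$, which suffices for $m=o(\sqrt n)$. In (ii), $\mathrm{varXi}(m)=O(1/m)$,
which suffices for $m=o(n)$.

For the central limit theorem in (ii), write $(X,Y)=(x,q(x,u))$ with $u$ uniform and independent of
$x$ (`exists_representation`). There are almost surely no ties, and $\xi_n$ is affine in
$V=\sum|R_k-R_i|$ over pairs of $x$-neighbours. Since $|R_k-R_i|=\sum_l|1\{Y_l\le Y_k\}-1\{Y_l\le
Y_i\}|$, $V$ is also the sum over $l$ of the number of neighbour pairs separated by $Y_l$. With
$p=F(Y)$ and $c(t)$ the probability that $t$ separates two conditionally independent copies of $Y$,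
this suggests replacing $V/n$ by $\sum|p_k-p_i|+\sum_k c(Y_k)$ up to a constant. The leave-one-out
Efron–Stein inequality shows that the fluctuation of the error has variance $o(n)$
(`variance_rankRemainder_le`). The decisive input is that neighbouring sections $p(x_i,\cdot)$,
$p(x_k,\cdot)$ are close in $L^1$ on average (`tendsto_neighbourDist`), which needs no regularity of
the conditional law.

The same closeness allows $x_k$ to be replaced by $x_i$ in $|p_k-p_i|$
(`variance_adjSum_sectionError_le`). Hoeffding's decomposition on the section at $x_i$ then leaves a
sum of degenerate interactions over neighbours and a sum over points. Given the $x$-coordinates,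
these are orthogonal, locally dependent terms, and Tikhomirov's method gives a normal approximation
of the characteristic function (`norm_integral_cis_sub_le`). The conditional variance is nearly an
iid sum over the $x_i$, hence concentrates; the conditional mean is an iid sum with its own normal
limit (`exists_norm_integral_cis_linearization_sub_le`).

The limit variance is positive: if the interactions vanish, then $|p(x,u)-p(x,v)|$ splits into a sum
of functions of $u$ and of $v$, which forces $p(x,\cdot)$ to be constant. Then $F(Y)$, and hence
$Y$, is a function of $X$ (`limitVariance_pos`). -/

namespace RankBootstrap

/-! ### Bounded measurable functions -/

/-- Bounded measurable real functions. -/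
structure BddMeasurable {Ω : Type*} [MeasurableSpace Ω] (f : Ω → ℝ) : Prop where
  measurable : Measurable f
  bdd : ∃ C, ∀ z, |f z| ≤ C

namespace BddMeasurable

variable {Ω Ω' : Type*} [MeasurableSpace Ω] [MeasurableSpace Ω'] {f g : Ω → ℝ}

theorem integrable (hf : BddMeasurable f) (P : Measure Ω) [IsFiniteMeasure P] :
    Integrable f P := by
  obtain ⟨C, hC⟩ := hf.bdd
  exact Integrable.of_bound hf.measurable.aestronglyMeasurable C
    (Eventually.of_forall fun z => by simpa using hC z)

theorem const (c : ℝ) : BddMeasurable (fun _ : Ω => c) :=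
  ⟨measurable_const, |c|, fun _ => le_rfl⟩

theorem add (hf : BddMeasurable f) (hg : BddMeasurable g) :
    BddMeasurable (fun z => f z + g z) := by
  obtain ⟨C, hC⟩ := hf.bdd
  obtain ⟨D, hD⟩ := hg.bdd
  exact ⟨hf.measurable.add hg.measurable, C + D,
    fun z => (abs_add_le _ _).trans (add_le_add (hC z) (hD z))⟩

theorem mul (hf : BddMeasurable f) (hg : BddMeasurable g) :
    BddMeasurable (fun z => f z * g z) := by
  obtain ⟨C, hC⟩ := hf.bdd
  obtain ⟨D, hD⟩ := hg.bdd
  refine ⟨hf.measurable.mul hg.measurable, C * D, fun z => ?_⟩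
  rw [abs_mul]
  exact mul_le_mul (hC z) (hD z) (abs_nonneg _) ((abs_nonneg _).trans (hC z))

theorem const_mul (c : ℝ) (hf : BddMeasurable f) : BddMeasurable (fun z => c * f z) :=
  (const c).mul hf

theorem neg (hf : BddMeasurable f) : BddMeasurable (fun z => -f z) := by
  simpa using hf.const_mul (-1)

theorem sub (hf : BddMeasurable f) (hg : BddMeasurable g) :
    BddMeasurable (fun z => f z - g z) := by
  simpa [sub_eq_add_neg] using hf.add hg.neg

theorem pow (hf : BddMeasurable f) (k : ℕ) : BddMeasurable (fun z => f z ^ k) := by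
  induction k with
  | zero => simpa using const 1
  | succ k ih => simpa [pow_succ] using ih.mul hf

theorem abs (hf : BddMeasurable f) : BddMeasurable (fun z => |f z|) := by
  obtain ⟨C, hC⟩ := hf.bdd
  exact ⟨hf.measurable.abs, C, fun z => by simpa using hC z⟩

theorem finsetSum {ι : Type*} (s : Finset ι) {F : ι → Ω → ℝ} (hF : ∀ i ∈ s, BddMeasurable (F i)) :
    BddMeasurable (fun z => ∑ i ∈ s, F i z) := by
  classical
  induction s using Finset.induction_on with
  | empty => simpa using const 0
  | insert a s ha ih =>
    simp only [Finset.sum_insert ha]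
    exact (hF a (by simp)).add (ih fun i hi => hF i (by simp [hi]))

theorem comp (hf : BddMeasurable f) {φ : Ω' → Ω} (hφ : Measurable φ) :
    BddMeasurable (fun w => f (φ w)) := by
  obtain ⟨C, hC⟩ := hf.bdd
  exact ⟨hf.measurable.comp hφ, C, fun w => hC _⟩

theorem ite {p : Ω → Prop} [DecidablePred p] (hp : MeasurableSet {z | p z})
    (hf : BddMeasurable f) (hg : BddMeasurable g) :
    BddMeasurable (fun z => if p z then f z else g z) := by
  obtain ⟨C, hC⟩ := hf.bdd
  obtain ⟨D, hD⟩ := hg.bdd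
  refine ⟨Measurable.ite hp hf.measurable hg.measurable, max C D, fun z => ?_⟩
  split_ifs
  · exact (hC z).trans (le_max_left _ _)
  · exact (hD z).trans (le_max_right _ _)

theorem integral_right {F : Ω → Ω' → ℝ} (hF : BddMeasurable (Function.uncurry F))
    (Q : Measure Ω') [IsProbabilityMeasure Q] : BddMeasurable (fun z => ∫ w, F z w ∂Q) := by
  obtain ⟨C, hC⟩ := hF.bdd
  refine ⟨(hF.measurable.stronglyMeasurable.integral_prod_right).measurable, C, fun z => ?_⟩
  have := norm_integral_le_of_norm_le_const (μ := Q) (f := F z) (C := C)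
    (Eventually.of_forall fun w => by simpa using hC (z, w))
  simpa using this

theorem integral_left {F : Ω → Ω' → ℝ} (hF : BddMeasurable (Function.uncurry F))
    (Q : Measure Ω) [IsProbabilityMeasure Q] : BddMeasurable (fun w => ∫ z, F z w ∂Q) :=
  integral_right (F := fun w z => F z w) (hF.comp measurable_swap) Q

end BddMeasurable

theorem integral_sq_sub_integral {Ω : Type*} [MeasurableSpace Ω] (P : Measure Ω)
    [IsProbabilityMeasure P] {g : Ω → ℝ} (hg : BddMeasurable g) :
    ∫ z, (g z - ∫ w, g w ∂P) ^ 2 ∂P = ∫ z, g z ^ 2 ∂P - (∫ z, g z ∂P) ^ 2 := by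
  set c := ∫ w, g w ∂P with hc
  have : ∀ z, (g z - c) ^ 2 = (g z ^ 2 - 2 * c * g z) + c ^ 2 := fun z => by ring
  simp_rw [this]
  rw [integral_add (((hg.pow 2).sub (hg.const_mul (2 * c))).integrable P)
    (integrable_const _), integral_sub ((hg.pow 2).integrable P)
    ((hg.const_mul (2 * c)).integrable P), integral_const_mul, ← hc]
  simp
  ring

theorem sq_integral_le {Ω : Type*} [MeasurableSpace Ω] (P : Measure Ω) [IsProbabilityMeasure P]
    {f : Ω → ℝ} (hf : BddMeasurable f) : (∫ z, f z ∂P) ^ 2 ≤ ∫ z, f z ^ 2 ∂P := by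
  have h0 : 0 ≤ ∫ z, (f z - ∫ w, f w ∂P) ^ 2 ∂P := integral_nonneg fun z => sq_nonneg _
  rw [integral_sq_sub_integral P hf] at h0
  linarith

theorem abs_integral_le_sqrt {Ω : Type*} [MeasurableSpace Ω] (P : Measure Ω)
    [IsProbabilityMeasure P] {f : Ω → ℝ} (hf : BddMeasurable f) :
    ∫ z, |f z| ∂P ≤ √(∫ z, f z ^ 2 ∂P) := by
  apply Real.le_sqrt_of_sq_le
  simpa using sq_integral_le P hf.abs

/-! ### Averaging over one coordinate of a product space -/

section Product

variable {ι E : Type*} [Fintype ι] [DecidableEq ι] [MeasurableSpace E]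

/-- The product measure with all factors equal to `μ`. -/
noncomputable abbrev iid (ι : Type*) [Fintype ι] (μ : Measure E) : Measure (ι → E) :=
  Measure.pi (fun _ : ι => μ)

/-- `f` does not depend on the coordinate `j`. -/
def Free (j : ι) {β : Type*} (f : (ι → E) → β) : Prop :=
  ∀ z w, f (Function.update z j w) = f z

variable (μ : Measure E) [IsProbabilityMeasure μ]

/-- Resampling one coordinate preserves the product law. One-coordinate integration can thus be done
with `Function.update`, with no splitting of the index type. -/
theorem measurePreserving_update (j : ι) :
    MeasurePreserving (fun p : (ι → E) × E => Function.update p.1 j p.2)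
      ((iid ι μ).prod μ) (iid ι μ) := by
  refine ⟨measurable_update', ?_⟩
  symm
  refine Measure.pi_eq fun s hs => ?_
  rw [Measure.map_apply measurable_update' (MeasurableSet.univ_pi hs)]
  have : (fun p : (ι → E) × E => Function.update p.1 j p.2) ⁻¹' (Set.univ.pi s) =
      (Set.univ.pi (Function.update s j Set.univ)) ×ˢ (s j) := by
    ext p
    simp only [Set.mem_preimage, Set.mem_univ_pi, Set.mem_prod]
    constructor
    · intro h
      refine ⟨fun i => ?_, by simpa using h j⟩
      by_cases hij : i = j
      · subst hij; simp
      · simpa [hij] using h i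
    · rintro ⟨h1, h2⟩ i
      by_cases hij : i = j
      · subst hij; simpa using h2
      · simpa [hij] using h1 i
  rw [this, Measure.prod_prod, Measure.pi_pi, ← Finset.mul_prod_erase _ _ (Finset.mem_univ j),
    ← Finset.mul_prod_erase Finset.univ (fun i => μ (s i)) (Finset.mem_univ j), mul_comm]
  simp only [Function.update_self, measure_univ, one_mul]
  congr 1
  refine Finset.prod_congr rfl fun i hi => ?_
  rw [Function.update_of_ne (Finset.ne_of_mem_erase hi)]

theorem integral_integral_update {G : Type*} [NormedAddCommGroup G] [NormedSpace ℝ G] (j : ι)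
    {f : (ι → E) → G} (hf : Integrable f (iid ι μ)) :
    ∫ z, ∫ w, f (Function.update z j w) ∂μ ∂(iid ι μ) = ∫ z, f z ∂(iid ι μ) := by
  have hmp := measurePreserving_update μ j
  rw [← integral_prod (fun p : (ι → E) × E => f (Function.update p.1 j p.2))
    (hmp.integrable_comp_of_integrable hf)]
  conv_rhs => rw [← hmp.map_eq]
  rw [integral_map hmp.measurable.aemeasurable]
  rw [hmp.map_eq]
  exact hf.aestronglyMeasurable

/-- The average of `f` over the coordinate `j`. -/
noncomputable def avg (j : ι) (f : (ι → E) → ℝ) (z : ι → E) : ℝ :=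
  ∫ w, f (Function.update z j w) ∂μ

variable {μ}

theorem BddMeasurable.avg {f : (ι → E) → ℝ} (hf : BddMeasurable f) (j : ι) :
    BddMeasurable (avg μ j f) :=
  BddMeasurable.integral_right (F := fun z w => f (Function.update z j w))
    (hf.comp (φ := fun p : (ι → E) × E => Function.update p.1 j p.2) measurable_update') μ

theorem free_avg (j : ι) (f : (ι → E) → ℝ) : Free j (avg μ j f) := by
  intro z w
  simp [RankBootstrap.avg]

theorem Free.avg {i : ι} {f : (ι → E) → ℝ} (hf : Free i f) (j : ι) : Free i (avg μ j f) := by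
  intro z w
  unfold RankBootstrap.avg
  by_cases hij : i = j
  · subst hij; simp
  · congr 1; ext v
    rw [Function.update_comm hij, hf]

theorem integral_avg {f : (ι → E) → ℝ} (hf : BddMeasurable f) (j : ι) :
    ∫ z, avg μ j f z ∂(iid ι μ) = ∫ z, f z ∂(iid ι μ) :=
  integral_integral_update μ j (hf.integrable _)

theorem avg_mul_free {j : ι} {f g : (ι → E) → ℝ} (hf : Free j f) (z : ι → E) :
    avg μ j (fun z => f z * g z) z = f z * avg μ j g z := by
  unfold avg
  simp_rw [hf z]
  rw [integral_const_mul]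

theorem integral_mul_eq_avg {j : ι} {f g : (ι → E) → ℝ} (hf : Free j f) (hfb : BddMeasurable f)
    (hg : BddMeasurable g) :
    ∫ z, f z * g z ∂(iid ι μ) = ∫ z, f z * avg μ j g z ∂(iid ι μ) := by
  rw [← integral_avg (hfb.mul hg) j]
  simp_rw [avg_mul_free hf]

theorem integral_mul_eq_zero {j : ι} {f g : (ι → E) → ℝ} (hf : Free j f) (hfb : BddMeasurable f)
    (hg : BddMeasurable g) (h0 : ∀ z, avg μ j g z = 0) :
    ∫ z, f z * g z ∂(iid ι μ) = 0 := by
  rw [integral_mul_eq_avg hf hfb hg]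
  simp [h0]

/-- The coordinate $j$ enters only through the second argument, so it may be treated as an
independent variable. This is how $Y_j$ is later frozen as a deterministic level $t$. -/
theorem integral_free_update {j : ι} {Φ : (ι → E) → E → ℝ}
    (hΦ : BddMeasurable (Function.uncurry Φ)) (hfree : ∀ w, Free j (fun z => Φ z w)) :
    ∫ z, Φ z (z j) ∂(iid ι μ) = ∫ w, ∫ z, Φ z w ∂(iid ι μ) ∂μ := by
  have hb : BddMeasurable (fun z : ι → E => Φ z (z j)) :=
    hΦ.comp (φ := fun z : ι → E => (z, z j)) (by fun_prop)
  rw [← integral_avg hb j, integral_integral_swap (by exact hΦ.comp measurable_swap |>.integrable _)]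
  unfold avg
  simp only [Function.update_self]
  congr 1; ext z; congr 1; ext w
  exact hfree w z w

theorem sq_avg_le {f : (ι → E) → ℝ} (hf : BddMeasurable f) (j : ι) (z : ι → E) :
    avg μ j f z ^ 2 ≤ avg μ j (fun z => f z ^ 2) z :=
  sq_integral_le μ (hf.comp (φ := fun w => Function.update z j w) (measurable_update z))

theorem avg_sub {f g : (ι → E) → ℝ} (hf : BddMeasurable f) (hg : BddMeasurable g) (j : ι)
    (z : ι → E) : avg μ j (fun z => f z - g z) z = avg μ j f z - avg μ j g z :=
  integral_sub
    ((hf.comp (φ := fun w => Function.update z j w) (measurable_update z)).integrable μ)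
    ((hg.comp (φ := fun w => Function.update z j w) (measurable_update z)).integrable μ)

theorem integral_sq_avg_le {f : (ι → E) → ℝ} (hf : BddMeasurable f) (j : ι) :
    ∫ z, avg μ j f z ^ 2 ∂(iid ι μ) ≤ ∫ z, f z ^ 2 ∂(iid ι μ) := by
  rw [← integral_avg (μ := μ) (hf.pow 2) j]
  exact integral_mono (((hf.avg j).pow 2).integrable _) (((hf.pow 2).avg j).integrable _)
    fun z => sq_avg_le hf j z

theorem integral_sq_sub_avg {f : (ι → E) → ℝ} (hf : BddMeasurable f) (j : ι) :
    ∫ z, (f z - avg μ j f z) ^ 2 ∂(iid ι μ) =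
      ∫ z, f z ^ 2 ∂(iid ι μ) - ∫ z, avg μ j f z ^ 2 ∂(iid ι μ) := by
  have h := integral_mul_eq_avg (μ := μ) (free_avg (μ := μ) j f) (hf.avg (μ := μ) j) hf
  have h2 : ∀ z, (f z - avg μ j f z) ^ 2 =
    (f z ^ 2 - 2 * (avg μ j f z * f z)) + avg μ j f z * avg μ j f z := fun z => by ring
  simp_rw [h2]
  have b1 := hf.pow 2
  have b2 := ((hf.avg (μ := μ) j).mul hf).const_mul 2
  have b3 := (hf.avg (μ := μ) j).mul (hf.avg (μ := μ) j)
  rw [integral_add ((b1.sub b2).integrable _) (b3.integrable _),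
    integral_sub (b1.integrable _) (b2.integrable _), integral_const_mul, h]
  simp_rw [pow_two]
  ring

/-- Averaging over $j$ is the $L^2$-projection onto functions free of $j$; Pythagoras is applied to
$f-g$. -/
theorem integral_sq_sub_avg_le {f g : (ι → E) → ℝ} (hf : BddMeasurable f) (hg : BddMeasurable g)
    {j : ι} (hfree : Free j g) :
    ∫ z, (f z - avg μ j f z) ^ 2 ∂(iid ι μ) ≤ ∫ z, (f z - g z) ^ 2 ∂(iid ι μ) := by
  have h1 := integral_sq_sub_avg (μ := μ) (hf.sub hg) j
  have h2 : ∀ z, avg μ j (fun z => f z - g z) z = avg μ j f z - g z := fun z => by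
    rw [avg_sub hf hg]
    congr 1
    unfold avg
    simp_rw [hfree z]
    simp
  have h3 : 0 ≤ ∫ z, avg μ j (fun z => f z - g z) z ^ 2 ∂(iid ι μ) :=
    integral_nonneg fun z => sq_nonneg _
  simp_rw [h2] at h1 h3
  have h4 : ∀ z, (f z - g z - (avg μ j f z - g z)) ^ 2 = (f z - avg μ j f z) ^ 2 :=
    fun z => by ring
  simp_rw [h4] at h1
  linarith

/-- Induction on the set of coordinates on which $g$ may depend. Averaging over $a$ splits the
second moment into $E(g-\mathrm{avg}_a g)^2$, which is at most $E(g-g_a)^2$ by the projection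
property, and the second moment of $\mathrm{avg}_a g$. The induction hypothesis applies to the
latter, since averaging is an $L^2$-contraction and preserves freeness of the comparison functions.
-/
theorem efronStein_aux (s : Finset ι) (g : (ι → E) → ℝ) (hg : BddMeasurable g)
    (gj : ι → (ι → E) → ℝ) (hgj : ∀ j, BddMeasurable (gj j)) (hfree : ∀ j, Free j (gj j))
    (hs : ∀ j ∉ s, Free j g) :
    ∫ z, g z ^ 2 ∂(iid ι μ) - (∫ z, g z ∂(iid ι μ)) ^ 2 ≤
      ∑ j ∈ s, ∫ z, (g z - gj j z) ^ 2 ∂(iid ι μ) := by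
  induction s using Finset.induction_on generalizing g gj with
  | empty =>
    have hne : Nonempty E := μ.nonempty_of_neZero
    obtain ⟨e⟩ := hne
    -- A function free of every coordinate is constant: the coordinates are overwritten by `e` one
    -- at a time.
    have hconst : ∀ z, g z = g (fun _ => e) := by
      have key : ∀ (t : Finset ι) (z : ι → E), g (fun i => if i ∈ t then e else z i) = g z := by
        intro t z
        induction t using Finset.induction_on with
        | empty => simp
        | insert a t ha ih =>
          rw [← ih, ← hs a (by simp) (fun i => if i ∈ t then e else z i) e]
          congr 1; ext i
          by_cases hia : i = a
          · subst hia; simp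
          · simp [hia]
      intro z
      simpa using (key Finset.univ z).symm
    have : g = fun _ => g (fun _ => e) := funext hconst
    rw [this]
    simp
  | insert a s ha ih =>
    have h1 := ih (avg μ a g) (hg.avg a) (fun i => avg μ a (gj i)) (fun i => (hgj i).avg a)
      (fun i => (hfree i).avg a) (fun j hj => by
        by_cases hja : j = a
        · subst hja; exact free_avg _ _
        · exact (hs j (by simp [hja, hj])).avg a)
    rw [integral_avg hg] at h1
    have h2 := integral_sq_sub_avg (μ := μ) hg a
    have h3 := integral_sq_sub_avg_le (μ := μ) hg (hgj a) (hfree a)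
    rw [Finset.sum_insert ha]
    have h4 : ∑ j ∈ s, ∫ z, (avg μ a g z - avg μ a (gj j) z) ^ 2 ∂(iid ι μ) ≤
        ∑ j ∈ s, ∫ z, (g z - gj j z) ^ 2 ∂(iid ι μ) := by
      refine Finset.sum_le_sum fun j _ => ?_
      have := integral_sq_avg_le (μ := μ) (hg.sub (hgj j)) a
      simp_rw [avg_sub hg (hgj j)] at this
      exact this
    linarith

/-- The Efron–Stein inequality, in its leave-one-out form. -/
theorem efronStein {g : (ι → E) → ℝ} (hg : BddMeasurable g)
    (gj : ι → (ι → E) → ℝ) (hgj : ∀ j, BddMeasurable (gj j)) (hfree : ∀ j, Free j (gj j)) :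
    ∫ z, (g z - ∫ w, g w ∂(iid ι μ)) ^ 2 ∂(iid ι μ) ≤
      ∑ j, ∫ z, (g z - gj j z) ^ 2 ∂(iid ι μ) := by
  rw [integral_sq_sub_integral _ hg]
  exact efronStein_aux Finset.univ g hg gj hgj hfree (by simp)

/-! ### Independence of functions of disjoint sets of coordinates -/

theorem dependsOn_free {β : Type*} {f : (ι → E) → β} {s : Set ι} (hf : DependsOn f s) {j : ι}
    (hj : j ∉ s) : Free j f := by
  intro z w
  apply hf
  intro i hi
  rw [Function.update_of_ne]
  rintro rfl
  exact hj hi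

theorem integral_mul_of_dependsOn {𝕜 : Type*} [RCLike 𝕜]
    {f g : (ι → E) → 𝕜}
    (hf : Measurable f) (hg : Measurable g) {s t : Finset ι} (hst : Disjoint s t)
    (hfs : DependsOn f (s : Set ι)) (hgt : DependsOn g (t : Set ι)) :
    ∫ z, f z * g z ∂(iid ι μ) = (∫ z, f z ∂(iid ι μ)) * ∫ z, g z ∂(iid ι μ) := by
  obtain ⟨e⟩ : Nonempty E := μ.nonempty_of_neZero
  have hind : iIndepFun (fun (i : ι) (z : ι → E) => z i) (iid ι μ) :=
    iIndepFun_pi (X := fun _ => id) (fun _ => aemeasurable_id)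
  have h := hind.indepFun_finset s t hst (fun i => measurable_pi_apply i)
  -- Filling the remaining coordinates with a fixed `e` exhibits $f$ and $g$ as measurable functions
  -- of the restrictions to `s` and `t`, which are independent.
  let ext (r : Finset ι) (v : r → E) : ι → E := fun i => if hi : i ∈ r then v ⟨i, hi⟩ else e
  have hext : ∀ r : Finset ι, Measurable (ext r) := fun r => by
    refine measurable_pi_lambda _ fun i => ?_
    by_cases hi : i ∈ r
    · simp only [ext, hi, dif_pos]; exact measurable_pi_apply _
    · simp only [ext, hi, dif_neg, not_false_eq_true]; exact measurable_const
  have h2 := h.comp (hf.comp (hext s)) (hg.comp (hext t))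
  have e1 : (f ∘ ext s) ∘ (fun (z : ι → E) (i : s) => z i) = f := by
    ext z
    apply hfs
    intro i hi
    have hi' : i ∈ s := hi
    simp [ext, hi']
  have e2 : (g ∘ ext t) ∘ (fun (z : ι → E) (i : t) => z i) = g := by
    ext z
    apply hgt
    intro i hi
    have hi' : i ∈ t := hi
    simp [ext, hi']
  rw [e1, e2] at h2
  exact h2.integral_fun_mul_eq_mul_integral hf.aestronglyMeasurable hg.aestronglyMeasurable

end Product

end RankBootstrap

namespace RankBootstrap

/-! ### A central limit theorem for locally dependent sums -/

/-- `x ↦ exp (i x)` on the real line. -/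
noncomputable def cis (x : ℝ) : ℂ := Complex.exp (Complex.I * x)

theorem norm_cis (x : ℝ) : ‖cis x‖ = 1 := Complex.norm_exp_I_mul_ofReal x

theorem cis_add (x y : ℝ) : cis (x + y) = cis x * cis y := by
  simp [cis, mul_add, Complex.exp_add]

theorem continuous_cis : Continuous cis := by unfold cis; fun_prop

theorem measurable_cis : Measurable cis := continuous_cis.measurable

theorem norm_cis_sub_one_le (x : ℝ) : ‖cis x - 1‖ ≤ |x| :=
  Real.norm_exp_I_mul_ofReal_sub_one_le

theorem norm_cis_sub_cis_le (x y : ℝ) : ‖cis x - cis y‖ ≤ |x - y| := by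
  have : cis x - cis y = cis y * (cis (x - y) - 1) := by
    rw [mul_sub, ← cis_add]; simp
  rw [this, norm_mul, norm_cis, one_mul]
  exact norm_cis_sub_one_le _

/-- Taylor expansion for $|x|\le1$; for $|x|>1$ the trivial bound $2|x|$ is already below $2x^2$. -/
theorem norm_cis_sub_one_sub_le (x : ℝ) : ‖cis x - 1 - Complex.I * x‖ ≤ 2 * x ^ 2 := by
  by_cases hx : |x| ≤ 1
  · have := Complex.norm_exp_sub_one_sub_id_le (x := Complex.I * x) (by simpa using hx)
    refine this.trans ?_
    simp
    nlinarith [sq_nonneg x]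
  · push Not at hx
    calc ‖cis x - 1 - Complex.I * x‖ ≤ ‖cis x - 1‖ + ‖Complex.I * x‖ := norm_sub_le _ _
      _ ≤ |x| + |x| := add_le_add (norm_cis_sub_one_le x) (by simp)
      _ ≤ 2 * |x| ^ 2 := by nlinarith
      _ = 2 * x ^ 2 := by rw [sq_abs]

theorem integrable_of_norm_le {Ω : Type*} [MeasurableSpace Ω] (P : Measure Ω)
    [IsFiniteMeasure P] {f : Ω → ℂ} (hf : Measurable f) {C : ℝ} (hC : ∀ z, ‖f z‖ ≤ C) :
    Integrable f P :=
  Integrable.of_bound hf.aestronglyMeasurable C (Eventually.of_forall hC)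

theorem norm_integral_le_const {Ω : Type*} [MeasurableSpace Ω] (P : Measure Ω)
    [IsProbabilityMeasure P] {f : Ω → ℂ} {C : ℝ} (hC : ∀ z, ‖f z‖ ≤ C) :
    ‖∫ z, f z ∂P‖ ≤ C := by
  simpa using norm_integral_le_of_norm_le_const (μ := P) (f := f) (Eventually.of_forall hC)

theorem hasDerivAt_integral_cis {Ω : Type*} [MeasurableSpace Ω] (P : Measure Ω)
    [IsProbabilityMeasure P] {W : Ω → ℝ} (hW : BddMeasurable W) (t : ℝ) :
    HasDerivAt (fun t : ℝ => ∫ z, cis (t * W z) ∂P)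
      (∫ z, Complex.I * (W z * cis (t * W z)) ∂P) t := by
  obtain ⟨C, hC⟩ := hW.bdd
  have hm := hW.measurable
  have hmc : ∀ t : ℝ, Measurable fun z => cis (t * W z) := fun t =>
    measurable_cis.comp (measurable_const.mul hm)
  refine (hasDerivAt_integral_of_dominated_loc_of_deriv_le (μ := P)
    (F := fun (t : ℝ) z => cis (t * W z))
    (F' := fun (t : ℝ) z => Complex.I * (W z * cis (t * W z)))
    (bound := fun _ => C) (s := Set.univ) Filter.univ_mem
    (Eventually.of_forall fun t => (hmc t).aestronglyMeasurable)
    (integrable_of_norm_le P (hmc t) (C := 1) fun z => (norm_cis _).le)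
    ?_ (Eventually.of_forall fun z t _ => ?_) (integrable_const C)
    (Eventually.of_forall fun z t _ => ?_)).2
  · exact (measurable_const.mul ((Complex.measurable_ofReal.comp hm).mul
      (hmc t))).aestronglyMeasurable
  · simpa [norm_cis] using hC z
  · have h1 : HasDerivAt (fun t : ℝ => Complex.I * ((t * W z : ℝ) : ℂ)) (Complex.I * W z) t := by
      have : HasDerivAt (fun t : ℝ => ((t * W z : ℝ) : ℂ)) (W z : ℂ) t := by
        simpa using ((hasDerivAt_id t).mul_const (W z)).ofReal_comp
      exact this.const_mul Complex.I
    have h2 := h1.cexp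
    refine h2.congr_deriv ?_
    simp only [cis]; ring

/-- If the characteristic function of `W` nearly satisfies the differential equation of the normal
characteristic function, then it is close to it. -/
theorem norm_sub_exp_le_of_deriv {f f' : ℝ → ℂ} {v R : ℝ} (hv : 0 ≤ v) (hR : 0 ≤ R)
    (h0 : f 0 = 1) (hf : ∀ t, HasDerivAt f (f' t) t)
    (hb : ∀ t, ‖f' t + (t * v : ℝ) * f t‖ ≤ R * t ^ 2) (t : ℝ) :
    ‖f t - Complex.exp (-(v * t ^ 2 / 2 : ℝ))‖ ≤ R * |t| ^ 3 := by
  -- The integrating factor $e^{vs^2/2}$ turns the approximate equation into a bound on a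
  -- derivative. The mean value inequality produces a factor $e^{vt^2/2}$, which the final
  -- multiplication by $e^{-vt^2/2}$ cancels.
  have hg : ∀ s : ℝ, HasDerivAt (fun s : ℝ => f s * Complex.exp ((v * s ^ 2 / 2 : ℝ)))
      ((f' s + (s * v : ℝ) * f s) * Complex.exp ((v * s ^ 2 / 2 : ℝ))) s := fun s => by
    have h1 : HasDerivAt (fun s : ℝ => ((v * s ^ 2 / 2 : ℝ) : ℂ)) ((s * v : ℝ) : ℂ) s := by
      have : HasDerivAt (fun s : ℝ => v * s ^ 2 / 2) (s * v) s := by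
        refine ((((hasDerivAt_id s).pow 2).const_mul v).div_const 2).congr_deriv ?_
        simp; ring
      exact this.ofReal_comp
    refine ((hf s).mul h1.cexp).congr_deriv ?_
    ring
  have hbound : ∀ s ∈ Set.uIcc 0 t,
      ‖(f' s + (s * v : ℝ) * f s) * Complex.exp ((v * s ^ 2 / 2 : ℝ))‖ ≤
        R * t ^ 2 * Real.exp (v * t ^ 2 / 2) := fun s hs => by
    have hst : |s| ≤ |t| := by
      have := Set.abs_sub_left_of_mem_uIcc hs
      simpa using this
    have hs2 : s ^ 2 ≤ t ^ 2 := sq_le_sq.mpr hst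
    rw [norm_mul, ← Complex.ofReal_exp, Complex.norm_real, Real.norm_eq_abs,
      abs_of_pos (Real.exp_pos _)]
    refine mul_le_mul ((hb s).trans (by gcongr)) (Real.exp_le_exp.mpr (by gcongr))
      (Real.exp_pos _).le (by positivity)
  have key := Convex.norm_image_sub_le_of_norm_hasDerivWithin_le
    (fun s _ => (hg s).hasDerivWithinAt) hbound (convex_uIcc 0 t) Set.left_mem_uIcc
    Set.right_mem_uIcc
  simp only [h0, ne_eq, OfNat.ofNat_ne_zero, not_false_eq_true, zero_pow, mul_zero, zero_div,
    Complex.ofReal_zero, Complex.exp_zero, mul_one, sub_zero, Real.norm_eq_abs] at key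
  have hfac : f t - Complex.exp (-(v * t ^ 2 / 2 : ℝ)) =
      (f t * Complex.exp ((v * t ^ 2 / 2 : ℝ)) - 1) * Complex.exp (-(v * t ^ 2 / 2 : ℝ)) := by
    rw [sub_mul, mul_assoc, ← Complex.exp_add]; simp
  rw [hfac, norm_mul]
  have hn : ‖Complex.exp (-((v * t ^ 2 / 2 : ℝ) : ℂ))‖ = Real.exp (-(v * t ^ 2 / 2)) := by
    rw [← Complex.ofReal_neg, ← Complex.ofReal_exp, Complex.norm_real, Real.norm_eq_abs,
      abs_of_pos (Real.exp_pos _)]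
  rw [hn]
  calc _ ≤ R * t ^ 2 * Real.exp (v * t ^ 2 / 2) * |t| * Real.exp (-(v * t ^ 2 / 2)) := by gcongr
    _ = R * |t| ^ 3 * (Real.exp (v * t ^ 2 / 2) * Real.exp (-(v * t ^ 2 / 2))) := by
        rw [← sq_abs t]; ring
    _ = R * |t| ^ 3 := by rw [← Real.exp_add]; simp

section Local

variable {ι E A : Type*} [Fintype ι] [DecidableEq ι] [MeasurableSpace E]
  {μ : Measure E} [IsProbabilityMeasure μ]

open Classical in
/-- The terms whose set of coordinates meets `S`. -/
noncomputable def touching (𝒜 : Finset A) (T : A → Finset ι) (S : Finset ι) : Finset A :=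
  𝒜.filter fun b => ¬ Disjoint (T b) S

theorem card_touching_le [DecidableEq A] (𝒜 : Finset A) (T : A → Finset ι) {K : ℕ}
    (hK : ∀ i, (𝒜.filter fun b => i ∈ T b).card ≤ K) (S : Finset ι) :
    (touching 𝒜 T S).card ≤ S.card * K := by
  have : touching 𝒜 T S ⊆ S.biUnion fun i => 𝒜.filter fun b => i ∈ T b := by
    intro b hb
    simp only [touching, Finset.mem_filter, Finset.not_disjoint_iff] at hb
    obtain ⟨hb, i, hi, hiS⟩ := hb
    simp only [Finset.mem_biUnion, Finset.mem_filter]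
    exact ⟨i, hiS, hb, hi⟩
  exact (Finset.card_le_card this).trans (Finset.card_biUnion_le_card_mul _ _ _ fun i _ => hK i)

theorem dependsOn_sum {s : Finset A} {f : A → (ι → E) → ℝ} {T : A → Finset ι} {S : Set ι}
    (hf : ∀ a, DependsOn (f a) (T a : Set ι)) (h : ∀ a ∈ s, (T a : Set ι) ⊆ S) :
    DependsOn (fun z => ∑ a ∈ s, f a z) S := by
  intro z w hzw
  exact Finset.sum_congr rfl fun a ha => hf a fun i hi => hzw i (h a ha hi)

theorem abs_sum_le_card_mul {s : Finset A} {f : A → ℝ} {ε : ℝ} (h : ∀ a ∈ s, |f a| ≤ ε) :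
    |∑ a ∈ s, f a| ≤ s.card * ε := by
  refine (Finset.abs_sum_le_sum_abs _ _).trans ?_
  simpa using Finset.sum_le_card_nsmul s _ ε h

/-- The basic estimate of Tikhomirov's method: a single summand `X` of a locally dependent sum.
`W₂`, `W₁`, `W` are the sums of the terms outside the second neighbourhood of `X`, outside the first
neighbourhood, and of all terms. -/
theorem tikhomirov_term {X S W₁ W₂ W : (ι → E) → ℝ} {T T' : Finset ι} {ε β : ℝ}
    (hX : Measurable X) (hW₁ : Measurable W₁) (hW₂ : Measurable W₂) (hS : Measurable S)
    (hW : ∀ z, W z = W₁ z + S z) (hε : ∀ z, |X z| ≤ ε) (hβ : ∀ z, |S z| ≤ β)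
    (h₁₂ : ∀ z, |W₁ z - W₂ z| ≤ β) (h₂ : ∀ z, |W z - W₂ z| ≤ β)
    (h0 : ∫ z, X z ∂(iid ι μ) = 0)
    (hXT : DependsOn X (T : Set ι)) (hST : DependsOn (fun z => X z * S z) (T' : Set ι))
    (hW₁T : DependsOn W₁ ((Tᶜ : Finset ι) : Set ι))
    (hW₂T : DependsOn W₂ ((T'ᶜ : Finset ι) : Set ι)) (t : ℝ) :
    ‖∫ z, Complex.I * (X z * cis (t * W z)) ∂(iid ι μ) +
      ((t * ∫ z, X z * S z ∂(iid ι μ) : ℝ) : ℂ) * ∫ z, cis (t * W z) ∂(iid ι μ)‖ ≤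
      4 * ε * β ^ 2 * t ^ 2 := by
  set P := iid ι μ with hP
  obtain ⟨e⟩ : Nonempty E := μ.nonempty_of_neZero
  have hε0 : 0 ≤ ε := (abs_nonneg _).trans (hε fun _ => e)
  have hβ0 : 0 ≤ β := (abs_nonneg _).trans (hβ fun _ => e)
  have hWm : Measurable W := by
    rw [show W = fun z => W₁ z + S z from funext hW]; exact hW₁.add hS
  have mc : ∀ {U : (ι → E) → ℝ}, Measurable U → Measurable fun z => cis (t * U z) := fun hU =>
    measurable_cis.comp (measurable_const.mul hU)
  have mX : Measurable fun z => (X z : ℂ) := Complex.measurable_ofReal.comp hX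
  have mS : Measurable fun z => (S z : ℂ) := Complex.measurable_ofReal.comp hS
  have hcomp : ∀ {U : (ι → E) → ℝ} {R : Set ι}, DependsOn U R →
      DependsOn (fun z => cis (t * U z)) R := fun hU z w h => by
    simp only [hU h]
  -- the two factorizations
  have i1 : ∫ z, (X z : ℂ) * cis (t * W₁ z) ∂P = 0 := by
    have := integral_mul_of_dependsOn (μ := μ) (f := fun z => (X z : ℂ))
      (g := fun z => cis (t * W₁ z)) mX (mc hW₁) (s := T) (t := Tᶜ) disjoint_compl_right
      (fun z w h => by simp only [hXT h]) (hcomp hW₁T)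
    rw [this, integral_complex_ofReal, h0]; simp
  have i2 : ∫ z, ((X z * S z : ℝ) : ℂ) * cis (t * W₂ z) ∂P =
      ((∫ z, X z * S z ∂P : ℝ) : ℂ) * ∫ z, cis (t * W₂ z) ∂P := by
    have := integral_mul_of_dependsOn (μ := μ) (f := fun z => ((X z * S z : ℝ) : ℂ))
      (g := fun z => cis (t * W₂ z)) (Complex.measurable_ofReal.comp (hX.mul hS)) (mc hW₂)
      (s := T') (t := T'ᶜ) disjoint_compl_right
      (fun z w h => by have := hST h; simp only at this; simp only [this]) (hcomp hW₂T)
    rw [this, integral_complex_ofReal]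
  have bXS : ∀ z, |X z * S z| ≤ ε * β := fun z => by
    rw [abs_mul]; exact mul_le_mul (hε z) (hβ z) (abs_nonneg _) hε0
  -- error terms
  let e1 : (ι → E) → ℂ := fun z =>
    Complex.I * X z * cis (t * W₁ z) * (cis (t * S z) - 1 - Complex.I * (t * S z : ℝ))
  let e2 : (ι → E) → ℂ := fun z => (-(t * (X z * S z)) : ℝ) * (cis (t * W₁ z) - cis (t * W₂ z))
  let e3 : (ι → E) → ℂ := fun z => cis (t * W₂ z) - cis (t * W z)
  have b1 : ∀ z, ‖e1 z‖ ≤ 2 * ε * β ^ 2 * t ^ 2 := fun z => by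
    simp only [e1, norm_mul, norm_cis, Complex.norm_I, Complex.norm_real, Real.norm_eq_abs,
      one_mul, mul_one]
    calc |X z| * _ ≤ ε * (2 * (t * S z) ^ 2) :=
          mul_le_mul (hε z) (norm_cis_sub_one_sub_le _) (norm_nonneg _) hε0
      _ = ε * (2 * t ^ 2 * |S z| ^ 2) := by rw [sq_abs]; ring
      _ ≤ ε * (2 * t ^ 2 * β ^ 2) := by gcongr; exact hβ z
      _ = _ := by ring
  have b2 : ∀ z, ‖e2 z‖ ≤ ε * β ^ 2 * t ^ 2 := fun z => by
    simp only [e2, norm_mul, Complex.norm_real, Real.norm_eq_abs, abs_neg]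
    calc |t * (X z * S z)| * _ ≤ |t| * (ε * β) * |t * W₁ z - t * W₂ z| := by
          rw [abs_mul]
          exact mul_le_mul (mul_le_mul_of_nonneg_left (bXS z) (abs_nonneg _))
            (norm_cis_sub_cis_le _ _) (norm_nonneg _) (by positivity)
      _ = |t| ^ 2 * (ε * β) * |W₁ z - W₂ z| := by rw [← mul_sub, abs_mul]; ring
      _ ≤ |t| ^ 2 * (ε * β) * β := by gcongr; exact h₁₂ z
      _ = _ := by rw [sq_abs]; ring
  have b3 : ∀ z, ‖e3 z‖ ≤ |t| * β := fun z => by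
    refine (norm_cis_sub_cis_le _ _).trans ?_
    rw [← mul_sub, abs_mul, abs_sub_comm]
    gcongr
    exact h₂ z
  have m1 : Measurable e1 := (((measurable_const.mul mX).mul (mc hW₁)).mul
    (((mc hS).sub_const 1).sub (measurable_const.mul
      (Complex.measurable_ofReal.comp (measurable_const.mul hS)))))
  have m2 : Measurable e2 := (Complex.measurable_ofReal.comp
    (measurable_const.mul (hX.mul hS)).neg).mul ((mc hW₁).sub (mc hW₂))
  have m3 : Measurable e3 := (mc hW₂).sub (mc hWm)
  -- Expand $e^{itW}=e^{itW_1}e^{itS}$ to first order in $S$, with error `e1`. The zeroth-order term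
  -- has mean zero because $X$ is centred and independent of $W_1$. In the first-order term
  -- $-tXSe^{itW_1}$, replacing $W_1$ by $W_2$ costs `e2` and makes the exponential independent of
  -- $XS$.
  have decomp : ∀ z, Complex.I * (X z * cis (t * W z)) =
      Complex.I * (X z * cis (t * W₁ z)) + (e1 z + (e2 z +
        (-(t : ℂ)) * (((X z * S z : ℝ) : ℂ) * cis (t * W₂ z)))) := fun z => by
    simp only [e1, e2, hW z, mul_add, cis_add]
    push_cast
    linear_combination ((X z : ℂ) * cis (t * W₁ z) * (t * S z)) * Complex.I_mul_I
  have n1 : Integrable (fun z => (X z : ℂ) * cis (t * W₁ z)) P :=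
    integrable_of_norm_le P (mX.mul (mc hW₁)) (C := ε) fun z => by
      simpa [norm_cis] using hε z
  have n2 : Integrable (fun z => ((X z * S z : ℝ) : ℂ) * cis (t * W₂ z)) P :=
    integrable_of_norm_le P ((Complex.measurable_ofReal.comp (hX.mul hS)).mul (mc hW₂))
      (C := ε * β) fun z => by
        rw [norm_mul, norm_cis, mul_one, Complex.norm_real]; exact bXS z
  have j1 := integrable_of_norm_le P m1 b1
  have j2 := integrable_of_norm_le P m2 b2
  have j3 : ∫ z, cis (t * W₂ z) ∂P = ∫ z, cis (t * W z) ∂P + ∫ z, e3 z ∂P := by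
    rw [integral_sub
      (integrable_of_norm_le P (mc hW₂) (C := 1) fun z => (norm_cis _).le)
      (integrable_of_norm_le P (mc hWm) (C := 1) fun z => (norm_cis _).le)]
    ring
  have k2 : Integrable (fun z => e2 z + -(t : ℂ) * (((X z * S z : ℝ) : ℂ) * cis (t * W₂ z))) P :=
    j2.add (n2.const_mul _)
  have k1 : Integrable (fun z => e1 z + (e2 z +
    -(t : ℂ) * (((X z * S z : ℝ) : ℂ) * cis (t * W₂ z)))) P := j1.add k2
  simp_rw [decomp]
  rw [integral_add (n1.const_mul _) k1, integral_const_mul, i1,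
    mul_zero, zero_add, integral_add j1 k2, integral_add j2 (n2.const_mul _), integral_const_mul, i2, j3]
  have c : ‖((∫ z, X z * S z ∂P : ℝ) : ℂ)‖ ≤ ε * β := by
    rw [Complex.norm_real]
    simpa using norm_integral_le_of_norm_le_const (μ := P) (f := fun z => X z * S z)
      (Eventually.of_forall bXS)
  have e3n : ‖(-(t : ℂ)) * (((∫ z, X z * S z ∂P : ℝ) : ℂ) * ∫ z, e3 z ∂P)‖ ≤
      ε * β ^ 2 * t ^ 2 := by
    rw [norm_mul, norm_mul, norm_neg, Complex.norm_real, Real.norm_eq_abs]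
    calc _ ≤ |t| * (ε * β * (|t| * β)) := by
          gcongr
          exact norm_integral_le_const P b3
      _ = _ := by rw [← sq_abs t]; ring
  have heq : ∫ z, e1 z ∂P + (∫ z, e2 z ∂P + -(t : ℂ) * (((∫ z, X z * S z ∂P : ℝ) : ℂ) *
        (∫ z, cis (t * W z) ∂P + ∫ z, e3 z ∂P))) +
      ((t * ∫ z, X z * S z ∂P : ℝ) : ℂ) * ∫ z, cis (t * W z) ∂P =
      ∫ z, e1 z ∂P + ∫ z, e2 z ∂P +
        (-(t : ℂ)) * (((∫ z, X z * S z ∂P : ℝ) : ℂ) * ∫ z, e3 z ∂P) := by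
    push_cast; ring
  rw [heq]
  -- The errors from `e1`, `e2` and `e3` contribute $2$, $1$ and $1$ times $\varepsilon\beta^2t^2$.
  refine (norm_add₃_le).trans ?_
  linarith [norm_integral_le_const P b1, norm_integral_le_const P b2]

/-- A quantitative central limit theorem for sums of bounded centred terms, each of which depends
on at most `L` coordinates, while each coordinate enters at most `K` terms. -/
theorem norm_integral_cis_sub_le [DecidableEq A] (𝒜 : Finset A) {ζ : A → (ι → E) → ℝ}
    {T : A → Finset ι} {ε : ℝ} {K L : ℕ} (hm : ∀ a, Measurable (ζ a)) (hε : ∀ a z, |ζ a z| ≤ ε)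
    (hT : ∀ a, DependsOn (ζ a) (T a : Set ι)) (hL : ∀ a, (T a).card ≤ L)
    (hK : ∀ i, (𝒜.filter fun b => i ∈ T b).card ≤ K) (h0 : ∀ a, ∫ z, ζ a z ∂(iid ι μ) = 0)
    (t : ℝ) :
    ‖∫ z, cis (t * ∑ a ∈ 𝒜, ζ a z) ∂(iid ι μ) -
      Complex.exp (-((∫ z, (∑ a ∈ 𝒜, ζ a z) ^ 2 ∂(iid ι μ)) * t ^ 2 / 2 : ℝ))‖ ≤
      4 * 𝒜.card * ε ^ 3 * (L * K * L * K) ^ 2 * |t| ^ 3 := by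
  set P := iid ι μ with hP
  obtain ⟨e⟩ : Nonempty E := μ.nonempty_of_neZero
  rcases 𝒜.eq_empty_or_nonempty with rfl | ⟨a₀, ha₀⟩
  · simp [cis]
  have hε0 : 0 ≤ ε := (abs_nonneg _).trans (hε a₀ fun _ => e)
  set W : (ι → E) → ℝ := fun z => ∑ a ∈ 𝒜, ζ a z with hWdef
  have hζb : ∀ a, BddMeasurable (ζ a) := fun a => ⟨hm a, ε, hε a⟩
  have hWb : BddMeasurable W := BddMeasurable.finsetSum _ fun a _ => hζb a
  let N1 : A → Finset A := fun a => touching 𝒜 T (T a)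
  -- For $a\in\mathcal A$ the union with `T a` adds nothing; it makes the inclusion `hN12` hold for
  -- every index $a$.
  let U : A → Finset ι := fun a => (N1 a).biUnion T ∪ T a
  let N2 : A → Finset A := fun a => touching 𝒜 T (U a)
  have hN1 : ∀ a, N1 a ⊆ 𝒜 := fun a => Finset.filter_subset _ _
  have hN2 : ∀ a, N2 a ⊆ 𝒜 := fun a => Finset.filter_subset _ _
  have hN12 : ∀ a, N1 a ⊆ N2 a := fun a b hb => by
    simp only [N1, N2, touching, Finset.mem_filter] at hb ⊢
    refine ⟨hb.1, fun h => hb.2 (h.mono_right ?_)⟩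
    exact Finset.subset_union_right
  let S : A → (ι → E) → ℝ := fun a z => ∑ b ∈ N1 a, ζ b z
  let W₁ : A → (ι → E) → ℝ := fun a z => ∑ b ∈ 𝒜 \ N1 a, ζ b z
  let W₂ : A → (ι → E) → ℝ := fun a z => ∑ b ∈ 𝒜 \ N2 a, ζ b z
  have hS : ∀ a, BddMeasurable (S a) := fun a => BddMeasurable.finsetSum _ fun a _ => hζb a
  have hW₁ : ∀ a, BddMeasurable (W₁ a) := fun a => BddMeasurable.finsetSum _ fun a _ => hζb a
  have hW₂ : ∀ a, BddMeasurable (W₂ a) := fun a => BddMeasurable.finsetSum _ fun a _ => hζb a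
  have hWS : ∀ a z, W z = W₁ a z + S a z := fun a z => (Finset.sum_sdiff (hN1 a)).symm
  -- A term has at most $L$ coordinates, which are touched by at most $LK$ terms; these occupy at
  -- most $LKL$ coordinates, touched by at most $LKLK$ terms.
  set M : ℝ := L * K * L * K with hM
  have hcard1 : ∀ a, (N1 a).card ≤ L * K := fun a =>
    (card_touching_le 𝒜 T hK _).trans (Nat.mul_le_mul_right _ (hL a))
  have hK1 : ∀ a ∈ 𝒜, (T a).Nonempty → 1 ≤ K := fun a ha ⟨i, hi⟩ =>
    (Finset.card_pos.mpr ⟨a, by simp [ha, hi]⟩ : 0 < _).trans_le (hK i)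
  have hU : ∀ a ∈ 𝒜, (U a) = (N1 a).biUnion T := fun a ha => by
    refine Finset.union_eq_left.mpr fun i hi => ?_
    refine Finset.mem_biUnion.mpr ⟨a, ?_, hi⟩
    simp only [N1, touching, Finset.mem_filter]
    exact ⟨ha, Finset.not_disjoint_iff.mpr ⟨i, hi, hi⟩⟩
  have hcard2 : ∀ a ∈ 𝒜, ((N2 a).card : ℝ) ≤ M := fun a ha => by
    have h1 : (U a).card ≤ L * K * L := by
      rw [hU a ha]
      exact (Finset.card_biUnion_le_card_mul _ _ _ fun b _ => hL b).trans
        (Nat.mul_le_mul_right _ (hcard1 a))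
    have h2 : (N2 a).card ≤ L * K * L * K :=
      (card_touching_le 𝒜 T hK _).trans (Nat.mul_le_mul_right _ h1)
    rw [hM]; exact_mod_cast h2
  have hcard1' : ∀ a ∈ 𝒜, ((N1 a).card : ℝ) ≤ M := fun a ha =>
    (Nat.cast_le.mpr (Finset.card_le_card (hN12 a))).trans (hcard2 a ha)
  have hM0 : 0 ≤ M := by positivity
  have hterm : ∀ a ∈ 𝒜, ∀ t : ℝ, ‖∫ z, Complex.I * (ζ a z * cis (t * W z)) ∂P +
      ((t * ∫ z, ζ a z * S a z ∂P : ℝ) : ℂ) * ∫ z, cis (t * W z) ∂P‖ ≤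
      4 * ε * (M * ε) ^ 2 * t ^ 2 := fun a ha t => by
    refine tikhomirov_term (W₁ := W₁ a) (W₂ := W₂ a) (T := T a) (T' := U a) (hm a)
      (hW₁ a).measurable (hW₂ a).measurable (hS a).measurable (hWS a) (hε a) (fun z => ?_)
      (fun z => ?_) (fun z => ?_) (h0 a) (hT a) ?_ ?_ ?_ t
    · exact (abs_sum_le_card_mul fun b _ => hε b z).trans
        (mul_le_mul_of_nonneg_right (hcard1' a ha) hε0)
    · have : W₁ a z - W₂ a z = ∑ b ∈ N2 a \ N1 a, ζ b z := by
        have e1 : 𝒜 \ N2 a ⊆ 𝒜 \ N1 a := Finset.sdiff_subset_sdiff le_rfl (hN12 a)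
        simp only [W₁, W₂]
        rw [← Finset.sum_sdiff e1, add_sub_cancel_right]
        refine Finset.sum_congr ?_ fun _ _ => rfl
        ext b
        have := @hN2 a b
        simp only [Finset.mem_sdiff]
        tauto
      rw [this]
      refine (abs_sum_le_card_mul fun b _ => hε b z).trans
        (mul_le_mul_of_nonneg_right (le_trans ?_ (hcard2 a ha)) hε0)
      exact Nat.cast_le.mpr (Finset.card_le_card Finset.sdiff_subset)
    · have : W z - W₂ a z = ∑ b ∈ N2 a, ζ b z := by
        simp only [W, W₂]
        rw [← Finset.sum_sdiff (hN2 a), add_sub_cancel_left]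
      rw [this]
      exact (abs_sum_le_card_mul fun b _ => hε b z).trans
        (mul_le_mul_of_nonneg_right (hcard2 a ha) hε0)
    · intro z w h
      have h1 : ζ a z = ζ a w := hT a fun i hi => h i (Finset.mem_union_right _ hi)
      have h2 : S a z = S a w := dependsOn_sum hT (S := (U a : Set ι)) (fun b hb i hi =>
        Finset.mem_union_left _ (Finset.mem_biUnion.mpr ⟨b, hb, hi⟩)) h
      simp only [h1, h2]
    · refine dependsOn_sum hT fun b hb i hi => ?_
      simp only [Finset.mem_sdiff, N1, touching, Finset.mem_filter, not_and, not_not] at hb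
      simp only [Finset.coe_compl, Set.mem_compl_iff, Finset.mem_coe]
      exact Finset.disjoint_left.mp (hb.2 hb.1) hi
    · refine dependsOn_sum hT fun b hb i hi => ?_
      simp only [Finset.mem_sdiff, N2, touching, Finset.mem_filter, not_and, not_not] at hb
      simp only [Finset.coe_compl, Set.mem_compl_iff, Finset.mem_coe]
      exact Finset.disjoint_left.mp (hb.2 hb.1) hi
  -- The part of $W$ outside the first neighbourhood of $a$ is independent of the centred $\zeta_a$.
  -- Hence the coefficients in the single-term estimates add up exactly to the variance of $W$.
  have hvar : ∫ z, W z ^ 2 ∂P = ∑ a ∈ 𝒜, ∫ z, ζ a z * S a z ∂P := by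
    have h1 : ∀ z, W z ^ 2 = ∑ a ∈ 𝒜, ζ a z * W z := fun z => by
      rw [pow_two, ← Finset.sum_mul]
    simp_rw [h1]
    rw [integral_finsetSum _ fun a _ => ((hζb a).mul hWb).integrable P]
    refine Finset.sum_congr rfl fun a ha => ?_
    have h2 : ∫ z, ζ a z * W₁ a z ∂P = 0 := by
      have := integral_mul_of_dependsOn (𝕜 := ℝ) (μ := μ) (hm a) (hW₁ a).measurable
        (s := T a) (t := (T a)ᶜ) disjoint_compl_right (hT a) (by
          refine dependsOn_sum hT fun b hb i hi => ?_
          simp only [Finset.mem_sdiff, N1, touching, Finset.mem_filter, not_and, not_not] at hb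
          simp only [Finset.coe_compl, Set.mem_compl_iff, Finset.mem_coe]
          exact Finset.disjoint_left.mp (hb.2 hb.1) hi)
      rw [this, h0 a, zero_mul]
    simp_rw [hWS a, mul_add]
    rw [integral_add (((hζb a).mul (hW₁ a)).integrable P) (((hζb a).mul (hS a)).integrable P), h2,
      zero_add]
  have hv0 : 0 ≤ ∫ z, W z ^ 2 ∂P := integral_nonneg fun z => sq_nonneg _
  have key := norm_sub_exp_le_of_deriv (f := fun t => ∫ z, cis (t * W z) ∂P)
    (f' := fun t => ∫ z, Complex.I * (W z * cis (t * W z)) ∂P) (v := ∫ z, W z ^ 2 ∂P)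
    (R := 𝒜.card * (4 * ε * (M * ε) ^ 2)) hv0 (by positivity) (by simp [cis])
    (hasDerivAt_integral_cis P hWb) (fun t => ?_) t
  · refine key.trans (le_of_eq ?_)
    ring
  · have mc : Measurable fun z => cis (t * W z) :=
      measurable_cis.comp (measurable_const.mul hWb.measurable)
    have hint : ∀ a, Integrable (fun z => Complex.I * (ζ a z * cis (t * W z))) P := fun a =>
      integrable_of_norm_le P (measurable_const.mul
        ((Complex.measurable_ofReal.comp (hm a)).mul mc)) (C := ε) fun z => by
          simpa [norm_cis] using hε a z
    have h1 : ∫ z, Complex.I * (W z * cis (t * W z)) ∂P =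
        ∑ a ∈ 𝒜, ∫ z, Complex.I * (ζ a z * cis (t * W z)) ∂P := by
      rw [← integral_finsetSum _ fun a _ => hint a]
      congr 1; ext z
      rw [← Finset.mul_sum, ← Finset.sum_mul]
      simp [W]
    have h2 : (((t * ∫ z, W z ^ 2 ∂P : ℝ)) : ℂ) * ∫ z, cis (t * W z) ∂P =
        ∑ a ∈ 𝒜, ((t * ∫ z, ζ a z * S a z ∂P : ℝ) : ℂ) * ∫ z, cis (t * W z) ∂P := by
      rw [hvar, Finset.mul_sum, ← Finset.sum_mul]; push_cast; rfl
    rw [h1, h2, ← Finset.sum_add_distrib]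
    refine (norm_sum_le _ _).trans ((Finset.sum_le_card_nsmul _ _ _ fun a ha => hterm a ha t).trans ?_)
    rw [nsmul_eq_mul]
    apply le_of_eq; ring

end Local

end RankBootstrap

namespace RankBootstrap

/-! ### Neighbouring points of a finite configuration on the line -/

section Adjacency

variable {ι : Type*} [Fintype ι] [DecidableEq ι]

/-- Among the points `x l`, `l ∈ s`, the point `x k` is the right neighbour of `x i`. -/
def Adj (s : Finset ι) (x : ι → ℝ) (i k : ι) : Prop :=
  i ∈ s ∧ k ∈ s ∧ x i < x k ∧ ∀ l ∈ s, x l ≤ x i ∨ x k ≤ x l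

open Classical in
/-- The sum of `F` over all pairs of neighbours. -/
noncomputable def adjSum (s : Finset ι) (x : ι → ℝ) (F : ι → ι → ℝ) : ℝ :=
  ∑ i, ∑ k, if Adj s x i k then F i k else 0

variable {s : Finset ι} {x : ι → ℝ} {F G : ι → ι → ℝ}

theorem Adj.right_unique (hx : Function.Injective x) {i k k' : ι} (h : Adj s x i k)
    (h' : Adj s x i k') : k = k' := by
  obtain ⟨-, hk, h1, h2⟩ := h
  obtain ⟨-, hk', h1', h2'⟩ := h'
  apply hx
  rcases h2 k' hk' with h | h <;> rcases h2' k hk with h' | h' <;> linarith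

theorem Adj.left_unique (hx : Function.Injective x) {i i' k : ι} (h : Adj s x i k)
    (h' : Adj s x i' k) : i = i' := by
  obtain ⟨hi, -, h1, h2⟩ := h
  obtain ⟨hi', -, h1', h2'⟩ := h'
  apply hx
  rcases h2 i' hi' with h | h <;> rcases h2' i hi with h' | h' <;> linarith

theorem Adj.ne {i k : ι} (h : Adj s x i k) : i ≠ k := by
  rintro rfl
  exact lt_irrefl _ h.2.2.1

theorem Adj.not_symm {i k : ι} (h : Adj s x i k) : ¬ Adj s x k i := fun h' =>
  lt_asymm h.2.2.1 h'.2.2.1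

/-- Removing $j$ destroys the pairs containing $j$ and creates only the pair made of its former left
and right neighbours. -/
theorem adj_erase_iff (hx : Function.Injective x) {j : ι} (hj : j ∈ s) (i k : ι) :
    Adj (s.erase j) x i k ↔
      (Adj s x i k ∧ i ≠ j ∧ k ≠ j) ∨ (Adj s x i j ∧ Adj s x j k) := by
  constructor
  · rintro ⟨hi, hk, hlt, h⟩
    rw [Finset.mem_erase] at hi hk
    by_cases hc : x i < x j ∧ x j < x k
    · right
      refine ⟨⟨hi.2, hj, hc.1, fun l hl => ?_⟩, ⟨hj, hk.2, hc.2, fun l hl => ?_⟩⟩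
      · by_cases hlj : l = j
        · subst hlj; exact Or.inr le_rfl
        · rcases h l (Finset.mem_erase.mpr ⟨hlj, hl⟩) with h | h
          · exact Or.inl h
          · right; linarith [hc.2]
      · by_cases hlj : l = j
        · subst hlj; exact Or.inl le_rfl
        · rcases h l (Finset.mem_erase.mpr ⟨hlj, hl⟩) with h | h
          · left; linarith [hc.1]
          · exact Or.inr h
    · left
      refine ⟨⟨hi.2, hk.2, hlt, fun l hl => ?_⟩, hi.1, hk.1⟩
      by_cases hlj : l = j
      · subst hlj
        by_contra hcon
        push Not at hcon
        exact hc hcon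
      · exact h l (Finset.mem_erase.mpr ⟨hlj, hl⟩)
  · rintro (⟨⟨hi, hk, hlt, h⟩, hij, hkj⟩ | ⟨h1, h2⟩)
    · exact ⟨Finset.mem_erase.mpr ⟨hij, hi⟩, Finset.mem_erase.mpr ⟨hkj, hk⟩, hlt,
        fun l hl => h l (Finset.mem_of_mem_erase hl)⟩
    · refine ⟨Finset.mem_erase.mpr ⟨h1.ne, h1.1⟩, Finset.mem_erase.mpr ⟨h2.ne.symm, h2.2.1⟩,
        h1.2.2.1.trans h2.2.2.1, fun l hl => ?_⟩
      rw [Finset.mem_erase] at hl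
      rcases h1.2.2.2 l hl.2 with h | h
      · exact Or.inl h
      · rcases h2.2.2.2 l hl.2 with h' | h'
        · exact absurd (hx (le_antisymm h' h)) hl.1
        · exact Or.inr h'

theorem adjSum_add : adjSum s x (fun i k => F i k + G i k) = adjSum s x F + adjSum s x G := by
  simp only [adjSum, ← Finset.sum_add_distrib]
  refine Finset.sum_congr rfl fun i _ => Finset.sum_congr rfl fun k _ => ?_
  split_ifs <;> simp

theorem adjSum_const_mul (c : ℝ) : adjSum s x (fun i k => c * F i k) = c * adjSum s x F := by
  simp only [adjSum, Finset.mul_sum]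
  refine Finset.sum_congr rfl fun i _ => Finset.sum_congr rfl fun k _ => ?_
  split_ifs <;> simp

theorem adjSum_sub : adjSum s x (fun i k => F i k - G i k) = adjSum s x F - adjSum s x G := by
  have h := adjSum_add (s := s) (x := x) (F := F) (G := fun i k => (-1) * G i k)
  rw [adjSum_const_mul] at h
  simpa [sub_eq_add_neg] using h

theorem adjSum_congr (h : ∀ i k, Adj s x i k → F i k = G i k) : adjSum s x F = adjSum s x G := by
  refine Finset.sum_congr rfl fun i _ => Finset.sum_congr rfl fun k _ => ?_
  split_ifs with hik
  · exact h i k hik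
  · rfl

theorem adjSum_mono (h : ∀ i k, Adj s x i k → F i k ≤ G i k) : adjSum s x F ≤ adjSum s x G := by
  refine Finset.sum_le_sum fun i _ => Finset.sum_le_sum fun k _ => ?_
  split_ifs with hik
  · exact h i k hik
  · exact le_rfl

theorem abs_adjSum_le : |adjSum s x F| ≤ adjSum s x (fun i k => |F i k|) := by
  refine (Finset.abs_sum_le_sum_abs _ _).trans (Finset.sum_le_sum fun i _ => ?_)
  refine (Finset.abs_sum_le_sum_abs _ _).trans (Finset.sum_le_sum fun k _ => ?_)
  split_ifs <;> simp

theorem adjSum_nonneg (h : ∀ i k, 0 ≤ F i k) : 0 ≤ adjSum s x F := by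
  refine Finset.sum_nonneg fun i _ => Finset.sum_nonneg fun k _ => ?_
  split_ifs
  · exact h i k
  · exact le_rfl

theorem adjSum_finsetSum {α : Type*} (t : Finset α) (H : α → ι → ι → ℝ) :
    adjSum s x (fun i k => ∑ a ∈ t, H a i k) = ∑ a ∈ t, adjSum s x (H a) := by
  classical
  induction t using Finset.induction_on with
  | empty => simp [adjSum]
  | insert a t ha ih => simp only [Finset.sum_insert ha, adjSum_add, ih]

/-- A predicate with at most one solution. -/
theorem unique_cases {p : ι → Prop} (h : ∀ i i', p i → p i' → i = i') :
    (∀ i, ¬ p i) ∨ ∃ i₀, ∀ i, p i ↔ i = i₀ := by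
  by_cases hp : ∃ i, p i
  · obtain ⟨i₀, h₀⟩ := hp
    exact Or.inr ⟨i₀, fun i => ⟨fun hi => h _ _ hi h₀, fun hi => hi ▸ h₀⟩⟩
  · exact Or.inl fun i hi => hp ⟨i, hi⟩

theorem sum_ite_le_of_unique {p : ι → Prop} [DecidablePred p] (h : ∀ i i', p i → p i' → i = i') {f : ι → ℝ} {B : ℝ}
    (hB : 0 ≤ B) (hf : ∀ i, p i → f i ≤ B) : (∑ i, if p i then f i else 0) ≤ B := by
  rcases unique_cases h with h0 | ⟨i₀, h0⟩
  · simpa [h0]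
  · simpa [h0] using hf i₀ ((h0 i₀).mpr rfl)

open Classical in
theorem sq_sum_ite_of_unique {p : ι → Prop} (h : ∀ i i', p i → p i' → i = i') (f : ι → ℝ) :
    (∑ i, if p i then f i else 0) ^ 2 = ∑ i, if p i then f i ^ 2 else 0 := by
  rcases unique_cases h with h0 | ⟨i₀, h0⟩
  · simp [h0]
  · simp [h0]

theorem adjSum_left_le (hx : Function.Injective x) {f : ι → ℝ} (hf : ∀ i, 0 ≤ f i) :
    adjSum s x (fun i _ => f i) ≤ ∑ i, f i := by
  classical
  exact Finset.sum_le_sum fun i _ => sum_ite_le_of_unique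
    (fun _ _ h h' => h.right_unique hx h') (hf i) fun _ _ => le_rfl

theorem adjSum_right_le (hx : Function.Injective x) {f : ι → ℝ} (hf : ∀ i, 0 ≤ f i) :
    adjSum s x (fun _ k => f k) ≤ ∑ i, f i := by
  classical
  unfold adjSum
  rw [Finset.sum_comm]
  exact Finset.sum_le_sum fun k _ => sum_ite_le_of_unique
    (fun _ _ h h' => h.left_unique hx h') (hf k) fun _ _ => le_rfl

theorem adjSum_le_card_mul (hx : Function.Injective x) {B : ℝ} (hB : 0 ≤ B)
    (h : ∀ i k, F i k ≤ B) : adjSum s x F ≤ Fintype.card ι * B := by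
  refine (adjSum_mono fun i k _ => h i k).trans ?_
  refine (adjSum_left_le hx (f := fun _ => B) fun _ => hB).trans ?_
  simp

open Classical in
/-- The effect of the removal of a point on a sum over neighbours. -/
theorem adjSum_sub_adjSum_erase (hx : Function.Injective x) {j : ι} (hj : j ∈ s) :
    adjSum s x F - adjSum (s.erase j) x F =
      (∑ i, if Adj s x i j then F i j else 0) + (∑ k, if Adj s x j k then F j k else 0) -
      ∑ i, ∑ k, if Adj s x i j ∧ Adj s x j k then F i k else 0 := by
  have key : ∀ i k, (if Adj s x i k then F i k else 0) -
      (if Adj (s.erase j) x i k then F i k else 0) =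
      (if k = j then (if Adj s x i j then F i j else 0) else 0) +
      (if i = j then (if Adj s x j k then F j k else 0) else 0) -
      (if Adj s x i j ∧ Adj s x j k then F i k else 0) := by
    intro i k
    rw [adj_erase_iff hx hj i k]
    by_cases hi : i = j
    · subst hi
      have h1 : ¬ Adj s x i i := fun h => h.ne rfl
      by_cases hk : k = i
      · subst hk; simp [h1]
      · simp [hk, h1]
    · by_cases hk : k = j
      · subst hk
        have h1 : ¬ Adj s x k k := fun h => h.ne rfl
        simp [hi, h1]
      · simp only [hi, hk, if_false, ne_eq, not_false_eq_true, and_true, add_zero, zero_sub]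
        by_cases h1 : Adj s x i k
        · have h2 : ¬ (Adj s x i j ∧ Adj s x j k) := fun h => hk (h1.right_unique hx h.1)
          simp [h1, h2]
        · by_cases h2 : Adj s x i j ∧ Adj s x j k
          · simp [h1, h2]
          · simp [h1, h2]
  unfold adjSum
  rw [← Finset.sum_sub_distrib]
  simp_rw [← Finset.sum_sub_distrib, key, Finset.sum_sub_distrib, Finset.sum_add_distrib]
  congr 2
  · simp
  · rw [Finset.sum_comm]; simp

open Classical in
-- At most two pairs are lost and one is gained. Together they involve $j$ and its two neighbours,
-- each point twice, whence the factor $2$.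
theorem abs_adjSum_sub_adjSum_erase_le (hx : Function.Injective x) {j : ι} (hj : j ∈ s) {f : ι → ℝ}
    (hf : ∀ i, 0 ≤ f i) (hF : ∀ i k, |F i k| ≤ f i + f k) :
    |adjSum s x F - adjSum (s.erase j) x F| ≤
      2 * ((∑ i, if Adj s x i j then f i else 0) + f j + ∑ k, if Adj s x j k then f k else 0) := by
  rw [adjSum_sub_adjSum_erase hx hj]
  rcases unique_cases (p := fun i => Adj s x i j) (fun _ _ h h' => h.left_unique hx h') with
    h1 | ⟨p, h1⟩ <;>
  rcases unique_cases (p := fun k => Adj s x j k) (fun _ _ h h' => h.right_unique hx h') with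
    h2 | ⟨q, h2⟩
  · simp [h1, h2, hf j]
  · simp only [h1, h2, false_and, if_false, Finset.sum_const_zero, Finset.sum_ite_eq',
      Finset.mem_univ, if_true]
    have := hF j q
    rw [zero_add, sub_zero]
    linarith [hf j, hf q]
  · simp only [h1, h2, and_false, if_false, Finset.sum_const_zero, Finset.sum_ite_eq',
      Finset.mem_univ, if_true]
    have := hF p j
    rw [add_zero, sub_zero]
    linarith [hf j, hf p]
  · have e : (∑ i, ∑ k, if Adj s x i j ∧ Adj s x j k then F i k else 0) = F p q := by
      simp [h1, h2, ite_and]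
    rw [e]
    simp only [h1, h2, Finset.sum_ite_eq', Finset.mem_univ, if_true]
    have a := abs_sub (F p j + F j q) (F p q)
    have b := abs_add_le (F p j) (F j q)
    linarith [hF p j, hF j q, hF p q]

theorem abs_adjSum_sub_adjSum_erase_le_const (hx : Function.Injective x) {j : ι} (hj : j ∈ s)
    {B : ℝ} (hF : ∀ i k, |F i k| ≤ B) :
    |adjSum s x F - adjSum (s.erase j) x F| ≤ 3 * B := by
  classical
  have hB : 0 ≤ B := (abs_nonneg _).trans (hF j j)
  refine (abs_adjSum_sub_adjSum_erase_le hx hj (f := fun _ => B / 2) (fun _ => by positivity)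
    fun i k => by simpa using hF i k).trans ?_
  have h1 := sum_ite_le_of_unique (p := fun i => Adj s x i j) (f := fun _ => B / 2) (B := B / 2)
    (fun _ _ h h' => h.left_unique hx h') (by positivity) fun _ _ => le_rfl
  have h2 := sum_ite_le_of_unique (p := fun i => Adj s x j i) (f := fun _ => B / 2) (B := B / 2)
    (fun _ _ h h' => h.right_unique hx h') (by positivity) fun _ _ => le_rfl
  linarith

open Classical in
-- Each point is counted at most three times: for itself, as a left neighbour and as a right
-- neighbour. Another factor $3$ comes from squaring a sum of three terms.
theorem sum_sq_neighbours_le (hx : Function.Injective x) (f : ι → ℝ) :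
    ∑ j, ((∑ i, if Adj s x i j then f i else 0) + f j + ∑ k, if Adj s x j k then f k else 0) ^ 2 ≤
      9 * ∑ i, f i ^ 2 := by
  have h1 : ∀ j, ((∑ i, if Adj s x i j then f i else 0) + f j +
      ∑ k, if Adj s x j k then f k else 0) ^ 2 ≤
      3 * ((∑ i, if Adj s x i j then f i ^ 2 else 0) + f j ^ 2 +
        ∑ k, if Adj s x j k then f k ^ 2 else 0) := fun j => by
    rw [← sq_sum_ite_of_unique (p := fun i => Adj s x i j) (fun _ _ h h' => h.left_unique hx h'),
      ← sq_sum_ite_of_unique (p := fun k => Adj s x j k) (fun _ _ h h' => h.right_unique hx h')]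
    set a := ∑ i, if Adj s x i j then f i else 0
    set b := ∑ k, if Adj s x j k then f k else 0
    nlinarith [sq_nonneg (a - f j), sq_nonneg (a - b), sq_nonneg (b - f j)]
  refine (Finset.sum_le_sum fun j _ => h1 j).trans ?_
  rw [← Finset.mul_sum, Finset.sum_add_distrib, Finset.sum_add_distrib]
  have a := adjSum_left_le (s := s) hx (f := fun i => f i ^ 2) fun i => sq_nonneg _
  have b := adjSum_right_le (s := s) hx (f := fun i => f i ^ 2) fun i => sq_nonneg _
  unfold adjSum at a b
  rw [Finset.sum_comm] at a
  rw [Finset.sum_comm] at b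
  rw [Finset.sum_comm] at b
  have b' : ∑ j, ∑ k, (if Adj s x j k then f k ^ 2 else 0) ≤ ∑ i, f i ^ 2 := b
  have a' : ∑ j, ∑ i, (if Adj s x i j then f i ^ 2 else 0) ≤ ∑ i, f i ^ 2 := a
  linarith

open Classical in
/-- The sum over all pairs of second neighbours. -/
noncomputable def adjSum₂ (s : Finset ι) (x : ι → ℝ) (F : ι → ι → ι → ℝ) : ℝ :=
  ∑ j, ∑ i, ∑ k, if Adj s x i j ∧ Adj s x j k then F i j k else 0

/-- Over all removals, each neighbour pair is destroyed twice, once per endpoint, and each pair of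
second neighbours is created once. -/
theorem sum_abs_adjSum_sub_erase_le (hx : Function.Injective x) :
    ∑ j, |adjSum Finset.univ x F - adjSum (Finset.univ.erase j) x F| ≤
      2 * adjSum Finset.univ x (fun i k => |F i k|) +
        adjSum₂ Finset.univ x (fun i _ k => |F i k|) := by
  classical
  have h : ∀ j, |adjSum Finset.univ x F - adjSum (Finset.univ.erase j) x F| ≤
      ((∑ i, if Adj Finset.univ x i j then |F i j| else 0) +
        (∑ k, if Adj Finset.univ x j k then |F j k| else 0)) +
      ∑ i, ∑ k, if Adj Finset.univ x i j ∧ Adj Finset.univ x j k then |F i k| else 0 := fun j => by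
    have e : ∀ (q : Prop) [Decidable q] (a : ℝ), |if q then a else 0| = if q then |a| else 0 :=
      fun q _ a => by split_ifs <;> simp
    rw [adjSum_sub_adjSum_erase hx (Finset.mem_univ j)]
    refine (abs_sub _ _).trans (add_le_add ((abs_add_le _ _).trans (add_le_add ?_ ?_)) ?_)
    · exact (Finset.abs_sum_le_sum_abs _ _).trans (by simp_rw [e]; exact le_rfl)
    · exact (Finset.abs_sum_le_sum_abs _ _).trans (by simp_rw [e]; exact le_rfl)
    · refine (Finset.abs_sum_le_sum_abs _ _).trans (Finset.sum_le_sum fun i _ => ?_)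
      exact (Finset.abs_sum_le_sum_abs _ _).trans (by simp_rw [e]; exact le_rfl)
  refine (Finset.sum_le_sum fun j _ => h j).trans ?_
  rw [Finset.sum_add_distrib, Finset.sum_add_distrib]
  have a : ∑ j, ∑ i, (if Adj Finset.univ x i j then |F i j| else 0) =
      adjSum Finset.univ x (fun i k => |F i k|) := by
    unfold adjSum; rw [Finset.sum_comm]
  rw [a]
  unfold adjSum adjSum₂
  linarith

/-- Intended for triangle inequalities: a bound through the middle point reduces second neighbours
to neighbours, because each neighbour pair extends in at most one way on either side. -/
theorem adjSum₂_le (hx : Function.Injective x) {H : ι → ι → ι → ℝ} {f g : ι → ι → ℝ}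
    (hf : ∀ i k, 0 ≤ f i k) (hg : ∀ i k, 0 ≤ g i k) (h : ∀ i j k, H i j k ≤ f i j + g j k) :
    adjSum₂ s x H ≤ adjSum s x f + adjSum s x g := by
  classical
  have h1 : ∀ j i k, (if Adj s x i j ∧ Adj s x j k then H i j k else 0) ≤
      (if Adj s x j k then (if Adj s x i j then f i j else 0) else 0) +
      (if Adj s x i j then (if Adj s x j k then g j k else 0) else 0) := fun j i k => by
    by_cases h1 : Adj s x i j <;> by_cases h2 : Adj s x j k <;> simp [h1, h2, h i j k]
  refine (Finset.sum_le_sum fun j _ => Finset.sum_le_sum fun i _ =>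
    Finset.sum_le_sum fun k _ => h1 j i k).trans ?_
  simp_rw [Finset.sum_add_distrib]
  refine add_le_add ?_ ?_
  · unfold adjSum
    rw [Finset.sum_comm]
    refine Finset.sum_le_sum fun i _ => Finset.sum_le_sum fun j _ => ?_
    refine sum_ite_le_of_unique (fun _ _ h h' => h.right_unique hx h') ?_ fun _ _ => le_rfl
    split_ifs
    · exact hf i j
    · exact le_rfl
  · unfold adjSum
    refine Finset.sum_le_sum fun j _ => ?_
    rw [Finset.sum_comm]
    refine Finset.sum_le_sum fun k _ => ?_
    refine sum_ite_le_of_unique (fun _ _ h h' => h.left_unique hx h') ?_ fun _ _ => le_rfl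
    split_ifs
    · exact hg j k
    · exact le_rfl

/-- Every point but the largest has a right neighbour. -/
theorem exists_adj_of_lt {i l : ι} (h : x i < x l) : ∃ k, Adj Finset.univ x i k := by
  obtain ⟨k, hk, hmin⟩ := Finset.exists_min_image (Finset.univ.filter fun k => x i < x k) x
    ⟨l, by simpa using h⟩
  refine ⟨k, Finset.mem_univ _, Finset.mem_univ _, by simpa using hk, fun m _ => ?_⟩
  by_cases hm : x i < x m
  · exact Or.inr (hmin m (by simpa using hm))
  · exact Or.inl (not_lt.mp hm)

/-- Only the largest point is not the left member of a pair. This is how sums over neighbours become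
sums over all points at bounded cost. -/
theorem abs_sum_sub_adjSum_left_le (hx : Function.Injective x) {f : ι → ℝ} {B : ℝ} (hB : 0 ≤ B)
    (hf : ∀ i, |f i| ≤ B) : |∑ i, f i - adjSum Finset.univ x (fun i _ => f i)| ≤ B := by
  classical
  have h : ∑ i, f i - adjSum Finset.univ x (fun i _ => f i) =
      ∑ i, if (∀ k, ¬ Adj Finset.univ x i k) then f i else 0 := by
    unfold adjSum
    rw [← Finset.sum_sub_distrib]
    refine Finset.sum_congr rfl fun i _ => ?_
    rcases unique_cases (p := fun k => Adj Finset.univ x i k)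
      (fun _ _ h h' => h.right_unique hx h') with h1 | ⟨q, h1⟩
    · simp [h1]
    · have : ¬ ∀ k, k ≠ q := fun h => h q rfl
      simp [h1]
  have hu : ∀ i i', (∀ k, ¬ Adj Finset.univ x i k) → (∀ k, ¬ Adj Finset.univ x i' k) → i = i' := by
    intro i i' h h'
    apply hx
    rcases lt_trichotomy (x i) (x i') with hl | hl | hl
    · obtain ⟨k, hk⟩ := exists_adj_of_lt hl
      exact absurd hk (h k)
    · exact hl
    · obtain ⟨k, hk⟩ := exists_adj_of_lt hl
      exact absurd hk (h' k)
  rw [h, abs_le]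
  refine ⟨?_, sum_ite_le_of_unique hu hB fun i _ => (abs_le.mp (hf i)).2⟩
  have := sum_ite_le_of_unique hu (f := fun i => - f i) hB fun i _ => by
    linarith [(abs_le.mp (hf i)).1]
  rw [neg_le, ← Finset.sum_neg_distrib]
  refine le_trans (le_of_eq (Finset.sum_congr rfl fun i _ => ?_)) this
  split_ifs <;> simp

theorem adj_neg_iff (s : Finset ι) (x : ι → ℝ) (i k : ι) :
    Adj s (fun l => - x l) i k ↔ Adj s x k i := by
  simp only [Adj, neg_lt_neg_iff, neg_le_neg_iff]
  constructor
  · rintro ⟨a, b, c, d⟩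
    exact ⟨b, a, c, fun l hl => (d l hl).symm⟩
  · rintro ⟨a, b, c, d⟩
    exact ⟨b, a, c, fun l hl => (d l hl).symm⟩

theorem abs_sum_sub_adjSum_right_le (hx : Function.Injective x) {f : ι → ℝ} {B : ℝ} (hB : 0 ≤ B)
    (hf : ∀ i, |f i| ≤ B) : |∑ i, f i - adjSum Finset.univ x (fun _ k => f k)| ≤ B := by
  classical
  have h := abs_sum_sub_adjSum_left_le (x := fun l => - x l)
    (fun a b h => hx (neg_injective h)) hB hf
  have e : adjSum Finset.univ (fun l => - x l) (fun i _ => f i) =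
      adjSum Finset.univ x (fun _ k => f k) := by
    unfold adjSum
    rw [Finset.sum_comm]
    exact Finset.sum_congr rfl fun k _ => Finset.sum_congr rfl fun i _ =>
      if_congr (adj_neg_iff _ x i k) rfl rfl
  rwa [e] at h

open Classical in
/-- At most one pair of neighbours is separated by a given point. -/
theorem adjSum_separated_le (hx : Function.Injective x) (a : ℝ) :
    adjSum s x (fun i k => if x i < a ∧ a ≤ x k then 1 else 0) ≤ 1 := by
  have key : ∀ i k i' k', Adj s x i k → Adj s x i' k' → x i < a → a ≤ x k → x i' < a → a ≤ x k' →
      i = i' := by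
    intro i k i' k' h h' h1 h2 h3 h4
    apply hx
    rcases h.2.2.2 i' h'.1 with h5 | h5 <;> rcases h'.2.2.2 i h.1 with h6 | h6 <;> linarith
  unfold adjSum
  have e : ∀ i, (∑ k, if Adj s x i k then (if x i < a ∧ a ≤ x k then (1 : ℝ) else 0) else 0) ≤
      if (∃ k, Adj s x i k ∧ x i < a ∧ a ≤ x k) then 1 else 0 := fun i => by
    split_ifs with h
    · exact sum_ite_le_of_unique (fun _ _ h h' => h.right_unique hx h') zero_le_one
        fun k _ => by split_ifs <;> simp
    · apply le_of_eq
      refine Finset.sum_eq_zero fun k _ => ?_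
      push Not at h
      by_cases hk : Adj s x i k
      · have h1 : ¬ (x i < a ∧ a ≤ x k) := fun h' => absurd h'.2 (not_le.mpr (h k hk h'.1))
        simp only [h1, if_false, ite_self]
      · simp only [hk, if_false]
  refine (Finset.sum_le_sum fun i _ => e i).trans ?_
  exact sum_ite_le_of_unique (fun i i' ⟨k, h, h1, h2⟩ ⟨k', h', h3, h4⟩ =>
    key i k i' k' h h' h1 h2 h3 h4) zero_le_one fun _ _ => le_rfl

theorem measurableSet_adj {Ω : Type*} [MeasurableSpace Ω] {x : Ω → ι → ℝ}
    (hx : ∀ i, Measurable fun ω => x ω i) (i k : ι) : MeasurableSet {ω | Adj s (x ω) i k} := by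
  refine (MeasurableSet.const _).inter ((MeasurableSet.const _).inter
    ((measurableSet_lt (hx i) (hx k)).inter ?_))
  have : {ω | ∀ l ∈ s, x ω l ≤ x ω i ∨ x ω k ≤ x ω l} =
      ⋂ l ∈ s, ({ω | x ω l ≤ x ω i} ∪ {ω | x ω k ≤ x ω l}) := by ext; simp
  change MeasurableSet {ω | ∀ l ∈ s, x ω l ≤ x ω i ∨ x ω k ≤ x ω l}
  rw [this]
  exact Finset.measurableSet_biInter _ fun l _ =>
    (measurableSet_le (hx l) (hx i)).union (measurableSet_le (hx k) (hx l))

theorem BddMeasurable.adjSum {Ω : Type*} [MeasurableSpace Ω] {x : Ω → ι → ℝ}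
    (hx : ∀ i, Measurable fun ω => x ω i) {F : Ω → ι → ι → ℝ}
    (hF : ∀ i k, BddMeasurable fun ω => F ω i k) :
    BddMeasurable fun ω => adjSum s (x ω) (F ω) := by
  classical
  refine finsetSum _ fun i _ => finsetSum _ fun k _ => ?_
  exact ite (measurableSet_adj hx i k) (hF i k) (const 0)

end Adjacency

/-- Without ties, neighbours are exactly consecutive elements of the sorted list. This connects the
rearranged-sample definition with the order-free `adjSum`, which behaves well when a point is
removed. -/
theorem adjSum_eq_sum_sorted {n : ℕ} {x : Fin n → ℝ} (F : Fin n → Fin n → ℝ)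
    (τ : Equiv.Perm (Fin n)) (h : StrictMono fun i => x (τ i)) :
    adjSum Finset.univ x F =
      ∑ i : Fin (n - 1), F (τ ⟨i.val, by omega⟩) (τ ⟨i.val + 1, by omega⟩) := by
  classical
  have hadj : ∀ a b, Adj Finset.univ x (τ a) (τ b) ↔ b.val = a.val + 1 := by
    intro a b
    constructor
    · rintro ⟨-, -, h1, h2⟩
      have hab : a < b := h.lt_iff_lt.mp h1
      by_contra hne
      have hlt : a.val + 1 < b.val := by
        have : a.val < b.val := hab
        omega
      have hm : a.val + 1 < n := by omega
      rcases h2 (τ ⟨a.val + 1, hm⟩) (Finset.mem_univ _) with h3 | h3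
      · have := h.le_iff_le.mp h3
        simp [Fin.le_def] at this
      · have := h.le_iff_le.mp h3
        simp [Fin.le_def] at this
        omega
    · intro hab
      refine ⟨Finset.mem_univ _, Finset.mem_univ _, h (by rw [Fin.lt_def]; omega), fun l _ => ?_⟩
      obtain ⟨c, rfl⟩ := τ.surjective l
      by_cases hc : c ≤ a
      · exact Or.inl (h.monotone hc)
      · refine Or.inr (h.monotone ?_)
        rw [Fin.le_def] at hc ⊢
        omega
  unfold adjSum
  rw [← Equiv.sum_comp τ]
  simp_rw [← Equiv.sum_comp τ (fun k => if Adj Finset.univ x _ k then F _ k else 0), hadj]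
  cases n with
  | zero => simp
  | succ m =>
    rw [Fin.sum_univ_castSucc]
    have hlast : (∑ b : Fin (m + 1), if b.val = (Fin.last m).val + 1 then
        F (τ (Fin.last m)) (τ b) else 0) = 0 := by
      refine Finset.sum_eq_zero fun b _ => ?_
      have := b.isLt
      rw [if_neg]
      simp
      omega
    rw [hlast, add_zero]
    refine Finset.sum_congr rfl fun j _ => ?_
    rw [Finset.sum_eq_single ⟨j.val + 1, by omega⟩]
    · simp [Fin.castSucc, Fin.castAdd, Fin.castLE]
    · intro b _ hb
      rw [if_neg]
      intro hb'
      exact hb (Fin.ext hb')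
    · simp

end RankBootstrap

namespace RankBootstrap

open unitInterval

/-! ### Neighbouring points of an iid sample are close to each other -/

section Iid

variable {ι E : Type*} [Fintype ι] [DecidableEq ι] [MeasurableSpace E]
  (μ : Measure E) [IsProbabilityMeasure μ]

theorem integral_iid_eval {f : E → ℝ} (hf : Measurable f) (i : ι) :
    ∫ z, f (z i) ∂(iid ι μ) = ∫ w, f w ∂μ := by
  have h := measurePreserving_eval (fun _ : ι => μ) i
  conv_rhs => rw [← h.map_eq]
  rw [integral_map h.measurable.aemeasurable hf.aestronglyMeasurable]

theorem ae_ne_of_noAtoms [MeasurableEq E] [MeasurableSingletonClass E] [NullSingletonClass μ] {i j : ι}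
    (hij : i ≠ j) : ∀ᵐ z ∂(iid ι μ), z i ≠ z j := by
  have hm : MeasurableSet {z : ι → E | z i = z j} :=
    measurableSet_eq_fun (measurable_pi_apply i) (measurable_pi_apply j)
  change iid ι μ {z | ¬ z i ≠ z j} = 0
  simp only [ne_eq, not_not]
  rw [← (measurePreserving_update μ j).measure_preimage hm.nullMeasurableSet,
    Measure.measure_prod_null (measurable_update' hm)]
  refine Eventually.of_forall fun z => ?_
  refine measure_mono_null (t := {z i}) (fun w hw => ?_) (measure_singleton _)
  have hw' : Function.update z j w i = Function.update z j w j := hw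
  rw [Function.update_of_ne hij, Function.update_self] at hw'
  exact hw'.symm

theorem ae_injective_of_noAtoms [MeasurableEq E] [MeasurableSingletonClass E] [NullSingletonClass μ] :
    ∀ᵐ z ∂(iid ι μ), Function.Injective z := by
  have h : ∀ᵐ z ∂(iid ι μ), ∀ i j : ι, i ≠ j → z i ≠ z j := by
    rw [ae_all_iff]; intro i
    rw [ae_all_iff]; intro j
    rw [eventually_imp_distrib_left]
    exact fun hij => ae_ne_of_noAtoms μ hij
  filter_upwards [h] with z hz i j hij
  by_contra hne
  exact hz i j hne hij

end Iid

/-- The `L¹`-distance of the sections of `p` at `x` and `x'`. -/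
noncomputable def sectionDist (p : ℝ × I → ℝ) (x x' : ℝ) : ℝ := ∫ u, |p (x, u) - p (x', u)|

theorem BddMeasurable.sectionDist {p : ℝ × I → ℝ} (hp : BddMeasurable p) :
    BddMeasurable fun w : ℝ × ℝ => sectionDist p w.1 w.2 :=
  integral_right (F := fun (w : ℝ × ℝ) (u : I) => |p (w.1, u) - p (w.2, u)|)
    (((hp.comp (φ := fun v : (ℝ × ℝ) × I => (v.1.1, v.2)) (by fun_prop)).sub
      (hp.comp (φ := fun v : (ℝ × ℝ) × I => (v.1.2, v.2)) (by fun_prop))).abs) _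

theorem sectionDist_nonneg (p : ℝ × I → ℝ) (x x' : ℝ) : 0 ≤ sectionDist p x x' :=
  integral_nonneg fun _ => abs_nonneg _

theorem sectionDist_triangle {p : ℝ × I → ℝ} (hp : BddMeasurable p) (x y z : ℝ) :
    sectionDist p x z ≤ sectionDist p x y + sectionDist p y z := by
  have hb : ∀ a b : ℝ, BddMeasurable fun u : I => |p (a, u) - p (b, u)| := fun a b =>
    ((hp.comp (φ := fun u : I => (a, u)) (by fun_prop)).sub
      (hp.comp (φ := fun u : I => (b, u)) (by fun_prop))).abs
  unfold sectionDist
  rw [← integral_add ((hb x y).integrable _) ((hb y z).integrable _)]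
  exact integral_mono ((hb x z).integrable _) (((hb x y).add (hb y z)).integrable _)
    fun u => abs_sub_le _ _ _

open Classical in
/-- A continuous function with compact support oscillates little between points which are not
separated by a suitable finite grid. -/
theorem exists_grid {g : ℝ × I → ℝ} (hg : Continuous g) (hc : HasCompactSupport g) {M : ℝ}
    (hM : ∀ z, |g z| ≤ M) {ε : ℝ} (hε : 0 < ε) :
    ∃ A : Finset ℝ, ∀ x x' : ℝ, x < x' → ∀ u, |g (x, u) - g (x', u)| ≤
      ε + ∑ a ∈ A, 2 * M * (if x < a ∧ a ≤ x' then 1 else 0) := by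
  have hM0 : 0 ≤ M := (abs_nonneg _).trans (hM (0, 0))
  obtain ⟨R, hR⟩ : ∃ R : ℝ, ∀ z : ℝ × I, R < |z.1| → g z = 0 := by
    obtain ⟨R, hR⟩ := (hc.image continuous_fst).isBounded.exists_norm_le
    refine ⟨R, fun z hz => ?_⟩
    by_contra h
    have := hR z.1 ⟨z, subset_tsupport _ h, rfl⟩
    rw [Real.norm_eq_abs] at this
    linarith
  obtain ⟨δ, hδ, hu⟩ := Metric.uniformContinuous_iff.mp
    (hc.uniformContinuous_of_continuous hg) ε hε
  -- The grid has mesh $\delta$ and starts at $-R$; $N$ is large enough to include the first grid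
  -- point beyond any $x\le R$.
  let N : ℕ := ⌊2 * R / δ⌋₊ + 1
  refine ⟨(Finset.range (N + 1)).image fun k : ℕ => -R + k * δ, fun x x' hxx u => ?_⟩
  have hsum : ∀ a ∈ (Finset.range (N + 1)).image (fun k : ℕ => -R + k * δ),
      0 ≤ 2 * M * (if x < a ∧ a ≤ x' then 1 else 0) := fun a _ => by
    split_ifs <;> simp [hM0]
  have sep : ∀ k : ℕ, k ≤ N → x < -R + k * δ → -R + k * δ ≤ x' → |g (x, u) - g (x', u)| ≤
      ε + ∑ a ∈ (Finset.range (N + 1)).image (fun k : ℕ => -R + k * δ),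
        2 * M * (if x < a ∧ a ≤ x' then 1 else 0) := fun k hk h1 h2 => by
    have hmem : -R + k * δ ∈ (Finset.range (N + 1)).image fun k : ℕ => -R + k * δ :=
      Finset.mem_image.mpr ⟨k, by simpa [Nat.lt_succ_iff] using hk, rfl⟩
    have h3 := Finset.single_le_sum hsum hmem
    rw [if_pos ⟨h1, h2⟩, mul_one] at h3
    have h4 := abs_sub (g (x, u)) (g (x', u))
    linarith [hM (x, u), hM (x', u)]
  have small : |g (x, u) - g (x', u)| ≤ ε → |g (x, u) - g (x', u)| ≤
      ε + ∑ a ∈ (Finset.range (N + 1)).image (fun k : ℕ => -R + k * δ),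
        2 * M * (if x < a ∧ a ≤ x' then 1 else 0) := fun h => by
    linarith [Finset.sum_nonneg hsum]
  by_cases hd : x' - x < δ
  · apply small
    have := @hu (x, u) (x', u) (by
      rw [Prod.dist_eq, dist_self, max_eq_left dist_nonneg, dist_comm, Real.dist_eq,
        abs_of_pos (sub_pos.mpr hxx)]
      exact hd)
    rw [Real.dist_eq] at this
    exact this.le
  push Not at hd
  by_cases h1 : x' < -R
  · apply small
    rw [hR (x, u) (lt_abs.mpr (Or.inr (by simp only; linarith))),
      hR (x', u) (lt_abs.mpr (Or.inr (by simp only; linarith)))]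
    simpa using hε.le
  by_cases h2 : R < x
  · apply small
    rw [hR (x, u) (lt_abs.mpr (Or.inl h2)), hR (x', u) (lt_abs.mpr (Or.inl (h2.trans hxx)))]
    simpa using hε.le
  push Not at h1 h2
  by_cases h3 : x < -R
  · exact sep 0 (Nat.zero_le _) (by simpa using h3) (by simpa using h1)
  push Not at h3
  -- Here $-R\le x\le R$ and $x'-x\ge\delta$, so the first grid point strictly beyond $x$ lies in
  -- $(x,x']$.
  have hq : 0 ≤ (x + R) / δ := div_nonneg (by linarith) hδ.le
  have hfl := Nat.floor_le hq
  have hfl2 := Nat.lt_floor_add_one ((x + R) / δ)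
  rw [div_lt_iff₀ hδ] at hfl2
  rw [le_div_iff₀ hδ] at hfl
  refine sep (⌊(x + R) / δ⌋₊ + 1) ?_ ?_ ?_
  · have : ⌊(x + R) / δ⌋₊ ≤ ⌊2 * R / δ⌋₊ := Nat.floor_mono (by gcongr; linarith)
    omega
  · push_cast; linarith
  · push_cast; linarith

/-- Replacing $p$ by $g$ costs the approximation error at both members of a pair. The oscillation of
$g$ costs $\varepsilon$ per pair, plus the grid terms. A grid point separates at most one pair, so
the grid terms stay bounded as the sample grows. -/
theorem adjSum_sectionDist_le {n : ℕ} {p g : ℝ × I → ℝ} (hp : BddMeasurable p)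
    (hg : BddMeasurable g) {M ε : ℝ} (hM : 0 ≤ M) {A : Finset ℝ} (hε : 0 ≤ ε)
    (hA : ∀ x x' : ℝ, x < x' → ∀ u, |g (x, u) - g (x', u)| ≤
      ε + ∑ a ∈ A, 2 * M * (if x < a ∧ a ≤ x' then 1 else 0))
    {x : Fin n → ℝ} (hx : Function.Injective x) :
    adjSum Finset.univ x (fun i k => sectionDist p (x i) (x k)) ≤
      2 * ∑ i, (∫ u, |p (x i, u) - g (x i, u)|) + n * ε + 2 * M * A.card := by
  classical
  have bm : ∀ (f : ℝ × I → ℝ), BddMeasurable f → ∀ a : ℝ, BddMeasurable fun u : I => f (a, u) :=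
    fun f hf a => hf.comp (φ := fun u : I => (a, u)) (by fun_prop)
  have h1 : ∀ i k, Adj Finset.univ x i k → sectionDist p (x i) (x k) ≤
      ((∫ u, |p (x i, u) - g (x i, u)|) + ∫ u, |p (x k, u) - g (x k, u)|) + (ε +
        ∑ a ∈ A, 2 * M * (if x i < a ∧ a ≤ x k then 1 else 0)) := fun i k h => by
    have b1 := (((bm p hp (x i)).sub (bm g hg (x i))).abs).integrable (volume : Measure I)
    have b2 := (((bm p hp (x k)).sub (bm g hg (x k))).abs).integrable (volume : Measure I)
    have hc : ∀ c : ℝ, c = ∫ _u : I, c := fun c => by simp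
    have b3 : Integrable (fun u : I => |p (x i, u) - g (x i, u)| + |p (x k, u) - g (x k, u)|) :=
      b1.add b2
    rw [hc (ε + ∑ a ∈ A, _), ← integral_add b1 b2, ← integral_add b3 (integrable_const _)]
    refine integral_mono ((((bm p hp (x i)).sub (bm p hp (x k))).abs).integrable _)
      (b3.add (integrable_const _)) fun u => ?_
    have := hA _ _ h.2.2.1 u
    have e : p (x i, u) - p (x k, u) = (p (x i, u) - g (x i, u)) + (g (x i, u) - g (x k, u)) -
      (p (x k, u) - g (x k, u)) := by ring
    rw [e]
    refine (abs_sub _ _).trans ?_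
    linarith [abs_add_le (p (x i, u) - g (x i, u)) (g (x i, u) - g (x k, u))]
  refine (adjSum_mono h1).trans ?_
  rw [adjSum_add, adjSum_add, adjSum_add, adjSum_finsetSum]
  have f0 : ∀ i, 0 ≤ ∫ u, |p (x i, u) - g (x i, u)| := fun i => integral_nonneg fun _ => abs_nonneg _
  have a1 := adjSum_left_le (s := Finset.univ) hx f0
  have a2 := adjSum_right_le (s := Finset.univ) hx f0
  have a3 := adjSum_le_card_mul (s := Finset.univ) hx hε (F := fun _ _ => ε) fun _ _ => le_rfl
  have a4 : ∑ a ∈ A, adjSum Finset.univ x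
      (fun i k => 2 * M * (if x i < a ∧ a ≤ x k then 1 else 0)) ≤ 2 * M * A.card := by
    have : ∀ a ∈ A, adjSum Finset.univ x
        (fun i k => 2 * M * (if x i < a ∧ a ≤ x k then 1 else 0)) ≤ 2 * M := fun a _ => by
      rw [adjSum_const_mul]
      have := adjSum_separated_le (s := Finset.univ) hx a
      nlinarith
    refine (Finset.sum_le_card_nsmul _ _ _ this).trans (le_of_eq ?_)
    rw [nsmul_eq_mul]; ring
  rw [Fintype.card_fin] at a3
  linarith

/-- The expected total distance of neighbouring sections in a sample of size `n`. -/
noncomputable def neighbourDist (μ : Measure ℝ) (p : ℝ × I → ℝ) (n : ℕ) : ℝ :=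
  ∫ x, adjSum Finset.univ x (fun i k => sectionDist p (x i) (x k)) ∂(iid (Fin n) μ)

theorem bddMeasurable_adjSum_sectionDist {p : ℝ × I → ℝ} (hp : BddMeasurable p) (n : ℕ) :
    BddMeasurable fun x : Fin n → ℝ =>
      adjSum Finset.univ x (fun i k => sectionDist p (x i) (x k)) :=
  BddMeasurable.adjSum (fun i => measurable_pi_apply i) fun i k =>
    hp.sectionDist.comp (φ := fun x : Fin n → ℝ => (x i, x k)) (by fun_prop)

theorem neighbourDist_nonneg (μ : Measure ℝ) (p : ℝ × I → ℝ) (n : ℕ) : 0 ≤ neighbourDist μ p n :=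
  integral_nonneg fun _ => adjSum_nonneg fun _ _ => sectionDist_nonneg _ _ _

/-- Compactly supported continuous functions are dense in $L^1(\mu\otimes\mathrm{vol})$. The
approximation and the oscillation together cost $3n\varepsilon$, and the cost of the grid is
independent of $n$. No continuity of $p$ in $x$ is needed. -/
theorem tendsto_neighbourDist (μ : Measure ℝ) [IsProbabilityMeasure μ] [NullSingletonClass μ]
    {p : ℝ × I → ℝ} (hp : BddMeasurable p) :
    Tendsto (fun n : ℕ => neighbourDist μ p n / n) atTop (𝓝 0) := by
  rw [Metric.tendsto_atTop]
  intro η hη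
  set ε := η / 8 with hεdef
  have hε : 0 < ε := by positivity
  obtain ⟨g, hgc, hgi, hgcont, -⟩ := (hp.integrable
    (μ.prod (volume : Measure I))).exists_hasCompactSupport_integral_sub_le hε
  obtain ⟨M, hM⟩ := hgc.exists_bound_of_continuous hgcont
  have hM0 : 0 ≤ M := (norm_nonneg _).trans (hM (0, 0))
  have hgb : BddMeasurable g := ⟨hgcont.measurable, M, hM⟩
  obtain ⟨A, hA⟩ := exists_grid hgcont hgc hM hε
  obtain ⟨N, hN⟩ := exists_nat_gt (2 * M * A.card / ε)
  refine ⟨N + 1, fun n hn => ?_⟩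
  have hn0 : (0 : ℝ) < n := by exact_mod_cast (by omega : 0 < n)
  have hδ : BddMeasurable fun x : ℝ => ∫ u, |p (x, u) - g (x, u)| :=
    BddMeasurable.integral_right (F := fun (x : ℝ) (u : I) => |p (x, u) - g (x, u)|)
      ((hp.sub hgb).abs) _
  have hle : neighbourDist μ p n ≤ 2 * (n * ε) + n * ε + 2 * M * A.card := by
    have hB : BddMeasurable fun x : Fin n → ℝ => ∑ i, ∫ u, |p (x i, u) - g (x i, u)| :=
      BddMeasurable.finsetSum _ fun i _ => hδ.comp (measurable_pi_apply i)
    have h1 : neighbourDist μ p n ≤ ∫ x, (2 * ∑ i, (∫ u, |p (x i, u) - g (x i, u)|) +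
        n * ε + 2 * M * A.card) ∂(iid (Fin n) μ) := by
      refine integral_mono_ae ((bddMeasurable_adjSum_sectionDist hp n).integrable _)
        ((((hB.const_mul 2).add (BddMeasurable.const _)).add (BddMeasurable.const _)).integrable _)
        ?_
      filter_upwards [ae_injective_of_noAtoms (ι := Fin n) μ] with x hx
      exact adjSum_sectionDist_le hp hgb hM0 hε.le hA hx
    refine h1.trans ?_
    rw [integral_add (((hB.const_mul 2).add (BddMeasurable.const _)).integrable _)
      (integrable_const _), integral_add ((hB.const_mul 2).integrable _) (integrable_const _),
      integral_const_mul, integral_finsetSum _ fun i _ =>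
        (hδ.comp (measurable_pi_apply i)).integrable _]
    simp_rw [integral_iid_eval μ hδ.measurable]
    have h2 : ∫ x, ∫ u, |p (x, u) - g (x, u)| ∂(volume : Measure I) ∂μ ≤ ε := by
      rw [integral_integral (((hp.sub hgb).abs).integrable _)]
      simpa only [Real.norm_eq_abs] using hgi
    simp only [Finset.sum_const, Finset.card_univ, Fintype.card_fin, nsmul_eq_mul, integral_const,
      probReal_univ, smul_eq_mul, one_mul]
    gcongr
  rw [Real.dist_eq, sub_zero, abs_of_nonneg (div_nonneg (neighbourDist_nonneg _ _ _) hn0.le),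
    div_lt_iff₀ hn0]
  have h3 : 2 * M * A.card < ε * n := by
    rw [div_lt_iff₀ hε] at hN
    have : (N : ℝ) ≤ n := by exact_mod_cast (by omega : N ≤ n)
    nlinarith
  have : η = 8 * ε := by rw [hεdef]; ring
  rw [this]
  nlinarith

end RankBootstrap

namespace RankBootstrap

open unitInterval

/-! ### Linearization of the rank variation -/

/-- The law of a point `(x, u)`, with `u` uniformly distributed and independent of `x`. -/
noncomputable abbrev joint (μ : Measure ℝ) : Measure (ℝ × I) := μ.prod volume

section Fubini

variable {ι : Type*} [Fintype ι] [DecidableEq ι] (μ : Measure ℝ) [IsProbabilityMeasure μ]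

/-- This is the form in which one conditions on all the $x$-coordinates. -/
theorem integral_iid_joint {G : Type*} [NormedAddCommGroup G] [NormedSpace ℝ G]
    {Φ : (ι → ℝ) → (ι → I) → G}
    (hΦ : Integrable (Function.uncurry Φ) ((iid ι μ).prod (iid ι (volume : Measure I)))) :
    ∫ z, Φ (fun i => (z i).1) (fun i => (z i).2) ∂(iid ι (joint μ)) =
      ∫ x, ∫ u, Φ x u ∂(iid ι (volume : Measure I)) ∂(iid ι μ) := by
  have h := measurePreserving_arrowProdEquivProdArrow ℝ I ι (fun _ => μ)
    (fun _ => (volume : Measure I))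
  rw [integral_integral hΦ, ← h.integral_comp']
  rfl

theorem integral_pair {E : Type*} [MeasurableSpace E] {ρ : Measure E} [IsProbabilityMeasure ρ]
    {f : E × E → ℝ} (hf : BddMeasurable f) {i k : ι} (hik : i ≠ k) :
    ∫ u, f (u i, u k) ∂(iid ι ρ) = ∫ w, f w ∂(ρ.prod ρ) := by
  rw [integral_free_update (j := k) (Φ := fun (u : ι → E) w => f (u i, w))
    (hf.comp (φ := fun v : (ι → E) × E => (v.1 i, v.2)) (by fun_prop))
    (fun w z v => by simp [Function.update_of_ne hik])]
  have : ∀ w, ∫ u, f (u i, w) ∂(iid ι ρ) = ∫ a, f (a, w) ∂ρ := fun w =>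
    integral_iid_eval ρ (f := fun a => f (a, w)) (hf.measurable.comp (by fun_prop)) i
  simp_rw [this]
  rw [integral_prod_symm _ (hf.integrable _)]

theorem integral_adjSum_fixed {Ω : Type*} [MeasurableSpace Ω] {ρ : Measure Ω}
    [IsProbabilityMeasure ρ] {s : Finset ι} {x : ι → ℝ} {F : Ω → ι → ι → ℝ}
    (hF : ∀ i k, BddMeasurable fun u => F u i k) :
    ∫ u, adjSum s x (F u) ∂ρ = adjSum s x (fun i k => ∫ u, F u i k ∂ρ) := by
  classical
  have hB : ∀ i k, BddMeasurable fun u => if Adj s x i k then F u i k else 0 := fun i k => by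
    split_ifs
    · exact hF i k
    · exact BddMeasurable.const 0
  simp only [adjSum]
  rw [integral_finsetSum _ fun i _ => (BddMeasurable.finsetSum _ fun k _ => hB i k).integrable _]
  refine Finset.sum_congr rfl fun i _ => ?_
  rw [integral_finsetSum _ fun k _ => (hB i k).integrable _]
  refine Finset.sum_congr rfl fun k _ => ?_
  split_ifs <;> simp

/-- The neighbour relation depends on the $x$-coordinates alone, so the uniform variables of each
pair can be integrated out inside the sum. -/
theorem integral_adjSum {f : (ℝ × ℝ) × (I × I) → ℝ} (hf : BddMeasurable f) :
    ∫ z, adjSum Finset.univ (fun i => (z i).1)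
      (fun i k => f (((z i).1, (z k).1), ((z i).2, (z k).2))) ∂(iid ι (joint μ)) =
    ∫ x, adjSum Finset.univ x (fun i k => ∫ w, f ((x i, x k), w)) ∂(iid ι μ) := by
  classical
  have hb : BddMeasurable fun v : (ι → ℝ) × (ι → I) => adjSum Finset.univ v.1
      (fun i k => f ((v.1 i, v.1 k), (v.2 i, v.2 k))) :=
    BddMeasurable.adjSum (fun i => (measurable_pi_apply i).comp measurable_fst) fun i k =>
      hf.comp (φ := fun v : (ι → ℝ) × (ι → I) => ((v.1 i, v.1 k), (v.2 i, v.2 k))) (by fun_prop)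
  refine (integral_iid_joint μ (Φ := fun x u => adjSum Finset.univ x
    (fun i k => f ((x i, x k), (u i, u k)))) (hb.integrable _)).trans ?_
  congr 1; ext x
  have hbu : ∀ i k, BddMeasurable fun u : ι → I => f ((x i, x k), (u i, u k)) := fun i k =>
    hf.comp (φ := fun u : ι → I => ((x i, x k), (u i, u k))) (by fun_prop)
  rw [integral_adjSum_fixed hbu]
  exact adjSum_congr fun i k h => integral_pair (f := fun w => f ((x i, x k), w))
    (hf.comp (φ := fun w : I × I => ((x i, x k), w)) (by fun_prop)) h.ne

/-- The second moment of a sum of centred bounded iid terms. -/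
theorem integral_sq_sum_le {E : Type*} [MeasurableSpace E] {ρ : Measure E}
    [IsProbabilityMeasure ρ] {f : E → ℝ} (hf : Measurable f) (hb : ∀ w, |f w| ≤ 1)
    (h0 : ∫ w, f w ∂ρ = 0) (s : Finset ι) :
    ∫ z, (∑ k ∈ s, f (z k)) ^ 2 ∂(iid ι ρ) ≤ Fintype.card ι := by
  have hfb : BddMeasurable f := ⟨hf, 1, hb⟩
  have hB : ∀ t : Finset ι, BddMeasurable fun z : ι → E => ∑ k ∈ t, f (z k) := fun t =>
    BddMeasurable.finsetSum _ fun k _ => hfb.comp (measurable_pi_apply k)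
  have h := efronStein (μ := ρ) (hB s) (fun j z => ∑ k ∈ s.erase j, f (z k))
    (fun j => hB _) (fun j z w => Finset.sum_congr rfl fun k hk => by
      rw [Function.update_of_ne (Finset.ne_of_mem_erase hk)])
  have hm : ∫ z, ∑ k ∈ s, f (z k) ∂(iid ι ρ) = 0 := by
    rw [integral_finsetSum _ fun k _ => (hfb.comp (measurable_pi_apply k)).integrable _]
    simp_rw [integral_iid_eval ρ hf, h0]
    simp
  rw [hm] at h
  simp only [sub_zero] at h
  refine h.trans ?_
  have : ∀ j, ∫ z, ((∑ k ∈ s, f (z k)) - ∑ k ∈ s.erase j, f (z k)) ^ 2 ∂(iid ι ρ) ≤ 1 := by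
    intro j
    have hle : ∀ z : ι → E, ((∑ k ∈ s, f (z k)) - ∑ k ∈ s.erase j, f (z k)) ^ 2 ≤ 1 := fun z => by
      by_cases hj : j ∈ s
      · rw [← Finset.add_sum_erase s (fun k => f (z k)) hj, add_sub_cancel_right]
        exact (sq_le_one_iff_abs_le_one _).mpr (hb _)
      · rw [Finset.erase_eq_of_notMem hj]; simp
    calc _ ≤ ∫ _z, (1 : ℝ) ∂(iid ι ρ) := integral_mono
          ((((hB s).sub (hB _)).pow 2).integrable _) (integrable_const _) hle
      _ = 1 := by simp
  refine (Finset.sum_le_card_nsmul _ _ 1 fun j _ => this j).trans ?_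
  simp

end Fubini

/-- The indicator of `t ≤ y`. -/
noncomputable def step (t y : ℝ) : ℝ := if t ≤ y then 1 else 0

theorem bddMeasurable_step : BddMeasurable fun w : ℝ × ℝ => step w.1 w.2 :=
  BddMeasurable.ite (measurableSet_le measurable_fst measurable_snd) (BddMeasurable.const 1)
    (BddMeasurable.const 0)

theorem step_nonneg (t y : ℝ) : 0 ≤ step t y := by unfold step; split_ifs <;> simp

theorem step_le_one (t y : ℝ) : step t y ≤ 1 := by unfold step; split_ifs <;> simp

theorem step_mono (t : ℝ) {y y' : ℝ} (h : y ≤ y') : step t y ≤ step t y' := by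
  unfold step
  split_ifs with h1 h2
  · exact le_rfl
  · exact absurd (h1.trans h) h2
  · exact zero_le_one
  · exact le_rfl

theorem abs_sub_le_one {a b : ℝ} (ha : 0 ≤ a) (ha' : a ≤ 1) (hb : 0 ≤ b) (hb' : b ≤ 1) :
    |a - b| ≤ 1 := by
  rw [abs_le]; constructor <;> linarith

theorem abs_step_sub_le_one (t y y' : ℝ) : |step t y - step t y'| ≤ 1 :=
  abs_sub_le_one (step_nonneg _ _) (step_le_one _ _) (step_nonneg _ _) (step_le_one _ _)

/-- The differences `step t y - step t y'` have the same sign for all `t`. -/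
theorem sum_abs_step_sub {α : Type*} (s : Finset α) (t : α → ℝ) (y y' : ℝ) :
    |∑ l ∈ s, step (t l) y - ∑ l ∈ s, step (t l) y'| = ∑ l ∈ s, |step (t l) y - step (t l) y'| := by
  rw [← Finset.sum_sub_distrib]
  rcases le_total y y' with h | h
  · have h1 : ∀ l, step (t l) y - step (t l) y' ≤ 0 := fun l => by linarith [step_mono (t l) h]
    rw [abs_of_nonpos (Finset.sum_nonpos fun l _ => h1 l), ← Finset.sum_neg_distrib]
    exact Finset.sum_congr rfl fun l _ => (abs_of_nonpos (h1 l)).symm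
  · have h1 : ∀ l, 0 ≤ step (t l) y - step (t l) y' := fun l => by linarith [step_mono (t l) h]
    rw [abs_of_nonneg (Finset.sum_nonneg fun l _ => h1 l)]
    exact Finset.sum_congr rfl fun l _ => (abs_of_nonneg (h1 l)).symm

theorem integral_step (ν : Measure ℝ) (y : ℝ) :
    ∫ t, step t y ∂ν = ν.real (Set.Iic y) := by
  have : (fun t => step t y) = Set.indicator (Set.Iic y) 1 := by
    ext t; simp [step, Set.indicator_apply]
  rw [this, integral_indicator_one measurableSet_Iic]

theorem bddMeasurable_step_left (y : ℝ) : BddMeasurable fun t => step t y :=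
  bddMeasurable_step.comp (φ := fun t : ℝ => (t, y)) (by fun_prop)

theorem integral_abs_step_sub (ν : Measure ℝ) [IsProbabilityMeasure ν] (y y' : ℝ) :
    ∫ t, |step t y - step t y'| ∂ν = |ν.real (Set.Iic y) - ν.real (Set.Iic y')| := by
  have i := fun y => (bddMeasurable_step_left y).integrable ν
  rcases le_total y y' with h | h
  · have h1 : ∀ t, |step t y - step t y'| = step t y' - step t y := fun t => by
      rw [abs_of_nonpos (by linarith [step_mono t h])]; ring
    have h2 : ν.real (Set.Iic y) ≤ ν.real (Set.Iic y') := measureReal_mono (Set.Iic_subset_Iic.mpr h)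
    simp_rw [h1]
    rw [integral_sub (i _) (i _), integral_step, integral_step, abs_of_nonpos (by linarith)]
    ring
  · have h1 : ∀ t, |step t y - step t y'| = step t y - step t y' := fun t =>
      abs_of_nonneg (by linarith [step_mono t h])
    have h2 : ν.real (Set.Iic y') ≤ ν.real (Set.Iic y) := measureReal_mono (Set.Iic_subset_Iic.mpr h)
    simp_rw [h1]
    rw [integral_sub (i _) (i _), integral_step, integral_step, abs_of_nonneg (by linarith)]

section Model

variable (μ : Measure ℝ) (q : ℝ × I → ℝ)

/-- The law of `Y = q (x, u)`. -/
noncomputable def lawY : Measure ℝ := (joint μ).map q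

/-- The score `F (Y)`, where `F` is the distribution function of `Y`. -/
noncomputable def score (w : ℝ × I) : ℝ := (lawY μ q).real (Set.Iic (q w))

/-- The probability that `t` separates two conditionally independent copies of `Y`. -/
noncomputable def crossProb (t : ℝ) : ℝ :=
  ∫ w : ℝ × (I × I), |step t (q (w.1, w.2.2)) - step t (q (w.1, w.2.1))| ∂(μ.prod volume)

/-- The number of pairs of neighbours whose `Y`-values are separated by `t`. -/
noncomputable def crossCount {ι : Type*} [Fintype ι] (s : Finset ι) (z : ι → ℝ × I) (t : ℝ) : ℝ :=
  adjSum s (fun i => (z i).1) (fun i k => |step t (q (z k)) - step t (q (z i))|)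

variable {μ q} [IsProbabilityMeasure μ] (hq : Measurable q)
include hq

theorem isProbabilityMeasure_lawY : IsProbabilityMeasure (lawY μ q) :=
  Measure.isProbabilityMeasure_map hq.aemeasurable

theorem integral_lawY {f : ℝ → ℝ} (hf : Measurable f) :
    ∫ t, f t ∂(lawY μ q) = ∫ w, f (q w) ∂(joint μ) :=
  integral_map hq.aemeasurable hf.aestronglyMeasurable

end Model

end RankBootstrap

/-! ### Crossing numbers: how many neighbour pairs a level separates. -/

namespace RankBootstrap

open unitInterval

theorem integral_sq_sub_const {Ω : Type*} [MeasurableSpace Ω] (P : Measure Ω)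
    [IsProbabilityMeasure P] {g : Ω → ℝ} (hg : BddMeasurable g) (a : ℝ) :
    ∫ z, (g z - a) ^ 2 ∂P = ∫ z, (g z - ∫ w, g w ∂P) ^ 2 ∂P + (∫ z, g z ∂P - a) ^ 2 := by
  rw [integral_sq_sub_integral P hg]
  have : ∀ z, (g z - a) ^ 2 = (g z ^ 2 - 2 * a * g z) + a ^ 2 := fun z => by ring
  simp_rw [this]
  rw [integral_add (((hg.pow 2).sub (hg.const_mul (2 * a))).integrable P)
    (integrable_const _), integral_sub ((hg.pow 2).integrable P)
    ((hg.const_mul (2 * a)).integrable P), integral_const_mul]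
  simp
  ring

theorem integral_mono_bdd {Ω : Type*} [MeasurableSpace Ω] {P : Measure Ω}
    [IsProbabilityMeasure P] {f g : Ω → ℝ} (hf : BddMeasurable f) (hg : BddMeasurable g)
    (h : ∀ᵐ z ∂P, f z ≤ g z) : ∫ z, f z ∂P ≤ ∫ z, g z ∂P :=
  integral_mono_ae (hf.integrable P) (hg.integrable P) h

theorem integral_le_const {Ω : Type*} [MeasurableSpace Ω] {P : Measure Ω}
    [IsProbabilityMeasure P] {f : Ω → ℝ} (hf : BddMeasurable f) {C : ℝ}
    (h : ∀ᵐ z ∂P, f z ≤ C) : ∫ z, f z ∂P ≤ C := by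
  simpa using integral_mono_bdd hf (BddMeasurable.const C) h

theorem bddMeasurable_step_comp {Ω : Type*} [MeasurableSpace Ω] {a b : Ω → ℝ}
    (ha : Measurable a) (hb : Measurable b) : BddMeasurable fun ω => step (a ω) (b ω) :=
  bddMeasurable_step.comp (ha.prodMk hb)

theorem BddMeasurable.add_const {Ω : Type*} [MeasurableSpace Ω] {f : Ω → ℝ}
    (hf : BddMeasurable f) (c : ℝ) : BddMeasurable fun z => f z + c :=
  hf.add (BddMeasurable.const c)

theorem BddMeasurable.sub_const {Ω : Type*} [MeasurableSpace Ω] {f : Ω → ℝ}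
    (hf : BddMeasurable f) (c : ℝ) : BddMeasurable fun z => f z - c :=
  hf.sub (BddMeasurable.const c)

section Model

variable {μ : Measure ℝ} {q : ℝ × I → ℝ} [IsProbabilityMeasure μ]

theorem ae_injective_fst {ι : Type*} [Fintype ι] [DecidableEq ι] [NullSingletonClass μ] :
    ∀ᵐ z ∂(iid ι (joint μ)), Function.Injective fun i => (z i).1 := by
  have h : Measure.map (fun (z : ι → ℝ × I) i => (z i).1) (iid ι (joint μ)) = iid ι μ := by
    rw [Measure.pi_map_pi fun _ => measurable_fst.aemeasurable]
    congr 1; ext1 i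
    exact Measure.fst_prod
  have h2 := ae_injective_of_noAtoms (ι := ι) μ
  rw [← h] at h2
  exact ae_of_ae_map (measurable_pi_lambda _ fun i =>
    (measurable_pi_apply i).fst).aemeasurable h2

theorem score_nonneg (w : ℝ × I) : 0 ≤ score μ q w := measureReal_nonneg

theorem crossProb_nonneg (t : ℝ) : 0 ≤ crossProb μ q t := integral_nonneg fun _ => abs_nonneg _

/-- Once $j$ is removed from the index set, neither the neighbour relation nor the remaining terms
see the point $z_j$. This supplies the comparison functions for `efronStein`. -/
theorem free_adjSum_erase {n : ℕ} {j : Fin n} {F : (Fin n → ℝ × I) → Fin n → Fin n → ℝ}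
    (hF : ∀ z w i k, i ≠ j → k ≠ j → F (Function.update z j w) i k = F z i k) :
    Free j fun z : Fin n → ℝ × I => adjSum (Finset.univ.erase j) (fun i => (z i).1) (F z) := by
  classical
  intro z w
  refine Finset.sum_congr rfl fun i _ => Finset.sum_congr rfl fun k _ => ?_
  by_cases hi : i = j
  · subst hi
    have h1 : ∀ x : Fin n → ℝ, ¬ Adj (Finset.univ.erase i) x i k := fun x h => by
      simpa using h.1
    rw [if_neg (h1 _), if_neg (h1 _)]
  by_cases hk : k = j
  · subst hk
    have h1 : ∀ x : Fin n → ℝ, ¬ Adj (Finset.univ.erase k) x i k := fun x h => by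
      simpa using h.2.1
    rw [if_neg (h1 _), if_neg (h1 _)]
  refine if_congr ?_ (hF z w i k hi hk) rfl
  simp only [Adj]
  rw [Function.update_of_ne hi, Function.update_of_ne hk]
  refine and_congr_right fun _ => and_congr_right fun _ => and_congr_right fun _ =>
    forall₂_congr fun l hl => ?_
  rw [Function.update_of_ne (Finset.ne_of_mem_erase hl)]

theorem free_crossCount {n : ℕ} (j : Fin n) (t : ℝ) :
    Free j fun z : Fin n → ℝ × I => crossCount q (Finset.univ.erase j) z t :=
  free_adjSum_erase fun z w i k hi hk => by
    rw [Function.update_of_ne hi, Function.update_of_ne hk]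

theorem crossCount_nonneg {n : ℕ} (s : Finset (Fin n)) (z : Fin n → ℝ × I) (t : ℝ) :
    0 ≤ crossCount q s z t := adjSum_nonneg fun _ _ => abs_nonneg _

theorem crossCount_le {n : ℕ} {s : Finset (Fin n)} {z : Fin n → ℝ × I}
    (hz : Function.Injective fun i => (z i).1) (t : ℝ) : crossCount q s z t ≤ n := by
  have := adjSum_le_card_mul (s := s) hz zero_le_one
    (F := fun i k => |step t (q (z k)) - step t (q (z i))|) fun i k => abs_step_sub_le_one _ _ _
  simpa [crossCount] using this

theorem abs_crossCount_sub_erase_le {n : ℕ} {z : Fin n → ℝ × I}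
    (hz : Function.Injective fun i => (z i).1) (j : Fin n) (t : ℝ) :
    |crossCount q Finset.univ z t - crossCount q (Finset.univ.erase j) z t| ≤ 3 := by
  have := abs_adjSum_sub_adjSum_erase_le_const hz (Finset.mem_univ j)
    (F := fun i k => |step t (q (z k)) - step t (q (z i))|) (B := 1)
    (fun i k => by rw [abs_abs]; exact abs_step_sub_le_one _ _ _)
  simpa [crossCount] using this

variable (hq : Measurable q)
include hq

theorem score_le_one (w : ℝ × I) : score μ q w ≤ 1 := by
  have := isProbabilityMeasure_lawY (μ := μ) hq
  exact measureReal_le_one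

theorem bddMeasurable_score : BddMeasurable (score μ q) := by
  have := isProbabilityMeasure_lawY (μ := μ) hq
  refine ⟨?_, 1, fun w => by
    rw [abs_of_nonneg (score_nonneg w)]; exact score_le_one hq w⟩
  have hm : Monotone fun t => (lawY μ q).real (Set.Iic t) := fun a b hab =>
    measureReal_mono (Set.Iic_subset_Iic.mpr hab)
  exact hm.measurable.comp hq

theorem bddMeasurable_crossCount {n : ℕ} (s : Finset (Fin n)) :
    BddMeasurable fun v : (Fin n → ℝ × I) × ℝ => crossCount q s v.1 v.2 :=
  BddMeasurable.adjSum (by fun_prop) fun i k =>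
    ((bddMeasurable_step_comp (by fun_prop) (by fun_prop)).sub
      (bddMeasurable_step_comp (by fun_prop) (by fun_prop))).abs

theorem bddMeasurable_crossCount' {n : ℕ} (s : Finset (Fin n)) (t : ℝ) :
    BddMeasurable fun z : Fin n → ℝ × I => crossCount q s z t :=
  (bddMeasurable_crossCount hq s).comp (φ := fun z => (z, t)) (by fun_prop)

theorem bddMeasurable_crossProb : BddMeasurable (crossProb μ q) :=
  BddMeasurable.integral_right
    (F := fun (t : ℝ) (w : ℝ × (I × I)) => |step t (q (w.1, w.2.2)) - step t (q (w.1, w.2.1))|)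
    ((bddMeasurable_step_comp (by fun_prop) (by fun_prop)).sub
      (bddMeasurable_step_comp (by fun_prop) (by fun_prop))).abs _

theorem crossProb_le_one (t : ℝ) : crossProb μ q t ≤ 1 :=
  integral_le_const ((bddMeasurable_step_comp (by fun_prop) (by fun_prop)).sub
      (bddMeasurable_step_comp (by fun_prop) (by fun_prop))).abs
    (Eventually.of_forall fun _ => abs_step_sub_le_one _ _ _)

theorem integral_free_lawY {n : ℕ} {j : Fin n} {Φ : (Fin n → ℝ × I) → ℝ → ℝ}
    (hΦ : BddMeasurable (Function.uncurry Φ)) (hfree : ∀ t, Free j fun z => Φ z t) :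
    ∫ z, Φ z (q (z j)) ∂(iid (Fin n) (joint μ)) =
      ∫ t, ∫ z, Φ z t ∂(iid (Fin n) (joint μ)) ∂(lawY μ q) := by
  rw [integral_free_update (Φ := fun z w => Φ z (q w))
    (hΦ.comp (φ := fun v : (Fin n → ℝ × I) × (ℝ × I) => (v.1, q v.2)) (by fun_prop))
    (fun w => hfree (q w)), integral_lawY hq]
  exact (BddMeasurable.integral_left hΦ _).measurable

variable (μ q) in
/-- The total score variation of neighbours. -/
noncomputable def scoreVariation {n : ℕ} (z : Fin n → ℝ × I) : ℝ :=
  adjSum Finset.univ (fun i => (z i).1) (fun i k => |score μ q (z k) - score μ q (z i)|)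

theorem bddMeasurable_scoreVariation (n : ℕ) :
    BddMeasurable fun z : Fin n → ℝ × I => scoreVariation μ q z :=
  BddMeasurable.adjSum (by fun_prop) fun i k =>
    (((bddMeasurable_score hq).comp (measurable_pi_apply k)).sub
      ((bddMeasurable_score hq).comp (measurable_pi_apply i))).abs

theorem bddMeasurable_crossCount_sub {n : ℕ} (s : Finset (Fin n)) :
    BddMeasurable fun v : (Fin n → ℝ × I) × ℝ => crossCount q s v.1 v.2 - n * crossProb μ q v.2 :=
  (bddMeasurable_crossCount hq s).sub
    (((bddMeasurable_crossProb hq).comp measurable_snd).const_mul _)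

variable [NullSingletonClass μ]

/-- Efron–Stein: removing a point changes the crossing number by at most $3$. -/
theorem variance_crossCount_le (n : ℕ) (t : ℝ) :
    ∫ z, (crossCount q Finset.univ z t - ∫ w, crossCount q Finset.univ w t
      ∂(iid (Fin n) (joint μ))) ^ 2 ∂(iid (Fin n) (joint μ)) ≤ 9 * n := by
  have hb := fun s => bddMeasurable_crossCount' hq (n := n) s t
  refine (efronStein (μ := joint μ) (hb Finset.univ)
    (fun j z => crossCount q (Finset.univ.erase j) z t) (fun j => hb _)
    (fun j => free_crossCount j t)).trans ?_
  have : ∀ j : Fin n, ∫ z, (crossCount q Finset.univ z t -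
      crossCount q (Finset.univ.erase j) z t) ^ 2 ∂(iid (Fin n) (joint μ)) ≤ 9 := fun j => by
    refine integral_le_const (((hb _).sub (hb _)).pow 2) ?_
    filter_upwards [ae_injective_fst (ι := Fin n) (μ := μ)] with z hz
    have := abs_crossCount_sub_erase_le (q := q) hz j t
    nlinarith [abs_le.mp this]
  refine (Finset.sum_le_card_nsmul _ _ 9 fun j _ => this j).trans ?_
  simp [mul_comm]

/-- If $Y_k=q(x_k,u_k)$ is replaced by $q(x_i,u_k)$, a neighbour pair becomes two conditionally
independent copies on the section at $x_i$. The expected sum is then $n$ times `crossProb`, up to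
the largest point, which accounts for the $1$. The replacement error is kept as an integral, to be
controlled after integration over $t$. -/
theorem abs_integral_crossCount_sub_le (n : ℕ) (t : ℝ) :
    |∫ z, crossCount q Finset.univ z t ∂(iid (Fin n) (joint μ)) - n * crossProb μ q t| ≤
      ∫ z, adjSum Finset.univ (fun i => (z i).1)
        (fun i k => |step t (q (z k)) - step t (q ((z i).1, (z k).2))|)
          ∂(iid (Fin n) (joint μ)) + 1 := by
  set P := iid (Fin n) (joint μ) with hP
  have hf : BddMeasurable fun v : (ℝ × ℝ) × (I × I) =>
      |step t (q (v.1.1, v.2.2)) - step t (q (v.1.1, v.2.1))| :=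
    ((bddMeasurable_step_comp (by fun_prop) (by fun_prop)).sub
      (bddMeasurable_step_comp (by fun_prop) (by fun_prop))).abs
  let γ : ℝ → ℝ := fun x => ∫ w : I × I, |step t (q (x, w.2)) - step t (q (x, w.1))|
  have hγ : BddMeasurable γ := BddMeasurable.integral_right
    (F := fun (x : ℝ) (w : I × I) => |step t (q (x, w.2)) - step t (q (x, w.1))|)
    (((bddMeasurable_step_comp (by fun_prop) (by fun_prop)).sub
      (bddMeasurable_step_comp (by fun_prop) (by fun_prop))).abs) _
  have hγ1 : ∀ x, |γ x| ≤ 1 := fun x => by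
    rw [abs_of_nonneg (integral_nonneg fun _ => abs_nonneg _)]
    exact integral_le_const (((bddMeasurable_step_comp (by fun_prop) (by fun_prop)).sub
      (bddMeasurable_step_comp (by fun_prop) (by fun_prop))).abs)
      (Eventually.of_forall fun _ => abs_step_sub_le_one _ _ _)
  have hc : crossProb μ q t = ∫ x, γ x ∂μ := by
    unfold crossProb
    rw [integral_prod]
    exact BddMeasurable.integrable (((bddMeasurable_step_comp (by fun_prop) (by fun_prop)).sub
      (bddMeasurable_step_comp (by fun_prop) (by fun_prop))).abs) _
  let T : (Fin n → ℝ × I) → ℝ := fun z => adjSum Finset.univ (fun i => (z i).1)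
    (fun i k => |step t (q ((z i).1, (z k).2)) - step t (q ((z i).1, (z i).2))|)
  let R : (Fin n → ℝ × I) → ℝ := fun z => adjSum Finset.univ (fun i => (z i).1)
    (fun i k => |step t (q (z k)) - step t (q ((z i).1, (z k).2))|)
  have hT : BddMeasurable T := BddMeasurable.adjSum (by fun_prop) fun i k =>
    ((bddMeasurable_step_comp (by fun_prop) (by fun_prop)).sub
      (bddMeasurable_step_comp (by fun_prop) (by fun_prop))).abs
  have hR : BddMeasurable R := BddMeasurable.adjSum (by fun_prop) fun i k =>
    ((bddMeasurable_step_comp (by fun_prop) (by fun_prop)).sub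
      (bddMeasurable_step_comp (by fun_prop) (by fun_prop))).abs
  have hS := bddMeasurable_crossCount' hq (n := n) Finset.univ t
  have hET : ∫ z, T z ∂P = ∫ x, adjSum Finset.univ x (fun i _ => γ (x i)) ∂(iid (Fin n) μ) :=
    integral_adjSum (ι := Fin n) μ hf
  have hnc : n * crossProb μ q t = ∫ x, ∑ i, γ (x i) ∂(iid (Fin n) μ) := by
    rw [integral_finsetSum _ fun i _ => (hγ.comp (measurable_pi_apply i)).integrable _]
    simp_rw [integral_iid_eval μ hγ.measurable, ← hc]
    simp
  have hγs : BddMeasurable fun x : Fin n → ℝ => ∑ i, γ (x i) :=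
    BddMeasurable.finsetSum _ fun i _ => hγ.comp (measurable_pi_apply i)
  have hγa : BddMeasurable fun x : Fin n → ℝ => adjSum Finset.univ x (fun i _ => γ (x i)) :=
    BddMeasurable.adjSum (by fun_prop) fun i k => hγ.comp (measurable_pi_apply i)
  have h1 : |∫ z, T z ∂P - n * crossProb μ q t| ≤ 1 := by
    rw [hET, hnc, abs_sub_comm, ← integral_sub (hγs.integrable _) (hγa.integrable _)]
    refine (abs_integral_le_integral_abs).trans (integral_le_const ((hγs.sub hγa).abs) ?_)
    filter_upwards [ae_injective_of_noAtoms (ι := Fin n) μ] with x hx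
    exact abs_sum_sub_adjSum_left_le hx zero_le_one fun i => hγ1 _
  have h2 : |∫ z, crossCount q Finset.univ z t ∂P - ∫ z, T z ∂P| ≤ ∫ z, R z ∂P := by
    rw [← integral_sub (hS.integrable _) (hT.integrable _)]
    refine (abs_integral_le_integral_abs).trans
      (integral_mono_bdd ((hS.sub hT).abs) hR (Eventually.of_forall fun z => ?_))
    simp only [crossCount, T, R]
    rw [← adjSum_sub]
    refine abs_adjSum_le.trans (adjSum_mono fun i k _ => ?_)
    refine (abs_abs_sub_abs_le_abs_sub _ _).trans (le_of_eq ?_)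
    congr 1
    simp
  calc _ ≤ |∫ z, crossCount q Finset.univ z t ∂P - ∫ z, T z ∂P| +
        |∫ z, T z ∂P - n * crossProb μ q t| := abs_sub_le _ _ _
    _ ≤ _ := add_le_add h2 h1

/-- Integrating $|1\{t\le y\}-1\{t\le y'\}|$ over $t$ with respect to the law of $Y$ gives
$|F(y)-F(y')|$, so the replacement error becomes the $L^1$-distance of neighbouring sections of the
score. -/
theorem integral_abs_integral_crossCount_sub_le (n : ℕ) :
    ∫ t, |∫ z, crossCount q Finset.univ z t ∂(iid (Fin n) (joint μ)) - n * crossProb μ q t|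
      ∂(lawY μ q) ≤ neighbourDist μ (score μ q) n + 1 := by
  have := isProbabilityMeasure_lawY (μ := μ) hq
  set P := iid (Fin n) (joint μ) with hP
  have hR : BddMeasurable fun v : ℝ × (Fin n → ℝ × I) => adjSum Finset.univ (fun i => (v.2 i).1)
        (fun i k => |step v.1 (q (v.2 k)) - step v.1 (q ((v.2 i).1, (v.2 k).2))|) :=
    BddMeasurable.adjSum (by fun_prop) fun i k =>
      ((bddMeasurable_step_comp (by fun_prop) (by fun_prop)).sub
      (bddMeasurable_step_comp (by fun_prop) (by fun_prop))).abs
  have hR' := BddMeasurable.integral_right (F := fun t z => adjSum Finset.univ (fun i => (z i).1)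
    (fun i k => |step t (q (z k)) - step t (q ((z i).1, (z k).2))|)) hR P
  have hS : BddMeasurable fun t : ℝ => ∫ z, crossCount q Finset.univ z t ∂P :=
    BddMeasurable.integral_left (F := fun z t => crossCount q Finset.univ z t)
      (bddMeasurable_crossCount hq (n := n) Finset.univ) P
  refine (integral_mono_bdd ((hS.sub ((bddMeasurable_crossProb hq).const_mul _)).abs)
    (hR'.add_const 1) (Eventually.of_forall fun t => abs_integral_crossCount_sub_le hq n t)).trans ?_
  rw [integral_add (hR'.integrable _) (integrable_const _)]
  simp only [integral_const, probReal_univ, smul_eq_mul, one_mul]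
  refine add_le_add_left (le_of_eq ?_) 1
  rw [integral_integral_swap (hR.integrable _)]
  have h1 : ∀ z : Fin n → ℝ × I, ∫ t, adjSum Finset.univ (fun i => (z i).1)
      (fun i k => |step t (q (z k)) - step t (q ((z i).1, (z k).2))|) ∂(lawY μ q) =
      adjSum Finset.univ (fun i => (z i).1)
        (fun i k => |score μ q ((z k).1, (z k).2) - score μ q ((z i).1, (z k).2)|) := fun z => by
    rw [integral_adjSum_fixed fun i k => (((bddMeasurable_step_comp (by fun_prop)
      (by fun_prop)).sub (bddMeasurable_step_comp (by fun_prop) (by fun_prop))).abs)]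
    simp_rw [integral_abs_step_sub]
    rfl
  simp_rw [h1]
  have hsc := bddMeasurable_score (μ := μ) hq
  rw [integral_adjSum μ (f := fun v => |score μ q (v.1.2, v.2.2) - score μ q (v.1.1, v.2.2)|)
    (((hsc.comp (φ := fun v : (ℝ × ℝ) × (I × I) => (v.1.2, v.2.2)) (by fun_prop)).sub
      (hsc.comp (φ := fun v : (ℝ × ℝ) × (I × I) => (v.1.1, v.2.2)) (by fun_prop))).abs)]
  unfold neighbourDist
  congr 1; ext x
  refine adjSum_congr fun i k _ => ?_
  simp only [sectionDist]
  have := integral_fun_snd (μ := (volume : Measure I)) (ν := (volume : Measure I))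
    (f := fun u => |score μ q (x k, u) - score μ q (x i, u)|)
  rw [Measure.volume_eq_prod, this]
  simp only [probReal_univ, one_smul]
  congr 1; ext u; rw [abs_sub_comm]

variable (μ q) in
/-- The mean squared deviation of the crossing numbers, integrated over the levels. -/
noncomputable def crossError (n : ℕ) : ℝ :=
  ∫ t, ∫ z, (crossCount q Finset.univ z t - n * crossProb μ q t) ^ 2
    ∂(iid (Fin n) (joint μ)) ∂(lawY μ q)

/-- Variance plus squared bias. The bias never exceeds $n$, so its square is at most $n$ times its
absolute value, and the $L^1$-bound over the levels suffices. -/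
theorem crossError_le (n : ℕ) :
    crossError μ q n ≤ 10 * n + n * neighbourDist μ (score μ q) n := by
  have := isProbabilityMeasure_lawY (μ := μ) hq
  set P := iid (Fin n) (joint μ) with hP
  have hS : BddMeasurable fun t : ℝ => ∫ z, crossCount q Finset.univ z t ∂P :=
    BddMeasurable.integral_left (F := fun z t => crossCount q Finset.univ z t)
      (bddMeasurable_crossCount hq (n := n) Finset.univ) P
  have hb : BddMeasurable fun t : ℝ => |∫ z, crossCount q Finset.univ z t ∂P -
    n * crossProb μ q t| := (hS.sub ((bddMeasurable_crossProb hq).const_mul _)).abs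
  have h1 : ∀ t, ∫ z, (crossCount q Finset.univ z t - n * crossProb μ q t) ^ 2 ∂P ≤
      n * |∫ z, crossCount q Finset.univ z t ∂P - n * crossProb μ q t| + 9 * n := fun t => by
    rw [integral_sq_sub_const P (bddMeasurable_crossCount' hq Finset.univ t)]
    have h2 := variance_crossCount_le (μ := μ) hq n t
    have h3 : 0 ≤ ∫ z, crossCount q Finset.univ z t ∂P :=
      integral_nonneg fun z => crossCount_nonneg _ _ _
    have h4 : ∫ z, crossCount q Finset.univ z t ∂P ≤ n := by
      refine integral_le_const (bddMeasurable_crossCount' hq Finset.univ t) ?_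
      filter_upwards [ae_injective_fst (ι := Fin n) (μ := μ)] with z hz
      exact crossCount_le hz t
    have h5 : 0 ≤ n * crossProb μ q t := mul_nonneg (Nat.cast_nonneg _) (crossProb_nonneg t)
    have h6 : n * crossProb μ q t ≤ n :=
      mul_le_of_le_one_right (Nat.cast_nonneg _) (crossProb_le_one hq t)
    have h7 : |∫ z, crossCount q Finset.univ z t ∂P - n * crossProb μ q t| ≤ n := by
      rw [abs_le]; constructor <;> linarith
    rw [← sq_abs (∫ z, crossCount q Finset.univ z t ∂P - n * crossProb μ q t)]
    nlinarith [abs_nonneg (∫ z, crossCount q Finset.univ z t ∂P - n * crossProb μ q t)]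
  have hL : BddMeasurable fun t => ∫ z, (crossCount q Finset.univ z t - n * crossProb μ q t) ^ 2 ∂P :=
    BddMeasurable.integral_left
      (F := fun z t => (crossCount q Finset.univ z t - n * crossProb μ q t) ^ 2)
      ((bddMeasurable_crossCount_sub hq Finset.univ).pow 2) P
  refine (integral_mono_bdd hL ((hb.const_mul n).add_const _) (Eventually.of_forall h1)).trans ?_
  rw [integral_add ((hb.const_mul n).integrable _) (integrable_const _), integral_const_mul]
  simp only [integral_const, probReal_univ, smul_eq_mul, one_mul]
  have := integral_abs_integral_crossCount_sub_le (μ := μ) hq n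
  have : (n : ℝ) * _ ≤ n * _ := mul_le_mul_of_nonneg_left this (Nat.cast_nonneg n)
  linarith

/-- A function of `z` and of `Y j`, which does not otherwise depend on the point `z j`. -/
theorem integral_sq_crossCount_sub_le {n : ℕ} (j : Fin n) :
    ∫ z, (crossCount q Finset.univ z (q (z j)) - n * crossProb μ q (q (z j))) ^ 2
      ∂(iid (Fin n) (joint μ)) ≤ 4 * crossError μ q n + 54 := by
  have := isProbabilityMeasure_lawY (μ := μ) hq
  set P := iid (Fin n) (joint μ) with hP
  have hB := fun s => bddMeasurable_crossCount_sub (μ := μ) hq (n := n) s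
  have hB1 : ∀ s, BddMeasurable fun z : Fin n → ℝ × I =>
      crossCount q s z (q (z j)) - n * crossProb μ q (q (z j)) := fun s =>
    (hB s).comp (φ := fun z : Fin n → ℝ × I => (z, q (z j))) (by fun_prop)
  have hB2 : ∀ s t, BddMeasurable fun z : Fin n → ℝ × I =>
      crossCount q s z t - n * crossProb μ q t := fun s t =>
    (hB s).comp (φ := fun z : Fin n → ℝ × I => (z, t)) (by fun_prop)
  -- Used twice: to pass to the sample without $j$, where $Y_j$ can be treated as an independent
  -- level, and to return to the full sample afterwards.
  have key : ∀ {a b : ℝ} (c : ℝ), |a - b| ≤ 3 → (a - c) ^ 2 ≤ 2 * (b - c) ^ 2 + 18 := by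
    intro a b c h
    nlinarith [abs_le.mp h, sq_nonneg (a - b - (b - c))]
  have h1 : ∫ z, (crossCount q Finset.univ z (q (z j)) - n * crossProb μ q (q (z j))) ^ 2 ∂P ≤
      2 * ∫ z, (crossCount q (Finset.univ.erase j) z (q (z j)) -
        n * crossProb μ q (q (z j))) ^ 2 ∂P + 18 := by
    refine (integral_mono_bdd ((hB1 _).pow 2) ((((hB1 (Finset.univ.erase j)).pow 2).const_mul
      2).add_const 18) ?_).trans (le_of_eq ?_)
    · filter_upwards [ae_injective_fst (ι := Fin n) (μ := μ)] with z hz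
      exact key _ (abs_crossCount_sub_erase_le hz j _)
    · rw [integral_add ((((hB1 (Finset.univ.erase j)).pow 2).const_mul 2).integrable _)
        (integrable_const _), integral_const_mul]
      simp
  have h2 : ∫ z, (crossCount q (Finset.univ.erase j) z (q (z j)) -
        n * crossProb μ q (q (z j))) ^ 2 ∂P =
      ∫ t, ∫ z, (crossCount q (Finset.univ.erase j) z t - n * crossProb μ q t) ^ 2 ∂P
        ∂(lawY μ q) :=
    integral_free_lawY hq (Φ := fun z t => (crossCount q (Finset.univ.erase j) z t -
        n * crossProb μ q t) ^ 2) ((hB _).pow 2) fun t z w => by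
      have := free_crossCount (q := q) j t z w
      simp only at this
      simp only [this]
  have h3 : ∫ t, ∫ z, (crossCount q (Finset.univ.erase j) z t - n * crossProb μ q t) ^ 2 ∂P
        ∂(lawY μ q) ≤ 2 * crossError μ q n + 18 := by
    have hL : ∀ s, BddMeasurable fun t =>
        ∫ z, (crossCount q s z t - n * crossProb μ q t) ^ 2 ∂P := fun s =>
      BddMeasurable.integral_left (F := fun z t => (crossCount q s z t - n * crossProb μ q t) ^ 2)
        ((hB s).pow 2) P
    have h4 : ∀ t, ∫ z, (crossCount q (Finset.univ.erase j) z t - n * crossProb μ q t) ^ 2 ∂P ≤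
        2 * ∫ z, (crossCount q Finset.univ z t - n * crossProb μ q t) ^ 2 ∂P + 18 := fun t => by
      refine (integral_mono_bdd ((hB2 _ t).pow 2) ((((hB2 Finset.univ t).pow 2).const_mul
        2).add_const 18) ?_).trans (le_of_eq ?_)
      · filter_upwards [ae_injective_fst (ι := Fin n) (μ := μ)] with z hz
        exact key _ (by rw [abs_sub_comm]; exact abs_crossCount_sub_erase_le hz j _)
      · rw [integral_add ((((hB2 Finset.univ t).pow 2).const_mul 2).integrable _)
          (integrable_const _), integral_const_mul]
        simp
    refine (integral_mono_bdd (hL _) (((hL Finset.univ).const_mul 2).add_const 18)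
      (Eventually.of_forall h4)).trans (le_of_eq ?_)
    rw [integral_add (((hL Finset.univ).const_mul 2).integrable _) (integrable_const _),
      integral_const_mul]
    simp [crossError, hP]
  rw [h2] at h1
  linarith

/-- The score variation is the crossing number averaged over levels drawn from the law of $Y$, so
the bound is Jensen's inequality. -/
theorem integral_sq_scoreVariation_sub_le (n : ℕ) :
    ∫ z, (scoreVariation μ q z - n * ∫ t, crossProb μ q t ∂(lawY μ q)) ^ 2
      ∂(iid (Fin n) (joint μ)) ≤ crossError μ q n := by
  have := isProbabilityMeasure_lawY (μ := μ) hq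
  set P := iid (Fin n) (joint μ) with hP
  have hB := bddMeasurable_crossCount_sub (μ := μ) hq (n := n) Finset.univ
  have hBt : ∀ z : Fin n → ℝ × I, BddMeasurable fun t =>
    crossCount q Finset.univ z t - n * crossProb μ q t := fun z =>
      hB.comp (φ := fun t => (z, t)) (by fun_prop)
  have h1 : ∀ z : Fin n → ℝ × I, scoreVariation μ q z - n * ∫ t, crossProb μ q t ∂(lawY μ q) =
      ∫ t, (crossCount q Finset.univ z t - n * crossProb μ q t) ∂(lawY μ q) := fun z => by
    have b1 : BddMeasurable fun t => crossCount q Finset.univ z t :=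
      (bddMeasurable_crossCount hq (n := n) Finset.univ).comp (φ := fun t => (z, t)) (by fun_prop)
    rw [integral_sub (b1.integrable _) (((bddMeasurable_crossProb hq).const_mul _).integrable _),
      integral_const_mul]
    congr 1
    unfold crossCount
    rw [integral_adjSum_fixed fun i k => (((bddMeasurable_step_comp (by fun_prop)
      (by fun_prop)).sub (bddMeasurable_step_comp (by fun_prop) (by fun_prop))).abs)]
    simp_rw [integral_abs_step_sub]
    rfl
  have h2 : ∀ z : Fin n → ℝ × I,
      (scoreVariation μ q z - n * ∫ t, crossProb μ q t ∂(lawY μ q)) ^ 2 ≤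
      ∫ t, (crossCount q Finset.univ z t - n * crossProb μ q t) ^ 2 ∂(lawY μ q) := fun z => by
    rw [h1 z]
    exact sq_integral_le _ (hBt z)
  refine (integral_mono_bdd (((bddMeasurable_scoreVariation hq n).sub_const _).pow 2)
    (BddMeasurable.integral_right
      (F := fun z t => (crossCount q Finset.univ z t - n * crossProb μ q t) ^ 2) (hB.pow 2) _)
    (Eventually.of_forall h2)).trans (le_of_eq ?_)
  rw [integral_integral_swap ((hB.pow 2).integrable _)]
  rfl

end Model

end RankBootstrap

/-! ### Efron–Stein estimate for the passage from ranks to scores. -/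

namespace RankBootstrap

open unitInterval

section Model

variable {μ : Measure ℝ} {q : ℝ × I → ℝ}

variable (q) in
/-- The rank of `Y i` among the `Y l`, `l ∈ s`. -/
noncomputable def rankAmong {n : ℕ} (s : Finset (Fin n)) (z : Fin n → ℝ × I) (i : Fin n) : ℝ :=
  ∑ l ∈ s, step (q (z l)) (q (z i))

variable (q) in
/-- The total variation of the ranks of neighbours. -/
noncomputable def neighbourVariation {n : ℕ} (z : Fin n → ℝ × I) : ℝ :=
  adjSum Finset.univ (fun i => (z i).1)
    (fun i k => |rankAmong q Finset.univ z k - rankAmong q Finset.univ z i|)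

variable (μ q) in
/-- The difference of the variations of ranks and of scores for a single pair. -/
noncomputable def pairRemainder {n : ℕ} (s : Finset (Fin n)) (z : Fin n → ℝ × I) (i k : Fin n) : ℝ :=
  |rankAmong q s z k - rankAmong q s z i| - s.card * |score μ q (z k) - score μ q (z i)|

variable (μ q) in
/-- The crossing probability at `q w`, centred. -/
noncomputable def centredCross (w : ℝ × I) : ℝ :=
  crossProb μ q (q w) - ∫ t, crossProb μ q t ∂(lawY μ q)

variable (μ q) in
/-- The remainder of the linearization of the rank variation. -/
noncomputable def rankRemainder {n : ℕ} (s : Finset (Fin n)) (z : Fin n → ℝ × I) : ℝ :=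
  adjSum s (fun i => (z i).1) (pairRemainder μ q s z) - s.card * ∑ k ∈ s, centredCross μ q (z k)

variable (μ q) in
/-- The deviation of the rank of `Y i` from its conditional mean. -/
noncomputable def rankDeviation {n : ℕ} (z : Fin n → ℝ × I) (i : Fin n) : ℝ :=
  rankAmong q Finset.univ z i - n * score μ q (z i)

theorem abs_rankAmong_sub {n : ℕ} (s : Finset (Fin n)) (z : Fin n → ℝ × I) (i k : Fin n) :
    |rankAmong q s z k - rankAmong q s z i| =
      ∑ l ∈ s, |step (q (z l)) (q (z k)) - step (q (z l)) (q (z i))| :=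
  sum_abs_step_sub s (fun l => q (z l)) _ _

/-- The rank difference of a pair is the number of points separating it, so it is additive in the
points, and removing $j$ removes one summand. -/
theorem pairRemainder_univ_eq {n : ℕ} (z : Fin n → ℝ × I) (j i k : Fin n) :
    pairRemainder μ q Finset.univ z i k = pairRemainder μ q (Finset.univ.erase j) z i k +
      (|step (q (z j)) (q (z k)) - step (q (z j)) (q (z i))| -
        |score μ q (z k) - score μ q (z i)|) := by
  unfold pairRemainder
  rw [abs_rankAmong_sub, abs_rankAmong_sub, ← Finset.add_sum_erase _ _ (Finset.mem_univ j),
    ← Finset.card_erase_add_one (Finset.mem_univ j)]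
  push_cast
  ring

/-- The bound separates the two points of the pair; each rank deviation has second moment of order
$n$. -/
theorem abs_pairRemainder_univ_le {n : ℕ} (z : Fin n → ℝ × I) (i k : Fin n) :
    |pairRemainder μ q Finset.univ z i k| ≤
      |rankDeviation μ q z i| + |rankDeviation μ q z k| := by
  have h : rankAmong q Finset.univ z k - rankAmong q Finset.univ z i =
      (rankDeviation μ q z k - rankDeviation μ q z i) +
        n * (score μ q (z k) - score μ q (z i)) := by
    unfold rankDeviation; ring
  unfold pairRemainder
  have hn : ∀ a : ℝ, (n : ℝ) * |a| = |n * a| := fun a => by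
    rw [abs_mul, abs_of_nonneg (Nat.cast_nonneg (α := ℝ) n)]
  rw [Finset.card_univ, Fintype.card_fin, hn]
  refine (abs_abs_sub_abs_le_abs_sub _ _).trans ?_
  rw [h, add_sub_cancel_right, add_comm]
  exact abs_sub _ _

variable [IsProbabilityMeasure μ] (hq : Measurable q)
include hq

theorem bddMeasurable_rankAmong {n : ℕ} (s : Finset (Fin n)) (i : Fin n) :
    BddMeasurable fun z : Fin n → ℝ × I => rankAmong q s z i :=
  BddMeasurable.finsetSum _ fun l _ => bddMeasurable_step_comp (by fun_prop) (by fun_prop)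

theorem bddMeasurable_score_eval {n : ℕ} (i : Fin n) :
    BddMeasurable fun z : Fin n → ℝ × I => score μ q (z i) :=
  (bddMeasurable_score hq).comp (measurable_pi_apply i)

theorem bddMeasurable_neighbourVariation (n : ℕ) :
    BddMeasurable fun z : Fin n → ℝ × I => neighbourVariation q z :=
  BddMeasurable.adjSum (by fun_prop) fun i k =>
    ((bddMeasurable_rankAmong hq _ k).sub (bddMeasurable_rankAmong hq _ i)).abs

theorem bddMeasurable_centredCross : BddMeasurable (centredCross μ q) :=
  ((bddMeasurable_crossProb hq).comp hq).sub_const _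

theorem abs_centredCross_le (w : ℝ × I) : |centredCross μ q w| ≤ 1 := by
  have := isProbabilityMeasure_lawY (μ := μ) hq
  exact abs_sub_le_one (crossProb_nonneg _) (crossProb_le_one hq _)
    (integral_nonneg fun _ => crossProb_nonneg _)
    (integral_le_const (bddMeasurable_crossProb hq) (Eventually.of_forall (crossProb_le_one hq)))

theorem integral_centredCross : ∫ w, centredCross μ q w ∂(joint μ) = 0 := by
  have := isProbabilityMeasure_lawY (μ := μ) hq
  unfold centredCross
  rw [integral_sub (((bddMeasurable_crossProb hq).comp hq).integrable _) (integrable_const _),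
    ← integral_lawY hq (bddMeasurable_crossProb hq).measurable]
  simp

theorem bddMeasurable_rankRemainder {n : ℕ} (s : Finset (Fin n)) :
    BddMeasurable fun z : Fin n → ℝ × I => rankRemainder μ q s z :=
  (BddMeasurable.adjSum (by fun_prop) fun i k =>
    ((bddMeasurable_rankAmong hq _ k).sub (bddMeasurable_rankAmong hq _ i)).abs.sub
      (((bddMeasurable_score_eval hq k).sub (bddMeasurable_score_eval hq i)).abs.const_mul _)).sub
    ((BddMeasurable.finsetSum _ fun k _ =>
      (bddMeasurable_centredCross hq).comp (measurable_pi_apply k)).const_mul _)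

theorem bddMeasurable_rankDeviation {n : ℕ} (i : Fin n) :
    BddMeasurable fun z : Fin n → ℝ × I => rankDeviation μ q z i :=
  (bddMeasurable_rankAmong hq _ i).sub ((bddMeasurable_score_eval hq i).const_mul _)

omit hq in
omit [IsProbabilityMeasure μ] in
theorem free_rankRemainder {n : ℕ} (j : Fin n) :
    Free j fun z : Fin n → ℝ × I => rankRemainder μ q (Finset.univ.erase j) z := by
  have h1 : Free j fun z : Fin n → ℝ × I => adjSum (Finset.univ.erase j) (fun i => (z i).1)
      (pairRemainder μ q (Finset.univ.erase j) z) := by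
    refine free_adjSum_erase fun z w i k hi hk => ?_
    have hr : ∀ m, m ≠ j → rankAmong q (Finset.univ.erase j) (Function.update z j w) m =
        rankAmong q (Finset.univ.erase j) z m := fun m hm =>
      Finset.sum_congr rfl fun l hl => by
        rw [Function.update_of_ne (Finset.ne_of_mem_erase hl), Function.update_of_ne hm]
    unfold pairRemainder
    rw [hr i hi, hr k hk, Function.update_of_ne hi, Function.update_of_ne hk]
  intro z w
  have h := h1 z w
  simp only at h
  simp only [rankRemainder, h]
  congr 2
  exact Finset.sum_congr rfl fun l hl => by
    rw [Function.update_of_ne (Finset.ne_of_mem_erase hl)]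

/-- With $Y_j$ frozen, the other points contribute a sum of centred bounded iid terms with second
moment at most $n$. The point $j$ itself adds $1-F(Y_j)\in[0,1]$. -/
theorem integral_sq_rankDeviation_le {n : ℕ} (j : Fin n) :
    ∫ z, rankDeviation μ q z j ^ 2 ∂(iid (Fin n) (joint μ)) ≤ 2 * n + 2 := by
  have := isProbabilityMeasure_lawY (μ := μ) hq
  set P := iid (Fin n) (joint μ) with hP
  let F : ℝ → ℝ := fun t => (lawY μ q).real (Set.Iic t)
  have hF : BddMeasurable F := by
    have hm : Monotone F := fun a b hab => measureReal_mono (Set.Iic_subset_Iic.mpr hab)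
    exact ⟨hm.measurable, 1, fun t => by
      rw [abs_of_nonneg measureReal_nonneg]; exact measureReal_le_one⟩
  let Φ : (Fin n → ℝ × I) → ℝ → ℝ := fun z t => ∑ l ∈ Finset.univ.erase j, (step (q (z l)) t - F t)
  have hΦ : BddMeasurable (Function.uncurry Φ) := BddMeasurable.finsetSum _ fun l _ =>
    (bddMeasurable_step_comp (by fun_prop) (by fun_prop)).sub (hF.comp measurable_snd)
  have hΦj : BddMeasurable fun z : Fin n → ℝ × I => Φ z (q (z j)) :=
    hΦ.comp (φ := fun z : Fin n → ℝ × I => (z, q (z j))) (by fun_prop)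
  have h1 : ∀ z, rankDeviation μ q z j ^ 2 ≤ 2 * Φ z (q (z j)) ^ 2 + 2 := fun z => by
    have e : rankDeviation μ q z j = Φ z (q (z j)) + (1 - F (q (z j))) := by
      have : (n : ℝ) * F (q (z j)) = ∑ l : Fin n, F (q (z j)) := by simp
      change rankAmong q Finset.univ z j - n * F (q (z j)) = _
      rw [this]
      unfold rankAmong
      rw [← Finset.sum_sub_distrib, ← Finset.add_sum_erase _ _ (Finset.mem_univ j), add_comm]
      simp [Φ, step]
    have hF0 : 0 ≤ F (q (z j)) := measureReal_nonneg
    have hF1 : F (q (z j)) ≤ 1 := measureReal_le_one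
    rw [e]
    nlinarith [sq_nonneg (Φ z (q (z j)) - (1 - F (q (z j))))]
  have h2 : ∫ z, Φ z (q (z j)) ^ 2 ∂P = ∫ t, ∫ z, Φ z t ^ 2 ∂P ∂(lawY μ q) :=
    integral_free_lawY hq (Φ := fun z t => Φ z t ^ 2) (hΦ.pow 2) fun t z w => by
      simp only [Φ]
      congr 1
      exact Finset.sum_congr rfl fun l hl => by
        rw [Function.update_of_ne (Finset.ne_of_mem_erase hl)]
  have h3 : ∀ t, ∫ z, Φ z t ^ 2 ∂P ≤ n := fun t => by
    have hf : BddMeasurable fun w : ℝ × I => step (q w) t :=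
      bddMeasurable_step_comp (by fun_prop) (by fun_prop)
    have := integral_sq_sum_le (ι := Fin n) (ρ := joint μ) (f := fun w => step (q w) t - F t)
      (hf.sub_const _).measurable
      (fun w => abs_sub_le_one (step_nonneg _ _) (step_le_one _ _) measureReal_nonneg
        measureReal_le_one) (by
        rw [integral_sub (hf.integrable _) (integrable_const _),
          ← integral_lawY hq (f := fun s => step s t) (bddMeasurable_step_left t).measurable,
          integral_step]
        simp [F]) (Finset.univ.erase j)
    rw [Fintype.card_fin] at this
    exact this
  calc _ ≤ ∫ z, (2 * Φ z (q (z j)) ^ 2 + 2) ∂P :=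
        integral_mono_bdd ((bddMeasurable_rankDeviation hq j).pow 2)
          (((hΦj.pow 2).const_mul 2).add_const 2) (Eventually.of_forall h1)
    _ = 2 * ∫ t, ∫ z, Φ z t ^ 2 ∂P ∂(lawY μ q) + 2 := by
        rw [integral_add (((hΦj.pow 2).const_mul 2).integrable _) (integrable_const _),
          integral_const_mul, h2]
        simp
    _ ≤ 2 * n + 2 := by
        have := integral_le_const (P := lawY μ q) (BddMeasurable.integral_left
          (F := fun z t => Φ z t ^ 2) (hΦ.pow 2) P) (Eventually.of_forall h3)
        linarith

/-- The score variation and the `centredCross` terms are subtracted precisely so that removing $j$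
leaves only fluctuations: the centred crossing number at $Y_j$, the centred score variation, the
change of the neighbour relation, and the sum of the `centredCross` terms, besides one bounded term.
The factor $5$ comes from squaring a sum of five terms. -/
theorem sum_sq_rankRemainder_sub_le {n : ℕ} {z : Fin n → ℝ × I}
    (hz : Function.Injective fun i => (z i).1) :
    ∑ j, (rankRemainder μ q Finset.univ z - rankRemainder μ q (Finset.univ.erase j) z) ^ 2 ≤
      5 * ((∑ j, (crossCount q Finset.univ z (q (z j)) - n * crossProb μ q (q (z j))) ^ 2) +
        n * (scoreVariation μ q z - n * ∫ t, crossProb μ q t ∂(lawY μ q)) ^ 2 +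
        36 * (∑ i, (2 * rankDeviation μ q z i ^ 2 + 2)) +
        n * (∑ k, centredCross μ q (z k)) ^ 2 + n) := by
  classical
  set cbar := ∫ t, crossProb μ q t ∂(lawY μ q) with hcbar
  let x : Fin n → ℝ := fun i => (z i).1
  let f : Fin n → ℝ := fun i => |rankDeviation μ q z i| + 1
  let N : Fin n → ℝ := fun j => (∑ i, if Adj Finset.univ x i j then f i else 0) + f j +
    ∑ k, if Adj Finset.univ x j k then f k else 0
  let Δ : Fin n → ℝ := fun j => adjSum Finset.univ x (pairRemainder μ q (Finset.univ.erase j) z) -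
    adjSum (Finset.univ.erase j) x (pairRemainder μ q (Finset.univ.erase j) z)
  have hθ : ∀ j i k, |(|step (q (z j)) (q (z k)) - step (q (z j)) (q (z i))| -
        |score μ q (z k) - score μ q (z i)|)| ≤ 1 := fun j i k =>
    abs_sub_le_one (abs_nonneg _) (abs_step_sub_le_one _ _ _) (abs_nonneg _)
      (abs_sub_le_one (score_nonneg _) (score_le_one hq _) (score_nonneg _) (score_le_one hq _))
  -- Pair remainders without $j$ differ from the full ones by at most $1$, so they are dominated by
  -- $f_i+f_k$ with $f=|{\rm deviation}|+1$.
  have hΔ : ∀ j, |Δ j| ≤ 2 * N j := fun j => by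
    refine abs_adjSum_sub_adjSum_erase_le hz (Finset.mem_univ j)
      (fun i => by positivity) fun i k => ?_
    have h1 := pairRemainder_univ_eq (μ := μ) (q := q) z j i k
    have h2 := abs_pairRemainder_univ_le (μ := μ) (q := q) z i k
    have h3 := hθ j i k
    rw [h1] at h2
    simp only [f]
    have h4 := abs_sub (pairRemainder μ q (Finset.univ.erase j) z i k +
      (|step (q (z j)) (q (z k)) - step (q (z j)) (q (z i))| -
        |score μ q (z k) - score μ q (z i)|)) (|step (q (z j)) (q (z k)) - step (q (z j)) (q (z i))| -
        |score μ q (z k) - score μ q (z i)|)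
    rw [add_sub_cancel_right] at h4
    linarith
  have hdec : ∀ j, rankRemainder μ q Finset.univ z - rankRemainder μ q (Finset.univ.erase j) z =
      (crossCount q Finset.univ z (q (z j)) - n * crossProb μ q (q (z j))) -
      (scoreVariation μ q z - n * cbar) + Δ j - (∑ k, centredCross μ q (z k)) +
      centredCross μ q (z j) := fun j => by
    have h1 : adjSum Finset.univ x (pairRemainder μ q Finset.univ z) =
        adjSum Finset.univ x (pairRemainder μ q (Finset.univ.erase j) z) +
          (crossCount q Finset.univ z (q (z j)) - scoreVariation μ q z) := by
      unfold crossCount scoreVariation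
      rw [← adjSum_sub, ← adjSum_add]
      exact adjSum_congr fun i k _ => pairRemainder_univ_eq z j i k
    have h2 : ((Finset.univ : Finset (Fin n)).card : ℝ) = (Finset.univ.erase j).card + 1 := by
      rw [← Finset.card_erase_add_one (Finset.mem_univ j)]; push_cast; ring
    have h3 : (n : ℝ) = (Finset.univ.erase j).card + 1 := by
      rw [← h2]; simp
    have h4 := Finset.add_sum_erase Finset.univ (fun k => centredCross μ q (z k)) (Finset.mem_univ j)
    have h5 : centredCross μ q (z j) = crossProb μ q (q (z j)) - cbar := rfl
    unfold rankRemainder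
    change adjSum Finset.univ x (pairRemainder μ q Finset.univ z) - _ -
      (adjSum (Finset.univ.erase j) x (pairRemainder μ q (Finset.univ.erase j) z) - _) = _
    rw [h1, h2, ← h4, h3, h5]
    simp only [Δ]
    ring
  have h5sq : ∀ a b c d e : ℝ, (a - b + c - d + e) ^ 2 ≤
      5 * (a ^ 2 + b ^ 2 + c ^ 2 + d ^ 2 + e ^ 2) := fun a b c d e => by
    nlinarith [sq_nonneg (a + b), sq_nonneg (a - c), sq_nonneg (a + d), sq_nonneg (a - e),
      sq_nonneg (b + c), sq_nonneg (b - d), sq_nonneg (b + e), sq_nonneg (c + d),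
      sq_nonneg (c - e), sq_nonneg (d + e)]
  have hΔ2 : ∑ j, Δ j ^ 2 ≤ 36 * ∑ i, (2 * rankDeviation μ q z i ^ 2 + 2) := by
    have h1 : ∀ j, Δ j ^ 2 ≤ 4 * N j ^ 2 := fun j => by
      have := sq_le_sq' (by linarith [abs_nonneg (Δ j), hΔ j]) (hΔ j)
      rw [sq_abs] at this
      linarith
    have h2 := sum_sq_neighbours_le (s := Finset.univ) hz f
    have h3 : ∑ i, f i ^ 2 ≤ ∑ i, (2 * rankDeviation μ q z i ^ 2 + 2) :=
      Finset.sum_le_sum fun i _ => by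
        simp only [f]
        rw [← sq_abs (rankDeviation μ q z i)]
        nlinarith [sq_nonneg (|rankDeviation μ q z i| - 1)]
    calc ∑ j, Δ j ^ 2 ≤ ∑ j, 4 * N j ^ 2 := Finset.sum_le_sum fun j _ => h1 j
      _ = 4 * ∑ j, N j ^ 2 := by rw [Finset.mul_sum]
      _ ≤ 4 * (9 * ∑ i, f i ^ 2) := by gcongr
      _ ≤ _ := by linarith
  have hlast : ∑ j, centredCross μ q (z j) ^ 2 ≤ n := by
    have : ∀ j ∈ (Finset.univ : Finset (Fin n)), centredCross μ q (z j) ^ 2 ≤ 1 := fun j _ =>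
      (sq_le_one_iff_abs_le_one _).mpr (abs_centredCross_le hq _)
    simpa using Finset.sum_le_card_nsmul _ _ 1 this
  calc _ ≤ ∑ j, 5 * ((crossCount q Finset.univ z (q (z j)) - n * crossProb μ q (q (z j))) ^ 2 +
        (scoreVariation μ q z - n * cbar) ^ 2 + Δ j ^ 2 + (∑ k, centredCross μ q (z k)) ^ 2 +
        centredCross μ q (z j) ^ 2) := Finset.sum_le_sum fun j _ => by
          rw [hdec j]; exact h5sq _ _ _ _ _
    _ ≤ _ := by
      rw [← Finset.mul_sum]
      simp only [Finset.sum_add_distrib, Finset.sum_const, Finset.card_univ, Fintype.card_fin,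
        nsmul_eq_mul]
      simp only [Finset.sum_add_distrib, Finset.sum_const, Finset.card_univ, Fintype.card_fin,
        nsmul_eq_mul] at hΔ2
      linarith

/-- Each leave-one-out difference has second moment of order $n(1+\mathrm{neighbourDist})$ on
average over $j$. Division by $n^2$ therefore leaves $O(1+\mathrm{neighbourDist})=o(n)$, which is
negligible against a variance of order $n$. -/
theorem variance_rankRemainder_le [NullSingletonClass μ] (n : ℕ) :
    ∫ z, (rankRemainder μ q Finset.univ z - ∫ w, rankRemainder μ q Finset.univ w
      ∂(iid (Fin n) (joint μ))) ^ 2 ∂(iid (Fin n) (joint μ)) ≤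
      n ^ 2 * (2400 + 25 * neighbourDist μ (score μ q) n) := by
  set P := iid (Fin n) (joint μ) with hP
  have hb := fun s => bddMeasurable_rankRemainder (μ := μ) hq (n := n) s
  refine (efronStein (μ := joint μ) (hb Finset.univ)
    (fun j z => rankRemainder μ q (Finset.univ.erase j) z) (fun j => hb _)
    (fun j => free_rankRemainder j)).trans ?_
  rw [← integral_finsetSum _ fun j _ => (((hb _).sub (hb _)).pow 2).integrable _]
  set cbar := ∫ t, crossProb μ q t ∂(lawY μ q) with hcbar
  have b1 : ∀ j, BddMeasurable fun z : Fin n → ℝ × I =>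
      (crossCount q Finset.univ z (q (z j)) - n * crossProb μ q (q (z j))) ^ 2 := fun j =>
    ((bddMeasurable_crossCount_sub (μ := μ) hq Finset.univ).comp
      (φ := fun z : Fin n → ℝ × I => (z, q (z j))) (by fun_prop)).pow 2
  have b1' := BddMeasurable.finsetSum Finset.univ fun j _ => b1 j
  have b2 : BddMeasurable fun z : Fin n → ℝ × I =>
      n * (scoreVariation μ q z - n * cbar) ^ 2 :=
    (((bddMeasurable_scoreVariation hq n).sub_const _).pow 2).const_mul _
  have b3 : ∀ i, BddMeasurable fun z : Fin n → ℝ × I => rankDeviation μ q z i ^ 2 := fun i =>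
    (bddMeasurable_rankDeviation hq i).pow 2
  have b3'' : ∀ i, BddMeasurable fun z : Fin n → ℝ × I => 2 * rankDeviation μ q z i ^ 2 + 2 :=
    fun i => ((b3 i).const_mul 2).add_const 2
  have b3' : BddMeasurable fun z : Fin n → ℝ × I => 36 * ∑ i, (2 * rankDeviation μ q z i ^ 2 + 2) :=
    (BddMeasurable.finsetSum _ fun i _ => b3'' i).const_mul _
  have b4 : BddMeasurable fun z : Fin n → ℝ × I => n * (∑ k, centredCross μ q (z k)) ^ 2 :=
    ((BddMeasurable.finsetSum _ fun k _ =>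
      (bddMeasurable_centredCross hq).comp (measurable_pi_apply k)).pow 2).const_mul _
  have hmono : ∫ z, ∑ j, (rankRemainder μ q Finset.univ z -
      rankRemainder μ q (Finset.univ.erase j) z) ^ 2 ∂P ≤ _ :=
    integral_mono_bdd (BddMeasurable.finsetSum _ fun j _ => ((hb _).sub (hb _)).pow 2)
      (((((b1'.add b2).add b3').add b4).add_const (n : ℝ)).const_mul 5)
      (by filter_upwards [ae_injective_fst (ι := Fin n) (μ := μ)] with z hz
          exact sum_sq_rankRemainder_sub_le hq hz)
  refine hmono.trans ?_
  rw [integral_const_mul, integral_add ((((b1'.add b2).add b3').add b4).integrable _)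
      (integrable_const _), integral_add (((b1'.add b2).add b3').integrable _) (b4.integrable _),
    integral_add ((b1'.add b2).integrable _) (b3'.integrable _),
    integral_add (b1'.integrable _) (b2.integrable _), integral_const_mul, integral_const_mul,
    integral_const_mul, integral_finsetSum _ fun j _ => (b1 j).integrable _,
    integral_finsetSum _ fun j _ => (b3'' j).integrable _]
  have c1 : ∑ j : Fin n, ∫ z, (crossCount q Finset.univ z (q (z j)) -
      n * crossProb μ q (q (z j))) ^ 2 ∂P ≤ n * (4 * crossError μ q n + 54) := by
    refine (Finset.sum_le_card_nsmul Finset.univ _ _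
      fun (j : Fin n) _ => integral_sq_crossCount_sub_le (μ := μ) hq j).trans (le_of_eq ?_)
    rw [Finset.card_univ, Fintype.card_fin, nsmul_eq_mul]
  have c2 := integral_sq_scoreVariation_sub_le (μ := μ) hq n
  have c3 : ∑ i : Fin n, ∫ z, (2 * rankDeviation μ q z i ^ 2 + 2) ∂P ≤ n * (4 * (n : ℝ) + 6) := by
    have : ∀ i ∈ (Finset.univ : Finset (Fin n)),
        ∫ z, (2 * rankDeviation μ q z i ^ 2 + 2) ∂P ≤ 4 * (n : ℝ) + 6 := fun i _ => by
      rw [integral_add (((b3 i).const_mul 2).integrable _) (integrable_const _),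
        integral_const_mul]
      have := integral_sq_rankDeviation_le (μ := μ) hq i
      simp only [integral_const, probReal_univ, smul_eq_mul, one_mul]
      linarith
    refine (Finset.sum_le_card_nsmul _ _ _ this).trans (le_of_eq ?_)
    rw [Finset.card_univ, Fintype.card_fin, nsmul_eq_mul]
  have c4 : ∫ z, (∑ k, centredCross μ q (z k)) ^ 2 ∂P ≤ n := by
    simpa using integral_sq_sum_le (ι := Fin n) (ρ := joint μ)
      (bddMeasurable_centredCross hq).measurable (abs_centredCross_le hq)
      (integral_centredCross hq) Finset.univ
  have c5 := crossError_le (μ := μ) hq n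
  have hn : (n : ℝ) ≤ (n : ℝ) ^ 2 := by exact_mod_cast Nat.le_self_pow two_ne_zero n
  have hn0 : (0 : ℝ) ≤ n := Nat.cast_nonneg n
  simp only [integral_const, probReal_univ, smul_eq_mul, one_mul]
  have c2' := mul_le_mul_of_nonneg_left c2 hn0
  have c4' := mul_le_mul_of_nonneg_left c4 hn0
  have c5' := mul_le_mul_of_nonneg_left c5 hn0
  nlinarith

end Model

end RankBootstrap

/-! ### Replacing neighbouring sections, Hoeffding decomposition on a section, and the total
linearization error. -/

namespace RankBootstrap

open unitInterval

section Scatter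

variable (p : ℝ × I → ℝ)

/-- The mean distance of `p w` to an independent value on the same section. -/
noncomputable def scatter (w : ℝ × I) : ℝ := ∫ v, |p w - p (w.1, v)|

/-- The mean distance of two independent values on the section at `x`. -/
noncomputable def meanScatter (x : ℝ) : ℝ := ∫ u, scatter p (x, u)

/-- The distance of two values on the section at `x`, with its projections removed. -/
noncomputable def pairInteraction (x : ℝ) (u u' : I) : ℝ :=
  |p (x, u') - p (x, u)| - scatter p (x, u) - scatter p (x, u') + meanScatter p x

/-- The error made when `x i` replaces `x k` for a pair of neighbours. -/
noncomputable def sectionError {n : ℕ} (z : Fin n → ℝ × I) (i k : Fin n) : ℝ :=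
  |p (z k) - p (z i)| - |p ((z i).1, (z k).2) - p (z i)| +
    (scatter p ((z i).1, (z k).2) - scatter p (z k))

variable {p} (hp : BddMeasurable p)
include hp

theorem bddMeasurable_scatter : BddMeasurable (scatter p) :=
  BddMeasurable.integral_right (F := fun (w : ℝ × I) (v : I) => |p w - p (w.1, v)|)
    ((hp.comp (φ := fun v : (ℝ × I) × I => v.1) (by fun_prop)).sub
      (hp.comp (φ := fun v : (ℝ × I) × I => (v.1.1, v.2)) (by fun_prop))).abs _

theorem bddMeasurable_meanScatter : BddMeasurable (meanScatter p) :=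
  BddMeasurable.integral_right (F := fun (x : ℝ) (u : I) => scatter p (x, u))
    (bddMeasurable_scatter hp) _

theorem bddMeasurable_section (x : ℝ) : BddMeasurable fun u : I => p (x, u) :=
  hp.comp (φ := fun u : I => (x, u)) (by fun_prop)

theorem bddMeasurable_pairInteraction :
    BddMeasurable fun v : ℝ × I × I => pairInteraction p v.1 v.2.1 v.2.2 :=
  (((((hp.comp (φ := fun v : ℝ × I × I => (v.1, v.2.2)) (by fun_prop)).sub
    (hp.comp (φ := fun v : ℝ × I × I => (v.1, v.2.1)) (by fun_prop))).abs).sub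
    ((bddMeasurable_scatter hp).comp (φ := fun v : ℝ × I × I => (v.1, v.2.1)) (by fun_prop))).sub
    ((bddMeasurable_scatter hp).comp (φ := fun v : ℝ × I × I => (v.1, v.2.2)) (by fun_prop))).add
    ((bddMeasurable_meanScatter hp).comp measurable_fst)

/-- Degeneracy of the Hoeffding component: this makes the interactions of different neighbour pairs
orthogonal given the $x$-coordinates. -/
theorem integral_pairInteraction_left (x : ℝ) (u' : I) : ∫ u, pairInteraction p x u u' = 0 := by
  have b1 := ((bddMeasurable_section hp x).sub_const (p (x, u'))).abs.integrable (volume : Measure I)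
  have b2 := (bddMeasurable_section (bddMeasurable_scatter hp) x).integrable (volume : Measure I)
  have e : ∀ u, pairInteraction p x u u' = |p (x, u) - p (x, u')| - scatter p (x, u) -
      (scatter p (x, u') - meanScatter p x) := fun u => by
    rw [pairInteraction, abs_sub_comm]; ring
  simp_rw [e]
  have b3 : Integrable (fun u : I => |p (x, u) - p (x, u')| - scatter p (x, u)) := b1.sub b2
  rw [integral_sub b3 (integrable_const _), integral_sub b1 b2]
  have h : ∫ u, |p (x, u) - p (x, u')| = scatter p (x, u') := by
    unfold scatter
    congr 1; ext u; rw [abs_sub_comm]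
  rw [h]
  simp [meanScatter]

theorem pairInteraction_comm (x : ℝ) (u u' : I) :
    pairInteraction p x u u' = pairInteraction p x u' u := by
  unfold pairInteraction; rw [abs_sub_comm]; ring

theorem integral_pairInteraction_right (x : ℝ) (u : I) : ∫ u', pairInteraction p x u u' = 0 := by
  simp_rw [fun u' => pairInteraction_comm hp x u u']
  exact integral_pairInteraction_left hp x u

theorem abs_scatter_sub_le (x x' : ℝ) (u : I) :
    |scatter p (x, u) - scatter p (x', u)| ≤ |p (x, u) - p (x', u)| + sectionDist p x x' := by
  have b := fun x : ℝ => (bddMeasurable_section hp x)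
  have b1 := fun x => (((BddMeasurable.const (p (x, u))).sub (b x)).abs)
  unfold scatter sectionDist
  simp only
  rw [← integral_sub ((b1 x).integrable _) ((b1 x').integrable _)]
  have h : |p (x, u) - p (x', u)| = ∫ _v : I, |p (x, u) - p (x', u)| := by simp
  rw [h, ← integral_add (integrable_const _) ((((b x).sub (b x')).abs).integrable _)]
  refine abs_integral_le_integral_abs.trans (integral_mono
    ((((b1 x).sub (b1 x')).abs).integrable _)
    ((integrable_const _).add ((((b x).sub (b x')).abs).integrable _)) fun v => ?_)
  refine (abs_abs_sub_abs_le_abs_sub _ _).trans ?_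
  have e : p (x, u) - p (x, v) - (p (x', u) - p (x', v)) =
    (p (x, u) - p (x', u)) - (p (x, v) - p (x', v)) := by ring
  rw [e]
  exact abs_sub _ _

/-- The correction by `scatter` in `sectionError` moves the projection on $u_k$ back to the section
of the point $k$, so that it can be summed over points. Like the main replacement, it is controlled
by the difference of the two sections. -/
theorem abs_sectionError_le {n : ℕ} (z : Fin n → ℝ × I) (i k : Fin n) :
    |sectionError p z i k| ≤ 2 * |p ((z i).1, (z k).2) - p ((z k).1, (z k).2)| +
      sectionDist p (z i).1 (z k).1 := by
  have h1 : |(|p (z k) - p (z i)| - |p ((z i).1, (z k).2) - p (z i)|)| ≤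
      |p ((z i).1, (z k).2) - p ((z k).1, (z k).2)| := by
    refine (abs_abs_sub_abs_le_abs_sub _ _).trans ?_
    rw [sub_sub_sub_cancel_right, abs_sub_comm]
  have h2 := abs_scatter_sub_le hp (z i).1 (z k).1 (z k).2
  have h3 := abs_add_le (|p (z k) - p (z i)| - |p ((z i).1, (z k).2) - p (z i)|)
    (scatter p ((z i).1, (z k).2) - scatter p (z k))
  unfold sectionError
  simp only [Prod.mk.eta] at h1 h2 ⊢
  linarith

theorem bddMeasurable_sectionError {n : ℕ} (i k : Fin n) :
    BddMeasurable fun z : Fin n → ℝ × I => sectionError p z i k :=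
  ((((hp.comp (φ := fun z : Fin n → ℝ × I => z k) (by fun_prop)).sub
    (hp.comp (φ := fun z : Fin n → ℝ × I => z i) (by fun_prop))).abs).sub
    (((hp.comp (φ := fun z : Fin n → ℝ × I => ((z i).1, (z k).2)) (by fun_prop)).sub
    (hp.comp (φ := fun z : Fin n → ℝ × I => z i) (by fun_prop))).abs)).add
    (((bddMeasurable_scatter hp).comp (φ := fun z : Fin n → ℝ × I => ((z i).1, (z k).2))
      (by fun_prop)).sub
    ((bddMeasurable_scatter hp).comp (φ := fun z : Fin n → ℝ × I => z k) (by fun_prop)))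

omit hp in
theorem free_adjSum_sectionError {n : ℕ} (j : Fin n) :
    Free j fun z : Fin n → ℝ × I => adjSum (Finset.univ.erase j) (fun i => (z i).1)
      (sectionError p z) :=
  free_adjSum_erase fun z w i k hi hk => by
    unfold sectionError
    rw [Function.update_of_ne hi, Function.update_of_ne hk]

variable {μ : Measure ℝ} [IsProbabilityMeasure μ]

omit hp in
theorem integral_adjSum₂ {n : ℕ} {f : (ℝ × ℝ) × (I × I) → ℝ} (hf : BddMeasurable f) :
    ∫ z, adjSum₂ Finset.univ (fun i => (z i).1)
      (fun i _ k => f (((z i).1, (z k).1), ((z i).2, (z k).2))) ∂(iid (Fin n) (joint μ)) =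
    ∫ x, adjSum₂ Finset.univ x (fun i _ k => ∫ w, f ((x i, x k), w)) ∂(iid (Fin n) μ) := by
  classical
  have hb : BddMeasurable fun v : (Fin n → ℝ) × (Fin n → I) => adjSum₂ Finset.univ v.1
      (fun i _ k => f ((v.1 i, v.1 k), (v.2 i, v.2 k))) := by
    refine .finsetSum _ fun j _ => .finsetSum _ fun i _ => .finsetSum _ fun k _ => ?_
    have hm : ∀ i : Fin n, Measurable fun v : (Fin n → ℝ) × (Fin n → I) => v.1 i := fun i => by
      fun_prop
    exact .ite ((measurableSet_adj hm i j).inter (measurableSet_adj hm j k))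
      (hf.comp (φ := fun v : (Fin n → ℝ) × (Fin n → I) => ((v.1 i, v.1 k), (v.2 i, v.2 k)))
        (by fun_prop)) (.const 0)
  refine (integral_iid_joint μ (Φ := fun x u => adjSum₂ Finset.univ x
    (fun i _ k => f ((x i, x k), (u i, u k)))) (hb.integrable _)).trans ?_
  congr 1; ext x
  have hB : ∀ j i k, BddMeasurable fun u : Fin n → I =>
      if Adj Finset.univ x i j ∧ Adj Finset.univ x j k then f ((x i, x k), (u i, u k)) else 0 :=
    fun j i k => by
      split_ifs
      · exact hf.comp (φ := fun u : Fin n → I => ((x i, x k), (u i, u k))) (by fun_prop)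
      · exact .const 0
  simp only [adjSum₂]
  rw [integral_finsetSum _ fun j _ => (BddMeasurable.finsetSum _ fun i _ =>
    .finsetSum _ fun k _ => hB j i k).integrable _]
  refine Finset.sum_congr rfl fun j _ => ?_
  rw [integral_finsetSum _ fun i _ => (BddMeasurable.finsetSum _ fun k _ =>
    hB j i k).integrable _]
  refine Finset.sum_congr rfl fun i _ => ?_
  rw [integral_finsetSum _ fun k _ => (hB j i k).integrable _]
  refine Finset.sum_congr rfl fun k _ => ?_
  split_ifs with h
  · exact integral_pair (f := fun w => f ((x i, x k), w))
      (hf.comp (φ := fun w : I × I => ((x i, x k), w)) (by fun_prop))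
      (fun e => by have := h.1.2.2.1.trans h.2.2.2.1; rw [e] at this; exact lt_irrefl _ this)
  · simp

variable [NullSingletonClass μ]

/-- Leave-one-out changes are bounded, so their squares are controlled by their absolute values,
which add up to distances of neighbouring and second neighbouring sections. The triangle inequality
reduces the latter to the former, and $108=9\cdot(2\cdot3+6)$. -/
theorem variance_adjSum_sectionError_le (hp0 : ∀ w, 0 ≤ p w) (hp1 : ∀ w, p w ≤ 1) (n : ℕ) :
    ∫ z, (adjSum Finset.univ (fun i => (z i).1) (sectionError p z) -
      ∫ w, adjSum Finset.univ (fun i => (w i).1) (sectionError p w)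
        ∂(iid (Fin n) (joint μ))) ^ 2 ∂(iid (Fin n) (joint μ)) ≤ 108 * neighbourDist μ p n := by
  set P := iid (Fin n) (joint μ) with hP
  let f : (ℝ × ℝ) × (I × I) → ℝ := fun v =>
    2 * |p (v.1.1, v.2.2) - p (v.1.2, v.2.2)| + sectionDist p v.1.1 v.1.2
  have hf : BddMeasurable f := ((((hp.comp (φ := fun v : (ℝ × ℝ) × (I × I) => (v.1.1, v.2.2))
    (by fun_prop)).sub (hp.comp (φ := fun v : (ℝ × ℝ) × (I × I) => (v.1.2, v.2.2))
    (by fun_prop))).abs).const_mul 2).add (hp.sectionDist.comp measurable_fst)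
  have hd1 : ∀ x x', sectionDist p x x' ≤ 1 := fun x x' =>
    integral_le_const (((bddMeasurable_section hp x).sub (bddMeasurable_section hp x')).abs)
      (Eventually.of_forall fun u => abs_sub_le_one (hp0 _) (hp1 _) (hp0 _) (hp1 _))
  have hfint : ∀ x x', ∫ w, f ((x, x'), w) = 3 * sectionDist p x x' := fun x x' => by
    have b : BddMeasurable fun w : I × I => 2 * |p (x, w.2) - p (x', w.2)| :=
      ((((bddMeasurable_section hp x).sub (bddMeasurable_section hp x')).abs).comp
        measurable_snd).const_mul 2
    have h2 := integral_fun_snd (μ := (volume : Measure I)) (ν := (volume : Measure I))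
      (f := fun u => |p (x, u) - p (x', u)|)
    simp only [probReal_univ, one_smul] at h2
    simp only [f]
    rw [integral_add (b.integrable _) (integrable_const _), integral_const_mul,
      Measure.volume_eq_prod, h2]
    simp [sectionDist]
    ring
  let Δ : Fin n → (Fin n → ℝ × I) → ℝ := fun j z =>
    adjSum Finset.univ (fun i => (z i).1) (sectionError p z) -
      adjSum (Finset.univ.erase j) (fun i => (z i).1) (sectionError p z)
  have hs : ∀ s : Finset (Fin n), BddMeasurable fun z : Fin n → ℝ × I =>
      adjSum s (fun i => (z i).1) (sectionError p z) := fun s =>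
    .adjSum (by fun_prop) fun i k => bddMeasurable_sectionError hp i k
  have hfz : ∀ i k : Fin n, BddMeasurable fun z : Fin n → ℝ × I =>
      f (((z i).1, (z k).1), ((z i).2, (z k).2)) := fun i k =>
    hf.comp (φ := fun z : Fin n → ℝ × I => (((z i).1, (z k).1), ((z i).2, (z k).2))) (by fun_prop)
  have hA : BddMeasurable fun z : Fin n → ℝ × I => adjSum Finset.univ (fun i => (z i).1)
      (fun i k => f (((z i).1, (z k).1), ((z i).2, (z k).2))) :=
    .adjSum (by fun_prop) hfz
  have hA2 : BddMeasurable fun z : Fin n → ℝ × I => adjSum₂ Finset.univ (fun i => (z i).1)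
      (fun i _ k => f (((z i).1, (z k).1), ((z i).2, (z k).2))) := by
    classical
    refine .finsetSum _ fun j _ => .finsetSum _ fun i _ => .finsetSum _ fun k _ => ?_
    have hm : ∀ i : Fin n, Measurable fun z : Fin n → ℝ × I => (z i).1 := fun i => by fun_prop
    exact .ite ((measurableSet_adj hm i j).inter (measurableSet_adj hm j k)) (hfz i k) (.const 0)
  refine (efronStein (μ := joint μ) (hs Finset.univ) (fun j z =>
    adjSum (Finset.univ.erase j) (fun i => (z i).1) (sectionError p z)) (fun j => hs _)
    free_adjSum_sectionError).trans ?_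
  rw [← integral_finsetSum _ fun j _ => (((hs _).sub (hs _)).pow 2).integrable _]
  have hM := fun z i k => abs_sectionError_le hp (n := n) z i k
  have hM3 : ∀ z i k, |sectionError p (n := n) z i k| ≤ 3 := fun z i k => by
    have := hM z i k
    have := hd1 (z i).1 (z k).1
    have := abs_sub_le_one (hp0 ((z i).1, (z k).2)) (hp1 _) (hp0 ((z k).1, (z k).2)) (hp1 _)
    linarith
  calc _ ≤ ∫ z, 9 * (2 * adjSum Finset.univ (fun i => (z i).1)
        (fun i k => f (((z i).1, (z k).1), ((z i).2, (z k).2))) +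
        adjSum₂ Finset.univ (fun i => (z i).1)
      (fun i _ k => f (((z i).1, (z k).1), ((z i).2, (z k).2)))) ∂P := by
        refine integral_mono_bdd (.finsetSum _ fun j _ => ((hs _).sub (hs _)).pow 2)
          (((hA.const_mul 2).add hA2).const_mul 9) ?_
        filter_upwards [ae_injective_fst (ι := Fin n) (μ := μ)] with z hz
        -- Each pair term is at most $3$ in absolute value, and three pairs change when a point is
        -- removed.
        have h1 : ∀ j, (Δ j z) ^ 2 ≤ 9 * |Δ j z| := fun j => by
          have : |Δ j z| ≤ 3 * 3 :=
            abs_adjSum_sub_adjSum_erase_le_const hz (Finset.mem_univ j) (hM3 z)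
          rw [← sq_abs]
          nlinarith [abs_nonneg (Δ j z)]
        refine (Finset.sum_le_sum fun j _ => h1 j).trans ?_
        rw [← Finset.mul_sum]
        refine mul_le_mul_of_nonneg_left ((sum_abs_adjSum_sub_erase_le hz).trans
          (add_le_add (mul_le_mul_of_nonneg_left (adjSum_mono fun i k _ => hM z i k)
            zero_le_two) ?_)) (by norm_num)
        unfold adjSum₂
        refine Finset.sum_le_sum fun j _ => Finset.sum_le_sum fun i _ =>
          Finset.sum_le_sum fun k _ => ?_
        split_ifs
        · exact hM z i k
        · exact le_rfl
    _ = 9 * (2 * ∫ x, adjSum Finset.univ x (fun i k => 3 * sectionDist p (x i) (x k))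
          ∂(iid (Fin n) μ) + ∫ x, adjSum₂ Finset.univ x
          (fun i _ k => 3 * sectionDist p (x i) (x k)) ∂(iid (Fin n) μ)) := by
        rw [integral_const_mul, integral_add ((hA.const_mul 2).integrable _) (hA2.integrable _),
          integral_const_mul, integral_adjSum μ hf, integral_adjSum₂ hf]
        simp_rw [hfint]
    _ ≤ 9 * (2 * (3 * neighbourDist μ p n) + 6 * neighbourDist μ p n) := by
        have hd : ∀ i k : Fin n, BddMeasurable fun x : Fin n → ℝ => 3 * sectionDist p (x i) (x k) :=
          fun i k => (hp.sectionDist.comp (φ := fun x : Fin n → ℝ => (x i, x k))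
            (by fun_prop)).const_mul 3
        have e1 : ∫ x, adjSum Finset.univ x (fun i k => 3 * sectionDist p (x i) (x k))
            ∂(iid (Fin n) μ) = 3 * neighbourDist μ p n := by
          simp_rw [adjSum_const_mul]
          rw [integral_const_mul, neighbourDist]
        have e2 : ∫ x, adjSum₂ Finset.univ x (fun i _ k => 3 * sectionDist p (x i) (x k))
            ∂(iid (Fin n) μ) ≤ 6 * neighbourDist μ p n := by
          have hb2 : BddMeasurable fun x : Fin n → ℝ => adjSum₂ Finset.univ x
              (fun i _ k => 3 * sectionDist p (x i) (x k)) := by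
            classical
            refine .finsetSum _ fun j _ => .finsetSum _ fun i _ => .finsetSum _ fun k _ => ?_
            have hm : ∀ i : Fin n, Measurable fun x : Fin n → ℝ => x i := fun i => by fun_prop
            exact .ite ((measurableSet_adj hm i j).inter (measurableSet_adj hm j k)) (hd i k)
              (.const 0)
          have hb1 := bddMeasurable_adjSum_sectionDist hp n
          rw [neighbourDist, ← integral_const_mul]
          refine integral_mono_bdd hb2 (hb1.const_mul 6) ?_
          filter_upwards [ae_injective_of_noAtoms (ι := Fin n) μ] with x hx
          have h3 : ∀ i k, 0 ≤ 3 * sectionDist p (x i) (x k) := fun i k =>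
            mul_nonneg (by norm_num) (sectionDist_nonneg _ _ _)
          have := adjSum₂_le (s := Finset.univ) hx (H := fun i _ k => 3 * sectionDist p (x i) (x k))
            h3 h3 fun i j k => by
              have := sectionDist_triangle hp (x i) (x j) (x k)
              linarith
          rw [adjSum_const_mul] at this
          linarith
        linarith
    _ = _ := by ring

end Scatter

section Model

variable {μ : Measure ℝ} {q : ℝ × I → ℝ}

variable (μ q) in
/-- The summand of the linearization which belongs to a single point. -/
noncomputable def pointTerm (w : ℝ × I) : ℝ :=
  2 * scatter (score μ q) w - meanScatter (score μ q) w.1 + crossProb μ q (q w)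

variable (μ q) in
/-- The linearization of the normalized rank variation: a sum over neighbours of terms which only
depend on one of the two sections, and a sum over the points. -/
noncomputable def linearization {n : ℕ} (z : Fin n → ℝ × I) : ℝ :=
  adjSum Finset.univ (fun i => (z i).1)
    (fun i k => pairInteraction (score μ q) (z i).1 (z i).2 (z k).2) + ∑ i, pointTerm μ q (z i)

variable [IsProbabilityMeasure μ] (hq : Measurable q)
include hq

theorem bddMeasurable_pointTerm : BddMeasurable (pointTerm μ q) :=
  (((bddMeasurable_scatter (bddMeasurable_score hq)).const_mul 2).sub
    ((bddMeasurable_meanScatter (bddMeasurable_score hq)).comp measurable_fst)).add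
    ((bddMeasurable_crossProb hq).comp hq)

theorem bddMeasurable_linearization (n : ℕ) :
    BddMeasurable fun z : Fin n → ℝ × I => linearization μ q z :=
  (BddMeasurable.adjSum (by fun_prop) fun i k =>
    (bddMeasurable_pairInteraction (bddMeasurable_score (μ := μ) hq)).comp
      (φ := fun z : Fin n → ℝ × I => ((z i).1, (z i).2, (z k).2)) (by fun_prop)).add
    (.finsetSum _ fun i _ => (bddMeasurable_pointTerm hq).comp (measurable_pi_apply i))

theorem scatter_score_mem (w : ℝ × I) :
    0 ≤ scatter (score μ q) w ∧ scatter (score μ q) w ≤ 1 :=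
  ⟨integral_nonneg fun _ => abs_nonneg _, integral_le_const
    (((BddMeasurable.const _).sub (bddMeasurable_section (bddMeasurable_score hq) w.1)).abs)
    (Eventually.of_forall fun _ => abs_sub_le_one (score_nonneg _) (score_le_one hq _)
      (score_nonneg _) (score_le_one hq _))⟩

theorem meanScatter_score_mem (x : ℝ) :
    0 ≤ meanScatter (score μ q) x ∧ meanScatter (score μ q) x ≤ 1 :=
  ⟨integral_nonneg fun _ => (scatter_score_mem hq _).1, integral_le_const
    (bddMeasurable_section (bddMeasurable_scatter (bddMeasurable_score hq)) x)
    (Eventually.of_forall fun _ => (scatter_score_mem hq _).2)⟩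

/-- The decomposition is exact except for two boundary effects: the largest point has no right
neighbour and the smallest no left neighbour. Each costs at most $1$. -/
theorem abs_neighbourVariation_sub_le {n : ℕ} (hn : 0 < n) {z : Fin n → ℝ × I}
    (hz : Function.Injective fun i => (z i).1) :
    |neighbourVariation q z / n - linearization μ q z - (rankRemainder μ q Finset.univ z / n +
      adjSum Finset.univ (fun i => (z i).1) (sectionError (score μ q) z) -
        n * ∫ t, crossProb μ q t ∂(lawY μ q))| ≤ 2 := by
  set cbar := ∫ t, crossProb μ q t ∂(lawY μ q)
  set p := score μ q with hp
  let x : Fin n → ℝ := fun i => (z i).1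
  let f : Fin n → ℝ := fun i => scatter p (z i) - meanScatter p (z i).1
  let g : Fin n → ℝ := fun k => scatter p (z k)
  have hf : ∀ i, |f i| ≤ 1 := fun i =>
    abs_sub_le_one (scatter_score_mem hq _).1 (scatter_score_mem hq _).2
      (meanScatter_score_mem hq _).1 (meanScatter_score_mem hq _).2
  have hg : ∀ i, |g i| ≤ 1 := fun i => by
    rw [abs_of_nonneg (scatter_score_mem hq _).1]; exact (scatter_score_mem hq _).2
  have h1 := abs_sum_sub_adjSum_left_le hz zero_le_one hf
  have h2 := abs_sum_sub_adjSum_right_le hz zero_le_one hg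
  have hn' : (n : ℝ) ≠ 0 := by exact_mod_cast hn.ne'
  have e1 : neighbourVariation q z = rankRemainder μ q Finset.univ z +
      n * scoreVariation μ q z + n * (∑ k, crossProb μ q (q (z k)) - n * cbar) := by
    unfold rankRemainder pairRemainder scoreVariation neighbourVariation centredCross
    rw [adjSum_sub, adjSum_const_mul, Finset.sum_sub_distrib, Finset.card_univ, Fintype.card_fin]
    simp [cbar]
    ring
  -- Hoeffding decomposition on the section of the left point $i$; `f` collects the part depending
  -- on $z_i$ alone and `g` the part depending on $z_k$ alone.
  have e2 : scoreVariation μ q z = adjSum Finset.univ x (sectionError p z) +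
      adjSum Finset.univ x (fun i k => pairInteraction p (z i).1 (z i).2 (z k).2) +
      (adjSum Finset.univ x (fun i _ => f i) + adjSum Finset.univ x (fun _ k => g k)) := by
    rw [← adjSum_add, ← adjSum_add, ← adjSum_add]
    refine adjSum_congr fun i k _ => ?_
    simp only [sectionError, pairInteraction, f, g, ← hp, Prod.mk.eta]
    ring
  have e3 : ∑ i, pointTerm μ q (z i) =
      ∑ i, f i + ∑ i, g i + ∑ k, crossProb μ q (q (z k)) := by
    rw [← Finset.sum_add_distrib, ← Finset.sum_add_distrib]
    refine Finset.sum_congr rfl fun i _ => ?_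
    simp only [pointTerm, f, g, ← hp]
    ring
  have e4 : neighbourVariation q z / n - linearization μ q z - (rankRemainder μ q Finset.univ z / n +
      adjSum Finset.univ (fun i => (z i).1) (sectionError p z) - n * cbar) =
      -((∑ i, f i - adjSum Finset.univ x (fun i _ => f i)) +
        (∑ i, g i - adjSum Finset.univ x (fun _ k => g k))) := by
    rw [e1, e2, linearization, e3]
    field_simp
    ring
  rw [e4, abs_neg]
  refine (abs_add_le _ _).trans ?_
  linarith

/-- A variance is at most the mean square about any constant. The one chosen here centres both
remainders, whose variances are known, and leaves the boundary term bounded by $2$. -/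
theorem variance_neighbourVariation_sub_le [NullSingletonClass μ] {n : ℕ} (hn : 0 < n) :
    ∫ z, (neighbourVariation q z / n - linearization μ q z -
      ∫ w, (neighbourVariation q w / n - linearization μ q w) ∂(iid (Fin n) (joint μ))) ^ 2
        ∂(iid (Fin n) (joint μ)) ≤ 7300 * (1 + neighbourDist μ (score μ q) n) := by
  set P := iid (Fin n) (joint μ) with hP
  set cbar := ∫ t, crossProb μ q t ∂(lawY μ q) with hcbar
  have hV : BddMeasurable fun z : Fin n → ℝ × I =>
      neighbourVariation q z / n - linearization μ q z := by
    simpa [div_eq_inv_mul] using ((bddMeasurable_neighbourVariation hq n).const_mul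
      (n : ℝ)⁻¹).sub (bddMeasurable_linearization hq n)
  have hR := bddMeasurable_rankRemainder (μ := μ) hq (n := n) Finset.univ
  have hE : BddMeasurable fun z : Fin n → ℝ × I =>
      adjSum Finset.univ (fun i => (z i).1) (sectionError (score μ q) z) :=
    .adjSum (by fun_prop) fun i k => bddMeasurable_sectionError (bddMeasurable_score hq) i k
  set mR := ∫ w, rankRemainder μ q Finset.univ w ∂P with hmR
  set mE := ∫ w, adjSum Finset.univ (fun i => (w i).1) (sectionError (score μ q) w) ∂P with hmE
  have h0 := integral_sq_sub_const P hV (mR / n + mE - n * cbar)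
  have h1 : ∫ z, (neighbourVariation q z / n - linearization μ q z -
      (mR / n + mE - n * cbar)) ^ 2 ∂P ≤
      ∫ z, (3 * ((n : ℝ)⁻¹ ^ 2 * (rankRemainder μ q Finset.univ z - mR) ^ 2 +
        (adjSum Finset.univ (fun i => (z i).1) (sectionError (score μ q) z) - mE) ^ 2) + 12) ∂P := by
    refine integral_mono_bdd ((hV.sub_const _).pow 2)
      ((((((hR.sub_const mR).pow 2).const_mul _).add ((hE.sub_const mE).pow 2)).const_mul 3).add_const
        12) ?_
    filter_upwards [ae_injective_fst (ι := Fin n) (μ := μ)] with z hz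
    have hb := abs_neighbourVariation_sub_le (μ := μ) hq hn hz
    rw [← hcbar] at hb
    set b := neighbourVariation q z / n - linearization μ q z - (rankRemainder μ q Finset.univ z / n +
      adjSum Finset.univ (fun i => (z i).1) (sectionError (score μ q) z) - n * cbar) with hbdef
    have e : neighbourVariation q z / n - linearization μ q z - (mR / n + mE - n * cbar) =
        (n : ℝ)⁻¹ * (rankRemainder μ q Finset.univ z - mR) +
        (adjSum Finset.univ (fun i => (z i).1) (sectionError (score μ q) z) - mE) + b := by
      rw [hbdef]; field_simp; ring
    rw [e, ← mul_pow]
    have hb2 : b ^ 2 ≤ 4 := by nlinarith [abs_le.mp hb]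
    have key : ∀ a c d : ℝ, (a + c + d) ^ 2 ≤ 3 * (a ^ 2 + c ^ 2) + 3 * d ^ 2 := fun a c d => by
      nlinarith [sq_nonneg (a - c), sq_nonneg (a - d), sq_nonneg (c - d)]
    refine (key _ _ _).trans ?_
    linarith
  have hs : ((fun z : Fin n → ℝ × I => (n : ℝ)⁻¹ ^ 2 * (rankRemainder μ q Finset.univ z - mR) ^ 2))
      = fun z => (n : ℝ)⁻¹ ^ 2 * (rankRemainder μ q Finset.univ z - mR) ^ 2 := rfl
  rw [integral_add ((((((hR.sub_const mR).pow 2).const_mul _).add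
    ((hE.sub_const mE).pow 2)).const_mul 3).integrable _) (integrable_const _), integral_const_mul,
    integral_add ((((hR.sub_const mR).pow 2).const_mul _).integrable _)
      (((hE.sub_const mE).pow 2).integrable _), integral_const_mul] at h1
  have h2 := variance_rankRemainder_le (μ := μ) hq n
  have h3 := variance_adjSum_sectionError_le (μ := μ) (bddMeasurable_score (μ := μ) hq)
    score_nonneg (score_le_one hq) n
  rw [← hP] at h2 h3
  have hn' : (0 : ℝ) < n := by exact_mod_cast hn
  have h4 : (n : ℝ)⁻¹ ^ 2 * ∫ z, (rankRemainder μ q Finset.univ z - mR) ^ 2 ∂P ≤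
      2400 + 25 * neighbourDist μ (score μ q) n := by
    rw [inv_pow, inv_mul_le_iff₀ (by positivity)]
    exact h2
  have hnd := neighbourDist_nonneg μ (score μ q) n
  simp only [integral_const, probReal_univ, smul_eq_mul, one_mul] at h1
  nlinarith [sq_nonneg (∫ z, (neighbourVariation q z / n - linearization μ q z) ∂P -
    (mR / n + mE - n * cbar))]

end Model

end RankBootstrap

namespace RankBootstrap

open unitInterval

/-! ### The central limit theorem for the linearization -/

theorem integral_sq_sum_of_orthogonal {Ω A : Type*} [MeasurableSpace Ω] (P : Measure Ω)
    [IsProbabilityMeasure P] (𝒜 : Finset A) {ζ : A → Ω → ℝ} (hζ : ∀ a, BddMeasurable (ζ a))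
    (h : ∀ a ∈ 𝒜, ∀ b ∈ 𝒜, a ≠ b → ∫ z, ζ a z * ζ b z ∂P = 0) :
    ∫ z, (∑ a ∈ 𝒜, ζ a z) ^ 2 ∂P = ∑ a ∈ 𝒜, ∫ z, ζ a z ^ 2 ∂P := by
  simp_rw [sq, Finset.sum_mul_sum]
  rw [integral_finsetSum _ fun a _ => (BddMeasurable.finsetSum _ fun b _ =>
    (hζ a).mul (hζ b)).integrable _]
  refine Finset.sum_congr rfl fun a ha => ?_
  rw [integral_finsetSum _ fun b _ => ((hζ a).mul (hζ b)).integrable _]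
  exact Finset.sum_eq_single_of_mem a ha fun b hb hab => h a ha b hb hab.symm

section Pairs

variable {n : ℕ} {x : Fin n → ℝ}

open Classical in
/-- The pairs of neighbours, together with the diagonal. -/
noncomputable def neighbourPairs (x : Fin n → ℝ) : Finset (Fin n × Fin n) :=
  Finset.univ.filter fun a => a.1 = a.2 ∨ Adj Finset.univ x a.1 a.2

/-- A diagonal pair $(i,i)$ carries the term of the single point $i$, so interactions and point
terms form one locally dependent sum. -/
theorem sum_neighbourPairs (Z : Fin n → Fin n → ℝ) :
    ∑ a ∈ neighbourPairs x, Z a.1 a.2 = adjSum Finset.univ x Z + ∑ i, Z i i := by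
  classical
  unfold neighbourPairs adjSum
  rw [Finset.sum_filter, Fintype.sum_prod_type, ← Finset.sum_add_distrib]
  refine Finset.sum_congr rfl fun i _ => ?_
  have h : ∀ k, (if i = k ∨ Adj Finset.univ x i k then Z i k else 0) =
      (if Adj Finset.univ x i k then Z i k else 0) + if i = k then Z i k else 0 := fun k => by
    by_cases h1 : i = k
    · subst h1
      have h2 : ¬ Adj Finset.univ x i i := fun h => h.ne rfl
      simp [h2]
    · simp [h1]
  simp_rw [h, Finset.sum_add_distrib]
  simp

theorem card_neighbourPairs_le (hx : Function.Injective x) :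
    ((neighbourPairs x).card : ℝ) ≤ 2 * n := by
  have h := sum_neighbourPairs (x := x) (fun _ _ => 1)
  have h1 := adjSum_le_card_mul (s := Finset.univ) hx zero_le_one (F := fun _ _ => 1)
    fun _ _ => le_rfl
  simp only [Finset.sum_const, nsmul_eq_mul, mul_one, Finset.card_univ, Fintype.card_fin] at h h1
  linarith

open Classical in
-- The diagonal pair, the pair to the right and the pair to the left: this is the constant $K=3$ of
-- `norm_integral_cis_sub_le`.
theorem card_neighbourPairs_touching_le (hx : Function.Injective x) (j : Fin n) :
    ((neighbourPairs x).filter fun b => j ∈ ({b.1, b.2} : Finset (Fin n))).card ≤ 3 := by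
  have hsub : ((neighbourPairs x).filter fun b => j ∈ ({b.1, b.2} : Finset (Fin n))) ⊆
      ({(j, j)} ∪ (Finset.univ.filter fun k => Adj Finset.univ x j k).image fun k => (j, k)) ∪
        (Finset.univ.filter fun i => Adj Finset.univ x i j).image fun i => (i, j) := by
    rintro ⟨i, k⟩ h
    simp only [neighbourPairs, Finset.mem_filter, Finset.mem_univ, true_and, Finset.mem_insert,
      Finset.mem_singleton] at h
    simp only [Finset.mem_union, Finset.mem_singleton, Finset.mem_image, Finset.mem_filter,
      Finset.mem_univ, true_and, Prod.mk.injEq]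
    obtain ⟨h1 | h1, rfl | rfl⟩ := h
    · exact Or.inl (Or.inl ⟨rfl, h1.symm⟩)
    · exact Or.inl (Or.inl ⟨h1, rfl⟩)
    · exact Or.inl (Or.inr ⟨k, h1, rfl, rfl⟩)
    · exact Or.inr ⟨i, h1, rfl, rfl⟩
  refine (Finset.card_le_card hsub).trans ((Finset.card_union_le _ _).trans ?_)
  have h1 : ((Finset.univ.filter fun k => Adj Finset.univ x j k).image fun k => (j, k)).card ≤ 1 :=
    Finset.card_image_le.trans (Finset.card_le_one.mpr fun a ha b hb => by
      simp only [Finset.mem_filter, Finset.mem_univ, true_and] at ha hb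
      exact ha.right_unique hx hb)
  have h2 : ((Finset.univ.filter fun i => Adj Finset.univ x i j).image fun i => (i, j)).card ≤ 1 :=
    Finset.card_image_le.trans (Finset.card_le_one.mpr fun a ha b hb => by
      simp only [Finset.mem_filter, Finset.mem_univ, true_and] at ha hb
      exact ha.left_unique hx hb)
  have h3 := Finset.card_union_le ({(j, j)} : Finset (Fin n × Fin n))
    ((Finset.univ.filter fun k => Adj Finset.univ x j k).image fun k => (j, k))
  rw [Finset.card_singleton] at h3
  omega

/-- Adjacency is asymmetric, so distinct pairs have distinct coordinate sets. A coordinate in only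
one of them yields orthogonality, since both kinds of terms average to zero over each of their
coordinates. -/
theorem exists_mem_of_ne_neighbourPairs {a b : Fin n × Fin n} (ha : a ∈ neighbourPairs x)
    (hb : b ∈ neighbourPairs x) (hab : a ≠ b) :
    ∃ j, (j ∈ ({a.1, a.2} : Finset (Fin n)) ∧ j ∉ ({b.1, b.2} : Finset (Fin n))) ∨
      (j ∈ ({b.1, b.2} : Finset (Fin n)) ∧ j ∉ ({a.1, a.2} : Finset (Fin n))) := by
  classical
  by_contra hcon
  push Not at hcon
  obtain ⟨i, k⟩ := a
  obtain ⟨i', k'⟩ := b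
  simp only [neighbourPairs, Finset.mem_filter, Finset.mem_univ, true_and] at ha hb
  simp only [Finset.mem_insert, Finset.mem_singleton] at hcon
  have h1 := (hcon i).1 (Or.inl rfl)
  have h2 := (hcon k).1 (Or.inr rfl)
  have h3 := (hcon i').2 (Or.inl rfl)
  have h4 := (hcon k').2 (Or.inr rfl)
  have hns : ∀ i k, Adj Finset.univ x i k → ¬ Adj Finset.univ x k i := fun i k h => h.not_symm
  have hne : ¬ (i = i' ∧ k = k') := fun h => hab (by rw [h.1, h.2])
  grind

variable {E : Type*} [MeasurableSpace E] {ν : Measure E} [IsProbabilityMeasure ν]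

/-- The conditional central limit theorem, with the $x$-coordinates fixed. Orthogonality makes the
variance explicit; with $L=2$, $K=3$ the constant $(LKLK)^2$ is $1296$, and there are at most $2n$
terms. -/
theorem norm_integral_cis_pairs_sub_le (hx : Function.Injective x) {g : Fin n → E → ℝ}
    {d : Fin n → E → E → ℝ} {B : ℝ} (hgm : ∀ i, Measurable (g i))
    (hdm : ∀ i, Measurable (Function.uncurry (d i))) (hgB : ∀ i u, |g i u| ≤ B)
    (hdB : ∀ i u u', |d i u u'| ≤ B) (hg0 : ∀ i, ∫ u, g i u ∂ν = 0)
    (hd1 : ∀ i u', ∫ u, d i u u' ∂ν = 0) (hd2 : ∀ i u, ∫ u', d i u u' ∂ν = 0) (c : ℝ) (t : ℝ) :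
    ‖∫ u, cis (t * (c * (adjSum Finset.univ x (fun i k => d i (u i) (u k)) + ∑ i, g i (u i))))
        ∂(iid (Fin n) ν) - Complex.exp (-(c ^ 2 * (adjSum Finset.univ x (fun i _ =>
          ∫ w, d i w.1 w.2 ^ 2 ∂(ν.prod ν)) + ∑ i, ∫ u, g i u ^ 2 ∂ν) * t ^ 2 / 2 : ℝ))‖ ≤
      4 * (2 * n) * (|c| * B) ^ 3 * 1296 * |t| ^ 3 := by
  classical
  set P := iid (Fin n) ν with hP
  let ζ : Fin n × Fin n → (Fin n → E) → ℝ := fun a u =>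
    c * if a.1 = a.2 then g a.1 (u a.1) else d a.1 (u a.1) (u a.2)
  have hdm' : ∀ i {Ω : Type _} [MeasurableSpace Ω] (f₁ f₂ : Ω → E), Measurable f₁ → Measurable f₂ →
      Measurable fun ω => d i (f₁ ω) (f₂ ω) := fun i Ω _ f₁ f₂ h₁ h₂ => (hdm i).comp (h₁.prodMk h₂)
  have hm : ∀ a, Measurable (ζ a) := fun a => by
    simp only [ζ]
    refine measurable_const.mul ?_
    split_ifs
    · exact (hgm _).comp (measurable_pi_apply _)
    · exact hdm' _ _ _ (measurable_pi_apply _) (measurable_pi_apply _)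
  have hε : ∀ a u, |ζ a u| ≤ |c| * B := fun a u => by
    simp only [ζ]
    rw [abs_mul]
    refine mul_le_mul_of_nonneg_left ?_ (abs_nonneg c)
    split_ifs
    · exact hgB _ _
    · exact hdB _ _ _
  have hb : ∀ a, BddMeasurable (ζ a) := fun a => ⟨hm a, _, hε a⟩
  have hT : ∀ a, DependsOn (ζ a) (({a.1, a.2} : Finset (Fin n)) : Set (Fin n)) := fun a u v h => by
    have h1 := h a.1 (by simp)
    have h2 := h a.2 (by simp)
    simp only [ζ, h1, h2]
  have havg : ∀ a, ∀ j ∈ ({a.1, a.2} : Finset (Fin n)), ∀ u, avg ν j (ζ a) u = 0 := by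
    rintro ⟨i, k⟩ j hj u
    simp only [Finset.mem_insert, Finset.mem_singleton] at hj
    simp only [avg, ζ]
    rw [integral_const_mul]
    by_cases hik : i = k
    · subst hik
      obtain rfl : j = i := hj.elim id id
      simp [hg0]
    · simp only [if_neg hik]
      rcases hj with rfl | rfl
      · simp [Function.update_of_ne (Ne.symm hik), hd1]
      · simp [Function.update_of_ne hik, hd2]
  have h0 : ∀ a, ∫ u, ζ a u ∂P = 0 := fun a => by
    rw [← integral_avg (hb a) a.1]
    simp [havg a a.1 (by simp)]
  have hcard : ∀ a : Fin n × Fin n, ({a.1, a.2} : Finset (Fin n)).card ≤ 2 := fun a =>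
    Finset.card_le_two
  have key := norm_integral_cis_sub_le (μ := ν) (neighbourPairs x) (ζ := ζ)
    (T := fun a => {a.1, a.2}) (L := 2) (K := 3) hm hε hT hcard
    (fun j => card_neighbourPairs_touching_le hx j) h0 t
  have hsum : ∀ u : Fin n → E, ∑ a ∈ neighbourPairs x, ζ a u =
      c * (adjSum Finset.univ x (fun i k => d i (u i) (u k)) + ∑ i, g i (u i)) := fun u => by
    have h := sum_neighbourPairs (x := x)
      (fun i k => if i = k then g i (u i) else d i (u i) (u k))
    simp only [ζ]
    rw [← Finset.mul_sum, h]
    congr 2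
    · exact adjSum_congr fun i k hik => if_neg hik.ne
    · simp
  have hvar : ∫ u, (∑ a ∈ neighbourPairs x, ζ a u) ^ 2 ∂P = c ^ 2 * (adjSum Finset.univ x
      (fun i _ => ∫ w, d i w.1 w.2 ^ 2 ∂(ν.prod ν)) + ∑ i, ∫ u, g i u ^ 2 ∂ν) := by
    rw [integral_sq_sum_of_orthogonal P _ hb]
    · have h := sum_neighbourPairs (x := x) (fun i k => ∫ u, ζ (i, k) u ^ 2 ∂P)
      rw [h, mul_add, ← adjSum_const_mul, Finset.mul_sum]
      congr 1
      · refine adjSum_congr fun i k hik => ?_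
        simp only [ζ, if_neg hik.ne, mul_pow]
        rw [integral_const_mul]
        congr 1
        exact integral_pair (f := fun w => d i w.1 w.2 ^ 2)
          ⟨(hdm i).pow_const 2, B ^ 2, fun w => by
            rw [abs_pow]; exact pow_le_pow_left₀ (abs_nonneg _) (hdB _ _ _) 2⟩ hik.ne
      · refine Finset.sum_congr rfl fun i _ => ?_
        simp only [ζ, if_true, mul_pow]
        rw [integral_const_mul]
        congr 1
        exact integral_iid_eval ν (f := fun u => g i u ^ 2) ((hgm i).pow_const 2) i
    · intro a ha b hb' hab
      obtain ⟨j, ⟨h1, h2⟩ | ⟨h1, h2⟩⟩ := exists_mem_of_ne_neighbourPairs ha hb' hab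
      · simp_rw [mul_comm (ζ a _)]
        exact integral_mul_eq_zero (dependsOn_free (hT b) (by simpa using h2)) (hb b) (hb a)
          (havg a j h1)
      · exact integral_mul_eq_zero (dependsOn_free (hT a) (by simpa using h2)) (hb a) (hb b)
          (havg b j h1)
  simp_rw [hsum] at key hvar
  rw [hvar] at key
  refine key.trans ?_
  by_cases hn : n = 0
  · have : (neighbourPairs x).card = 0 := by
      have := card_neighbourPairs_le hx
      subst hn
      simpa using this
    simp [this, hn]
  have hB : 0 ≤ B := by
    obtain ⟨e⟩ : Nonempty E := ν.nonempty_of_neZero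
    exact (abs_nonneg _).trans (hgB ⟨0, Nat.pos_of_ne_zero hn⟩ e)
  have h1296 : (((2 : ℕ) : ℝ) * (3 : ℕ) * (2 : ℕ) * (3 : ℕ)) ^ 2 = 1296 := by norm_num
  rw [h1296]
  have := card_neighbourPairs_le hx
  gcongr

end Pairs

end RankBootstrap

/-! ### Characteristic function of the linearization, by conditioning on the $x$-coordinates. -/

namespace RankBootstrap

open unitInterval

theorem norm_integral_cis_iid_sub_le {E : Type*} [MeasurableSpace E] {ν : Measure E}
    [IsProbabilityMeasure ν] {n : ℕ} {g : E → ℝ} {B : ℝ} (hg : Measurable g) (hB : ∀ w, |g w| ≤ B)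
    (h0 : ∫ w, g w ∂ν = 0) (c t : ℝ) :
    ‖∫ z, cis (t * (c * ∑ i : Fin n, g (z i))) ∂(iid (Fin n) ν) -
      Complex.exp (-(c ^ 2 * (n * ∫ w, g w ^ 2 ∂ν) * t ^ 2 / 2 : ℝ))‖ ≤
      4 * n * (|c| * B) ^ 3 * |t| ^ 3 := by
  let ζ : Fin n → (Fin n → E) → ℝ := fun i z => c * g (z i)
  have hm : ∀ i, Measurable (ζ i) := fun i => (hg.comp (measurable_pi_apply i)).const_mul c
  have hε : ∀ i z, |ζ i z| ≤ |c| * B := fun i z => by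
    simp only [ζ]; rw [abs_mul]
    exact mul_le_mul_of_nonneg_left (hB _) (abs_nonneg c)
  have hb : ∀ i, BddMeasurable (ζ i) := fun i => ⟨hm i, _, hε i⟩
  have hT : ∀ i, DependsOn (ζ i) (({i} : Finset (Fin n)) : Set (Fin n)) := fun i u v h => by
    simp only [ζ, h i (by simp)]
  have hi0 : ∀ i, ∫ z, ζ i z ∂(iid (Fin n) ν) = 0 := fun i => by
    simp only [ζ]
    rw [integral_const_mul, integral_iid_eval ν hg, h0, mul_zero]
  have key := norm_integral_cis_sub_le (μ := ν) Finset.univ (ζ := ζ) (T := fun i => {i}) (L := 1)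
    (K := 1) hm hε hT (fun _ => by simp) (fun j => Finset.card_le_one.mpr fun a ha b hb => by
      simp only [Finset.mem_filter, Finset.mem_singleton] at ha hb
      exact ha.2.symm.trans hb.2) hi0 t
  have hvar : ∫ z, (∑ i, ζ i z) ^ 2 ∂(iid (Fin n) ν) = c ^ 2 * (n * ∫ w, g w ^ 2 ∂ν) := by
    rw [integral_sq_sum_of_orthogonal _ _ hb]
    · simp only [ζ, mul_pow, integral_const_mul]
      simp_rw [integral_iid_eval ν (f := fun w => g w ^ 2) (hg.pow_const 2)]
      simp; ring
    · intro a _ b _ hab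
      refine integral_mul_eq_zero (j := b) (dependsOn_free (hT a) (by simpa using hab.symm)) (hb a)
        (hb b) fun z => ?_
      simp [avg, ζ, integral_const_mul, h0]
  rw [hvar] at key
  simp only [ζ, ← Finset.mul_sum] at key
  refine key.trans (le_of_eq ?_)
  simp

theorem abs_exp_neg_sub_exp_neg_le {a b : ℝ} (ha : 0 ≤ a) (hb : 0 ≤ b) :
    |Real.exp (-a) - Real.exp (-b)| ≤ |a - b| := by
  wlog h : a ≤ b generalizing a b
  · rw [abs_sub_comm, abs_sub_comm a]
    exact this hb ha (le_of_not_ge h)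
  rw [abs_of_nonneg (sub_nonneg.mpr (Real.exp_le_exp.mpr (by linarith))),
    abs_of_nonpos (by linarith)]
  have h1 := Real.add_one_le_exp (-(b - a))
  have h2 : Real.exp (-b) = Real.exp (-a) * Real.exp (-(b - a)) := by rw [← Real.exp_add]; ring_nf
  have h3 : Real.exp (-a) ≤ 1 := Real.exp_le_one_iff.mpr (by linarith)
  have h4 := Real.exp_pos (-a)
  rw [h2]
  nlinarith

/-- The mean absolute deviation of the sum of iid bounded terms. -/
theorem integral_abs_sum_sub_le {E : Type*} [MeasurableSpace E] {ν : Measure E}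
    [IsProbabilityMeasure ν] {n : ℕ} {g : E → ℝ} {B : ℝ} (hg : Measurable g) (hB0 : 0 < B)
    (hB : ∀ w, |g w - ∫ v, g v ∂ν| ≤ B) :
    ∫ z, |∑ i : Fin n, g (z i) - n * ∫ v, g v ∂ν| ∂(iid (Fin n) ν) ≤ B * √n := by
  set m := ∫ v, g v ∂ν with hm
  have hgb : BddMeasurable g := ⟨hg, B + |m|, fun w => by
    have := abs_sub_abs_le_abs_sub (g w) m
    linarith [hB w]⟩
  let f : E → ℝ := fun w => B⁻¹ * (g w - m)
  have hf : BddMeasurable f := (hgb.sub_const m).const_mul _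
  have hf1 : ∀ w, |f w| ≤ 1 := fun w => by
    simp only [f]
    rw [abs_mul, abs_of_pos (inv_pos.mpr hB0), inv_mul_le_iff₀ hB0, mul_one]
    exact hB w
  have hf0 : ∫ w, f w ∂ν = 0 := by
    simp only [f]
    rw [integral_const_mul, integral_sub (hgb.integrable _) (integrable_const _)]
    simp [hm]
  have h1 := integral_sq_sum_le (ι := Fin n) hf.measurable hf1 hf0 Finset.univ
  have hs : BddMeasurable fun z : Fin n → E => ∑ i, f (z i) :=
    .finsetSum _ fun i _ => hf.comp (measurable_pi_apply i)
  have h2 := abs_integral_le_sqrt (iid (Fin n) ν) hs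
  have e : ∀ z : Fin n → E, |∑ i : Fin n, g (z i) - n * m| = B * |∑ i, f (z i)| := fun z => by
    have : ∑ i : Fin n, g (z i) - n * m = B * ∑ i, f (z i) := by
      simp only [f]
      rw [← Finset.mul_sum, ← mul_assoc, mul_inv_cancel₀ hB0.ne', one_mul, Finset.sum_sub_distrib]
      simp
    rw [this, abs_mul, abs_of_pos hB0]
  simp_rw [e]
  rw [integral_const_mul]
  refine mul_le_mul_of_nonneg_left (h2.trans (Real.sqrt_le_sqrt ?_)) hB0.le
  simpa using h1

section Model

variable {μ : Measure ℝ} {q : ℝ × I → ℝ}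

variable (μ q) in
/-- The conditional mean of the point terms on a section. -/
noncomputable def pointMean (x : ℝ) : ℝ := ∫ u, pointTerm μ q (x, u)

variable (μ q) in
/-- The conditional variance contributed by the section at `x`. -/
noncomputable def sectionVariance (x : ℝ) : ℝ :=
  (∫ w : I × I, pairInteraction (score μ q) x w.1 w.2 ^ 2) +
    ∫ u, (pointTerm μ q (x, u) - pointMean μ q x) ^ 2

variable (μ q) in
/-- The asymptotic variance of the normalized linearization. -/
noncomputable def limitVariance : ℝ :=
  ∫ x, sectionVariance μ q x ∂μ + ∫ x, (pointMean μ q x - ∫ x, pointMean μ q x ∂μ) ^ 2 ∂μ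

theorem sectionVariance_nonneg (x : ℝ) : 0 ≤ sectionVariance μ q x :=
  add_nonneg (integral_nonneg fun _ => sq_nonneg _) (integral_nonneg fun _ => sq_nonneg _)

variable [IsProbabilityMeasure μ] (hq : Measurable q)
include hq

theorem bddMeasurable_pointMean : BddMeasurable (pointMean μ q) :=
  BddMeasurable.integral_right (F := fun (x : ℝ) (u : I) => pointTerm μ q (x, u))
    (bddMeasurable_pointTerm hq) _

theorem bddMeasurable_interactionVariance : BddMeasurable fun x : ℝ =>
    ∫ w : I × I, pairInteraction (score μ q) x w.1 w.2 ^ 2 :=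
  .integral_right (F := fun (x : ℝ) (w : I × I) => pairInteraction (score μ q) x w.1 w.2 ^ 2)
    ((bddMeasurable_pairInteraction (bddMeasurable_score hq)).pow 2) _

theorem bddMeasurable_sectionVariance : BddMeasurable (sectionVariance μ q) :=
  (bddMeasurable_interactionVariance hq).add
    (.integral_right (F := fun (x : ℝ) (u : I) => (pointTerm μ q (x, u) - pointMean μ q x) ^ 2)
    (((bddMeasurable_pointTerm hq).sub ((bddMeasurable_pointMean hq).comp measurable_fst)).pow 2) _)

/-- Given $x$, the characteristic function is $e^{itcR(x)}\Psi(x)$ with $R$ the centred conditional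
mean. Up to $O(n^{-1/2})$ in $L^1$, $\Psi$ equals the constant $e^{-vt^2/2}$, which can be pulled
out. The rest is the characteristic function of an iid sum with variance $w$, and `limitVariance` is
$v+w$. -/
theorem exists_norm_integral_cis_linearization_sub_le [NullSingletonClass μ] (t : ℝ) :
    ∃ K : ℝ, ∀ n : ℕ, 0 < n →
      ‖∫ z : Fin n → ℝ × I, cis (t * ((√n)⁻¹ * (linearization μ q z - n * ∫ x, pointMean μ q x ∂μ)))
        ∂(iid (Fin n) (joint μ)) - Complex.exp (-(limitVariance μ q * t ^ 2 / 2 : ℝ))‖ ≤ K / √n := by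
  set p := score μ q with hp
  have hpb : BddMeasurable p := bddMeasurable_score hq
  set m := ∫ x, pointMean μ q x ∂μ with hm
  let h : ℝ → I → ℝ := fun x u => pointTerm μ q (x, u) - pointMean μ q x
  let d : ℝ → I → I → ℝ := fun x u u' => pairInteraction p x u u'
  let G : ℝ → ℝ := sectionVariance μ q
  let D : ℝ → ℝ := fun x => ∫ w : I × I, d x w.1 w.2 ^ 2
  set v := ∫ x, G x ∂μ with hv
  set w := ∫ x, (pointMean μ q x - m) ^ 2 ∂μ with hw
  have hhb : BddMeasurable fun z : ℝ × I => h z.1 z.2 :=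
    (bddMeasurable_pointTerm hq).sub ((bddMeasurable_pointMean hq).comp measurable_fst)
  have hdb : BddMeasurable fun z : ℝ × I × I => d z.1 z.2.1 z.2.2 :=
    bddMeasurable_pairInteraction hpb
  have hgb : BddMeasurable fun x => pointMean μ q x - m := (bddMeasurable_pointMean hq).sub_const m
  have hGb : BddMeasurable G := bddMeasurable_sectionVariance hq
  have hDb : BddMeasurable D := bddMeasurable_interactionVariance hq
  obtain ⟨B₁, h₁⟩ := hhb.bdd
  obtain ⟨B₂, h₂⟩ := hdb.bdd
  obtain ⟨B₃, h₃⟩ := hgb.bdd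
  obtain ⟨B₄, h₄⟩ := (hGb.sub_const v).bdd
  obtain ⟨B₅, h₅⟩ := hDb.bdd
  obtain ⟨B, hB0, hB1, hB2, hB3, hB4, hB5⟩ : ∃ B : ℝ, 0 < B ∧ B₁ ≤ B ∧ B₂ ≤ B ∧ B₃ ≤ B ∧ B₄ ≤ B ∧
      B₅ ≤ B := by
    refine ⟨1 + |B₁| + |B₂| + |B₃| + |B₄| + |B₅|, by positivity, ?_, ?_, ?_, ?_, ?_⟩ <;>
    linarith [abs_nonneg B₁, abs_nonneg B₂, abs_nonneg B₃, abs_nonneg B₄, abs_nonneg B₅,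
      le_abs_self B₁, le_abs_self B₂, le_abs_self B₃, le_abs_self B₄, le_abs_self B₅]
  have hh : ∀ x u, |h x u| ≤ B := fun x u => (h₁ (x, u)).trans hB1
  have hd : ∀ x u u', |d x u u'| ≤ B := fun x u u' => (h₂ (x, u, u')).trans hB2
  have hg : ∀ x, |pointMean μ q x - m| ≤ B := fun x => (h₃ x).trans hB3
  have hG : ∀ x, |G x - v| ≤ B := fun x => (h₄ x).trans hB4
  have hD : ∀ x, |D x| ≤ B := fun x => (h₅ x).trans hB5
  have hh0 : ∀ x, ∫ u, h x u = 0 := fun x => by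
    simp only [h]
    rw [integral_sub ((bddMeasurable_section (bddMeasurable_pointTerm hq) x).integrable _)
      (integrable_const _)]
    simp [pointMean]
  have hg0 : ∫ x, (pointMean μ q x - m) ∂μ = 0 := by
    rw [integral_sub ((bddMeasurable_pointMean hq).integrable _) (integrable_const _)]
    simp [hm]
  have hv0 : 0 ≤ v := integral_nonneg fun x => sectionVariance_nonneg x
  refine ⟨10368 * B ^ 3 * |t| ^ 3 + t ^ 2 * B + 4 * B ^ 3 * |t| ^ 3, fun n hn => ?_⟩
  have hn' : (0 : ℝ) < n := by exact_mod_cast hn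
  have hs : 0 < √(n : ℝ) := Real.sqrt_pos.mpr hn'
  have hs1 : 1 ≤ √(n : ℝ) := by
    rw [Real.one_le_sqrt]; exact_mod_cast hn
  have hss : √(n : ℝ) * √(n : ℝ) = n := Real.mul_self_sqrt hn'.le
  set c := (√(n : ℝ))⁻¹ with hc
  have hc0 : 0 < c := inv_pos.mpr hs
  have hcs : c * √(n : ℝ) = 1 := inv_mul_cancel₀ hs.ne'
  -- Throughout, $c=n^{-1/2}$; hence $n c^3=c$ is the rate of all error terms.
  have hc2 : c ^ 2 * n = 1 := by rw [← hss]; linear_combination (c * √(n : ℝ) + 1) * hcs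
  have hc1 : c ≤ 1 := inv_le_one_of_one_le₀ hs1
  let S : (Fin n → ℝ) → (Fin n → I) → ℝ := fun x u =>
    adjSum Finset.univ x (fun i k => d (x i) (u i) (u k)) + ∑ i, h (x i) (u i)
  let R : (Fin n → ℝ) → ℝ := fun x => ∑ i, (pointMean μ q (x i) - m)
  let vx : (Fin n → ℝ) → ℝ := fun x =>
    c ^ 2 * (adjSum Finset.univ x (fun i _ => D (x i)) + ∑ i, ∫ u, h (x i) u ^ 2)
  have hSb : BddMeasurable (Function.uncurry S) :=
    (BddMeasurable.adjSum (fun i => (measurable_pi_apply i).comp measurable_fst) fun i k =>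
      hdb.comp (φ := fun v : (Fin n → ℝ) × (Fin n → I) => (v.1 i, v.2 i, v.2 k)) (by fun_prop)).add
      (.finsetSum _ fun i _ =>
        hhb.comp (φ := fun v : (Fin n → ℝ) × (Fin n → I) => (v.1 i, v.2 i)) (by fun_prop))
  have hRb : BddMeasurable R := .finsetSum _ fun i _ => hgb.comp (measurable_pi_apply i)
  have hvxb : BddMeasurable vx := ((BddMeasurable.adjSum (fun i => measurable_pi_apply i)
    fun i k => hDb.comp (measurable_pi_apply i)).add (.finsetSum _ fun i _ =>
      (BddMeasurable.integral_right (F := fun (x : ℝ) (u : I) => h x u ^ 2) (hhb.pow 2) _).comp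
        (measurable_pi_apply i))).const_mul _
  have hvx0 : ∀ x, 0 ≤ vx x := fun x => mul_nonneg (sq_nonneg c) (add_nonneg
    (adjSum_nonneg fun _ _ => integral_nonneg fun _ => sq_nonneg _)
    (Finset.sum_nonneg fun _ _ => integral_nonneg fun _ => sq_nonneg _))
  have hmS : Measurable fun v : (Fin n → ℝ) × (Fin n → I) => cis (t * (c * S v.1 v.2)) :=
    measurable_cis.comp ((hSb.measurable.const_mul c).const_mul t)
  have hmR : Measurable fun x : Fin n → ℝ => cis (t * (c * R x)) :=
    measurable_cis.comp ((hRb.measurable.const_mul c).const_mul t)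
  let Ψ : (Fin n → ℝ) → ℂ := fun x => ∫ u, cis (t * (c * S x u)) ∂(iid (Fin n) volume)
  have hΨm : Measurable Ψ :=
    (hmS.stronglyMeasurable.integral_prod_right (ν := iid (Fin n) (volume : Measure I))).measurable
  have hΨ1 : ∀ x, ‖Ψ x‖ ≤ 1 := fun x => norm_integral_le_const _ fun u => (norm_cis _).le
  have hsplit : ∫ z : Fin n → ℝ × I, cis (t * (c * (linearization μ q z - n * m)))
      ∂(iid (Fin n) (joint μ)) = ∫ x, cis (t * (c * R x)) * Ψ x ∂(iid (Fin n) μ) := by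
    have e : ∀ z : Fin n → ℝ × I, cis (t * (c * (linearization μ q z - n * m))) =
        cis (t * (c * R fun i => (z i).1)) * cis (t * (c * S (fun i => (z i).1) fun i => (z i).2)) :=
      fun z => by
        rw [← cis_add]
        congr 1
        have : linearization μ q z - n * m = R (fun i => (z i).1) +
            S (fun i => (z i).1) (fun i => (z i).2) := by
          simp only [linearization, R, S, h, d, Finset.sum_sub_distrib, Prod.mk.eta]
          simp
          ring
        rw [this]; ring
    simp_rw [e]
    have := integral_iid_joint (ι := Fin n) μ (Φ := fun x u => cis (t * (c * R x)) *
      cis (t * (c * S x u))) (integrable_of_norm_le _ ((hmR.comp measurable_fst).mul hmS) (C := 1)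
        fun v => by simp [Function.uncurry, norm_cis])
    rw [this]
    congr 1; ext x
    exact integral_const_mul _ _
  have hpt : ∀ x : Fin n → ℝ, Function.Injective x → ‖Ψ x - Complex.exp (-(v * t ^ 2 / 2 : ℝ))‖ ≤
      10368 * B ^ 3 * |t| ^ 3 * c + t ^ 2 / 2 * |vx x - v| := fun x hx => by
    have k1 := norm_integral_cis_pairs_sub_le (ν := (volume : Measure I)) hx
      (g := fun i u => h (x i) u) (d := fun i u u' => d (x i) u u') (B := B)
      (fun i => (bddMeasurable_section hhb (x i)).measurable)
      (fun i => hdb.measurable.comp (f := fun w : I × I => (x i, w)) (by fun_prop))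
      (fun i u => hh _ _) (fun i u u' => hd _ _ _) (fun i => hh0 _)
      (fun i u' => integral_pairInteraction_left hpb _ _)
      (fun i u => integral_pairInteraction_right hpb _ _) c t
    have k2 : ‖Complex.exp (-(vx x * t ^ 2 / 2 : ℝ)) - Complex.exp (-(v * t ^ 2 / 2 : ℝ))‖ ≤
        t ^ 2 / 2 * |vx x - v| := by
      rw [← Complex.ofReal_neg, ← Complex.ofReal_neg, ← Complex.ofReal_exp, ← Complex.ofReal_exp,
        ← Complex.ofReal_sub, Complex.norm_real, Real.norm_eq_abs]
      refine (abs_exp_neg_sub_exp_neg_le (by have := hvx0 x; positivity) (by positivity)).trans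
        (le_of_eq ?_)
      have : vx x * t ^ 2 / 2 - v * t ^ 2 / 2 = t ^ 2 / 2 * (vx x - v) := by ring
      rw [this, abs_mul, abs_of_nonneg (by positivity)]
    have k3 : 4 * (2 * (n : ℝ)) * (|c| * B) ^ 3 * 1296 * |t| ^ 3 = 10368 * B ^ 3 * |t| ^ 3 * c := by
      rw [abs_of_pos hc0]
      linear_combination (10368 * B ^ 3 * |t| ^ 3 * c) * hc2
    rw [k3] at k1
    calc _ ≤ ‖Ψ x - Complex.exp (-(vx x * t ^ 2 / 2 : ℝ))‖ +
          ‖Complex.exp (-(vx x * t ^ 2 / 2 : ℝ)) - Complex.exp (-(v * t ^ 2 / 2 : ℝ))‖ :=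
          norm_sub_le_norm_sub_add_norm_sub _ _ _
      _ ≤ _ := add_le_add k1 k2
  -- Every interaction lives on the section of its left point, so up to the largest point the
  -- conditional variance is an iid average of `sectionVariance`, with mean $v$ and fluctuations of
  -- order $n^{-1/2}$.
  have hvx : ∫ x, |vx x - v| ∂(iid (Fin n) μ) ≤ 2 * B * c := by
    have a1 := integral_abs_sum_sub_le (n := n) hGb.measurable hB0 hG
    have hb1 : BddMeasurable fun x : Fin n → ℝ => |∑ i, G (x i) - n * v| :=
      ((BddMeasurable.finsetSum _ fun i _ => hGb.comp (measurable_pi_apply i)).sub_const _).abs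
    have a2 : ∫ x, |vx x - v| ∂(iid (Fin n) μ) ≤
        ∫ x, (c ^ 2 * |∑ i, G (x i) - n * v| + c ^ 2 * B) ∂(iid (Fin n) μ) := by
      refine integral_mono_bdd ((hvxb.sub_const v).abs) ((hb1.const_mul _).add_const _) ?_
      filter_upwards [ae_injective_of_noAtoms (ι := Fin n) μ] with x hx
      have b1 := abs_sum_sub_adjSum_left_le hx hB0.le (f := fun i => D (x i)) fun i => hD _
      have e : vx x - v = c ^ 2 * ((∑ i, G (x i) - n * v) -
          (∑ i, D (x i) - adjSum Finset.univ x (fun i _ => D (x i)))) := by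
        have e1 : ∑ i, G (x i) = ∑ i, D (x i) + ∑ i, ∫ u, h (x i) u ^ 2 := by
          rw [← Finset.sum_add_distrib]; rfl
        rw [e1]
        simp only [vx]
        linear_combination (v) * hc2
      rw [e, abs_mul, abs_of_nonneg (sq_nonneg c), ← mul_add]
      refine mul_le_mul_of_nonneg_left ((abs_sub _ _).trans ?_) (sq_nonneg c)
      linarith
    rw [integral_add ((hb1.const_mul _).integrable _) (integrable_const _), integral_const_mul] at a2
    simp only [integral_const, probReal_univ, smul_eq_mul, one_mul] at a2
    have a3 : c ^ 2 * ∫ x, |∑ i : Fin n, G (x i) - n * v| ∂(iid (Fin n) μ) ≤ c * B := by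
      calc _ ≤ c ^ 2 * (B * √n) := mul_le_mul_of_nonneg_left a1 (sq_nonneg c)
        _ = c * B * (c * √n) := by ring
        _ = c * B := by rw [hcs, mul_one]
    have a4 : c ^ 2 * B ≤ c * B := mul_le_mul_of_nonneg_right (by nlinarith) hB0.le
    linarith
  have hR1 : ‖∫ x, cis (t * (c * R x)) ∂(iid (Fin n) μ) - Complex.exp (-(w * t ^ 2 / 2 : ℝ))‖ ≤
      4 * B ^ 3 * |t| ^ 3 * c := by
    have k := norm_integral_cis_iid_sub_le (n := n) hgb.measurable hg hg0 c t
    have e1 : c ^ 2 * (n * ∫ x, (pointMean μ q x - m) ^ 2 ∂μ) = w := by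
      rw [← mul_assoc, hc2, one_mul]
    rw [e1] at k
    refine k.trans (le_of_eq ?_)
    rw [abs_of_pos hc0]
    linear_combination (4 * B ^ 3 * |t| ^ 3 * c) * hc2
  rw [hsplit]
  set ev := Complex.exp (-(v * t ^ 2 / 2 : ℝ)) with hev
  have hev1 : ‖ev‖ ≤ 1 := by
    rw [hev, ← Complex.ofReal_neg, ← Complex.ofReal_exp, Complex.norm_real, Real.norm_eq_abs,
      abs_of_pos (Real.exp_pos _)]
    exact Real.exp_le_one_iff.mpr (by have : 0 ≤ v * t ^ 2 / 2 := by positivity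
                                      linarith)
  have hlim : Complex.exp (-(limitVariance μ q * t ^ 2 / 2 : ℝ)) =
      Complex.exp (-(w * t ^ 2 / 2 : ℝ)) * ev := by
    rw [hev, ← Complex.exp_add]
    congr 1
    have : limitVariance μ q = v + w := rfl
    rw [this]; push_cast; ring
  have hi1 : Integrable (fun x => cis (t * (c * R x)) * Ψ x) (iid (Fin n) μ) :=
    integrable_of_norm_le _ (hmR.mul hΨm) (C := 1) fun x => by
      rw [norm_mul, norm_cis, one_mul]; exact hΨ1 x
  have hi2 : Integrable (fun x => cis (t * (c * R x)) * ev) (iid (Fin n) μ) :=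
    integrable_of_norm_le _ (hmR.mul_const ev) (C := 1) fun x => by
      rw [norm_mul, norm_cis, one_mul]; exact hev1
  have e : ∫ x, cis (t * (c * R x)) * Ψ x ∂(iid (Fin n) μ) -
      Complex.exp (-(limitVariance μ q * t ^ 2 / 2 : ℝ)) =
      ∫ x, (cis (t * (c * R x)) * Ψ x - cis (t * (c * R x)) * ev) ∂(iid (Fin n) μ) +
      (∫ x, cis (t * (c * R x)) ∂(iid (Fin n) μ) - Complex.exp (-(w * t ^ 2 / 2 : ℝ))) * ev := by
    rw [integral_sub hi1 hi2, integral_mul_const, hlim]; ring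
  rw [e]
  have f1 : ‖∫ x, (cis (t * (c * R x)) * Ψ x - cis (t * (c * R x)) * ev) ∂(iid (Fin n) μ)‖ ≤
      10368 * B ^ 3 * |t| ^ 3 * c + t ^ 2 / 2 * (2 * B * c) := by
    have hb : BddMeasurable fun x => |vx x - v| := (hvxb.sub_const v).abs
    calc _ ≤ ∫ x, (10368 * B ^ 3 * |t| ^ 3 * c + t ^ 2 / 2 * |vx x - v|) ∂(iid (Fin n) μ) := by
          refine norm_integral_le_of_norm_le
            (((BddMeasurable.const _).add (hb.const_mul (t ^ 2 / 2))).integrable _) ?_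
          filter_upwards [ae_injective_of_noAtoms (ι := Fin n) μ] with x hx
          rw [← mul_sub, norm_mul, norm_cis, one_mul]
          exact hpt x hx
      _ ≤ _ := by
          rw [integral_add (integrable_const _) ((hb.const_mul (t ^ 2 / 2)).integrable _),
            integral_const_mul (t ^ 2 / 2)]
          simp only [integral_const, probReal_univ, smul_eq_mul, one_mul]
          gcongr
  have f2 : ‖(∫ x, cis (t * (c * R x)) ∂(iid (Fin n) μ) - Complex.exp (-(w * t ^ 2 / 2 : ℝ))) * ev‖
      ≤ 4 * B ^ 3 * |t| ^ 3 * c := by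
    rw [norm_mul]
    calc _ ≤ 4 * B ^ 3 * |t| ^ 3 * c * 1 :=
          mul_le_mul hR1 hev1 (norm_nonneg _) (by positivity)
      _ = _ := mul_one _
  refine (norm_add_le _ _).trans ((add_le_add f1 f2).trans (le_of_eq ?_))
  rw [div_eq_mul_inv _ √(n : ℝ), ← hc]; ring

end Model

end RankBootstrap

/-! ### Asymptotic normality of the normalized rank variation. -/

namespace RankBootstrap

open unitInterval

section Model

variable {μ : Measure ℝ} {q : ℝ × I → ℝ} [IsProbabilityMeasure μ] (hq : Measurable q)
include hq

theorem integral_pointMean : ∫ x, pointMean μ q x ∂μ = ∫ w, pointTerm μ q w ∂(joint μ) := by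
  rw [integral_prod _ ((bddMeasurable_pointTerm hq).integrable _)]
  rfl

theorem integral_linearization (n : ℕ) :
    ∫ z : Fin n → ℝ × I, linearization μ q z ∂(iid (Fin n) (joint μ)) =
      n * ∫ x, pointMean μ q x ∂μ := by
  have hpb : BddMeasurable (score μ q) := bddMeasurable_score hq
  have hd : BddMeasurable fun v : (ℝ × ℝ) × (I × I) =>
      pairInteraction (score μ q) v.1.1 v.2.1 v.2.2 :=
    (bddMeasurable_pairInteraction hpb).comp
      (φ := fun v : (ℝ × ℝ) × (I × I) => (v.1.1, v.2.1, v.2.2)) (by fun_prop)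
  have h1 : BddMeasurable fun z : Fin n → ℝ × I => adjSum Finset.univ (fun i => (z i).1)
      (fun i k => pairInteraction (score μ q) (z i).1 (z i).2 (z k).2) :=
    .adjSum (by fun_prop) fun i k => hd.comp
      (φ := fun z : Fin n → ℝ × I => (((z i).1, (z k).1), ((z i).2, (z k).2))) (by fun_prop)
  have h2 : ∀ i, BddMeasurable fun z : Fin n → ℝ × I => pointTerm μ q (z i) := fun i =>
    (bddMeasurable_pointTerm hq).comp (measurable_pi_apply i)
  have h3 : ∀ x, ∫ w : I × I, pairInteraction (score μ q) x w.1 w.2 = 0 := fun x => by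
    rw [Measure.volume_eq_prod, integral_prod _ (((bddMeasurable_pairInteraction hpb).comp
      (φ := fun w : I × I => (x, w)) (by fun_prop)).integrable _)]
    simp [integral_pairInteraction_right hpb]
  unfold linearization
  rw [integral_add (h1.integrable _) ((BddMeasurable.finsetSum _ fun i _ => h2 i).integrable _),
    integral_adjSum μ hd, integral_finsetSum _ fun i _ => (h2 i).integrable _]
  simp_rw [h3, integral_iid_eval (joint μ) (bddMeasurable_pointTerm hq).measurable,
    ← integral_pointMean hq]
  simp [adjSum]

variable [NullSingletonClass μ]

/-- Efron–Stein: removing a point alters at most three bounded interactions and one bounded point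
term. -/
theorem exists_variance_linearization_le : ∃ K : ℝ, 0 ≤ K ∧ ∀ n : ℕ,
    ∫ z : Fin n → ℝ × I, (linearization μ q z - ∫ w, linearization μ q w ∂(iid (Fin n) (joint μ))) ^ 2
      ∂(iid (Fin n) (joint μ)) ≤ K * n := by
  have hpb : BddMeasurable (score μ q) := bddMeasurable_score hq
  obtain ⟨B₁, h₁⟩ := (bddMeasurable_pairInteraction hpb).bdd
  obtain ⟨B₂, h₂⟩ := (bddMeasurable_pointTerm (μ := μ) hq).bdd
  refine ⟨(3 * B₁ + B₂) ^ 2, sq_nonneg _, fun n => ?_⟩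
  have hd : ∀ s : Finset (Fin n), BddMeasurable fun z : Fin n → ℝ × I =>
      adjSum s (fun i => (z i).1)
        (fun i k => pairInteraction (score μ q) (z i).1 (z i).2 (z k).2) := fun s =>
    .adjSum (by fun_prop) fun i k => (bddMeasurable_pairInteraction hpb).comp
      (φ := fun z : Fin n → ℝ × I => ((z i).1, (z i).2, (z k).2)) (by fun_prop)
  have hp : ∀ s : Finset (Fin n), BddMeasurable fun z : Fin n → ℝ × I =>
      ∑ i ∈ s, pointTerm μ q (z i) := fun s =>
    .finsetSum _ fun i _ => (bddMeasurable_pointTerm hq).comp (measurable_pi_apply i)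
  have hb := fun s => (hd s).add (hp s)
  refine (efronStein (μ := joint μ) (bddMeasurable_linearization hq n)
    (fun j z => adjSum (Finset.univ.erase j) (fun i => (z i).1)
        (fun i k => pairInteraction (score μ q) (z i).1 (z i).2 (z k).2) +
      ∑ i ∈ Finset.univ.erase j, pointTerm μ q (z i)) (fun j => hb _) fun j z w => ?_).trans ?_
  · have h1 := free_adjSum_erase (j := j) (F := fun (z : Fin n → ℝ × I) i k =>
      pairInteraction (score μ q) (z i).1 (z i).2 (z k).2) (fun z w i k hi hk => by
        rw [Function.update_of_ne hi, Function.update_of_ne hk]) z w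
    simp only at h1 ⊢
    rw [h1]
    congr 1
    exact Finset.sum_congr rfl fun l hl => by
      rw [Function.update_of_ne (Finset.ne_of_mem_erase hl)]
  · refine (Finset.sum_le_card_nsmul _ _ ((3 * B₁ + B₂) ^ 2) fun j _ => ?_).trans (le_of_eq (by
      rw [Finset.card_univ, Fintype.card_fin, nsmul_eq_mul, mul_comm]))
    refine integral_le_const (((bddMeasurable_linearization hq n).sub (hb _)).pow 2) ?_
    filter_upwards [ae_injective_fst (ι := Fin n) (μ := μ)] with z hz
    have k1 := abs_adjSum_sub_adjSum_erase_le_const hz (Finset.mem_univ j)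
      (F := fun i k => pairInteraction (score μ q) (z i).1 (z i).2 (z k).2)
      (fun i k => h₁ ((z i).1, (z i).2, (z k).2))
    have k2 := h₂ (z j)
    rw [linearization, ← Finset.add_sum_erase _ _ (Finset.mem_univ j), ← sq_abs]
    refine pow_le_pow_left₀ (abs_nonneg _) ?_ 2
    refine le_trans (le_of_eq ?_) ((abs_add_le _ _).trans (add_le_add k1 k2))
    congr 1
    ring

omit hq in
theorem neighbourDist_score_le (hq : Measurable q) (n : ℕ) : neighbourDist μ (score μ q) n ≤ n := by
  refine integral_le_const (bddMeasurable_adjSum_sectionDist (bddMeasurable_score hq) n) ?_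
  filter_upwards [ae_injective_of_noAtoms (ι := Fin n) μ] with x hx
  have := adjSum_le_card_mul (s := Finset.univ) hx zero_le_one
    (F := fun i k => sectionDist (score μ q) (x i) (x k)) fun i k =>
    integral_le_const (((bddMeasurable_section (bddMeasurable_score hq) (x i)).sub
      (bddMeasurable_section (bddMeasurable_score hq) (x k))).abs)
      (Eventually.of_forall fun u => abs_sub_le_one (score_nonneg _) (score_le_one hq _)
        (score_nonneg _) (score_le_one hq _))
  simpa using this

omit [NullSingletonClass μ] in
theorem bddMeasurable_neighbourVariation_div (n : ℕ) :
    BddMeasurable fun z : Fin n → ℝ × I => neighbourVariation q z / n := by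
  simpa [div_eq_inv_mul] using (bddMeasurable_neighbourVariation hq n).const_mul (n : ℝ)⁻¹

/-- The crude bound $\mathrm{neighbourDist}\le n$ suffices here. The resulting order $n$ gives
$\mathrm{varXi}(m)=O(1/m)$ in the continuous case, and the tightness needed for rescaling. -/
theorem exists_variance_neighbourVariation_le : ∃ K : ℝ, 0 ≤ K ∧ ∀ n : ℕ, 0 < n →
    ∫ z : Fin n → ℝ × I, (neighbourVariation q z / n -
      ∫ w : Fin n → ℝ × I, neighbourVariation q w / n ∂(iid (Fin n) (joint μ))) ^ 2
      ∂(iid (Fin n) (joint μ)) ≤ K * n := by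
  obtain ⟨K, hK0, hK⟩ := exists_variance_linearization_le (μ := μ) hq
  refine ⟨29200 + 2 * K, by positivity, fun n hn => ?_⟩
  set P := iid (Fin n) (joint μ)
  have hL := bddMeasurable_linearization (μ := μ) hq n
  have hV := bddMeasurable_neighbourVariation_div hq n
  have h1 := variance_neighbourVariation_sub_le (μ := μ) hq hn
  have h2 := neighbourDist_score_le (μ := μ) hq n
  have hn1 : (1 : ℝ) ≤ n := by exact_mod_cast hn
  rw [integral_sub (hV.integrable _) (hL.integrable _)] at h1
  set mV := ∫ w : Fin n → ℝ × I, neighbourVariation q w / n ∂P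
  set mL := ∫ w : Fin n → ℝ × I, linearization μ q w ∂P
  have b1 := ((hV.sub hL).sub_const (mV - mL)).pow 2
  have b2 := (hL.sub_const mL).pow 2
  calc _ ≤ ∫ z, (2 * (neighbourVariation q z / n - linearization μ q z - (mV - mL)) ^ 2 +
        2 * (linearization μ q z - mL) ^ 2) ∂P := by
        refine integral_mono_bdd ((hV.sub_const mV).pow 2) ((b1.const_mul 2).add (b2.const_mul 2))
          (Eventually.of_forall fun z => ?_)
        nlinarith [sq_nonneg ((neighbourVariation q z / n - linearization μ q z - (mV - mL)) -
          (linearization μ q z - mL))]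
    _ ≤ _ := by
        rw [integral_add ((b1.const_mul 2).integrable _) ((b2.const_mul 2).integrable _),
          integral_const_mul, integral_const_mul]
        have := hK n
        nlinarith

/-- The normalized variation and its linearization differ in $L^2$ by a quantity whose square is
$O(1/n+\mathrm{neighbourDist}/n)\to0$, and $x\mapsto e^{itx}$ is $|t|$-Lipschitz. -/
theorem tendsto_integral_cis_neighbourVariation (t : ℝ) :
    Tendsto (fun n : ℕ => ∫ z : Fin n → ℝ × I, cis (t * ((√n)⁻¹ * (neighbourVariation q z / n -
      ∫ w : Fin n → ℝ × I, neighbourVariation q w / n ∂(iid (Fin n) (joint μ)))))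
      ∂(iid (Fin n) (joint μ))) atTop (𝓝 (Complex.exp (-(limitVariance μ q * t ^ 2 / 2 : ℝ)))) := by
  obtain ⟨K, hK⟩ := exists_norm_integral_cis_linearization_sub_le (μ := μ) hq t
  have hpb : BddMeasurable (score μ q) := bddMeasurable_score hq
  rw [tendsto_iff_norm_sub_tendsto_zero]
  have hbound : Tendsto (fun n : ℕ => |t| * √(7300 * (1 / n + neighbourDist μ (score μ q) n / n)) +
      K / √n) atTop (𝓝 0) := by
    have h1 : Tendsto (fun n : ℕ => (1 : ℝ) / n) atTop (𝓝 0) := tendsto_one_div_atTop_nhds_zero_nat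
    have h2 := tendsto_neighbourDist μ hpb
    have h3 : Tendsto (fun n : ℕ => K / √(n : ℝ)) atTop (𝓝 0) :=
      (Real.tendsto_sqrt_atTop.comp tendsto_natCast_atTop_atTop).const_div_atTop K
    have h4 := ((((h1.add h2).const_mul 7300).sqrt).const_mul |t|).add h3
    simpa using h4
  refine squeeze_zero' (Eventually.of_forall fun n => norm_nonneg _) ?_ hbound
  filter_upwards [eventually_gt_atTop 0] with n hn
  set P := iid (Fin n) (joint μ)
  have hn' : (0 : ℝ) < n := by exact_mod_cast hn
  have hs : 0 < √(n : ℝ) := Real.sqrt_pos.mpr hn'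
  have hL := bddMeasurable_linearization (μ := μ) hq n
  have hV := bddMeasurable_neighbourVariation_div hq n
  have h1 := variance_neighbourVariation_sub_le (μ := μ) hq hn
  rw [integral_sub (hV.integrable _) (hL.integrable _), integral_linearization hq] at h1
  set mV := ∫ w : Fin n → ℝ × I, neighbourVariation q w / n ∂P
  set m := ∫ x, pointMean μ q x ∂μ
  let W : (Fin n → ℝ × I) → ℝ := fun z => (√n)⁻¹ * (neighbourVariation q z / n - mV)
  let L : (Fin n → ℝ × I) → ℝ := fun z => (√n)⁻¹ * (linearization μ q z - n * m)
  have hW : BddMeasurable W := (hV.sub_const mV).const_mul _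
  have hLb : BddMeasurable L := (hL.sub_const _).const_mul _
  have iW : Integrable (fun z => cis (t * W z)) P :=
    integrable_of_norm_le _ (measurable_cis.comp (hW.measurable.const_mul t)) fun z => (norm_cis _).le
  have iL : Integrable (fun z => cis (t * L z)) P :=
    integrable_of_norm_le _ (measurable_cis.comp (hLb.measurable.const_mul t)) fun z => (norm_cis _).le
  have h2 : ‖∫ z, cis (t * W z) ∂P - ∫ z, cis (t * L z) ∂P‖ ≤
      |t| * √(7300 * (1 / n + neighbourDist μ (score μ q) n / n)) := by
    have hb := hW.sub hLb
    rw [← integral_sub iW iL]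
    calc _ ≤ ∫ z, |t| * |W z - L z| ∂P :=
          norm_integral_le_of_norm_le ((hb.abs.const_mul _).integrable _)
            (Eventually.of_forall fun z => (norm_cis_sub_cis_le _ _).trans (le_of_eq (by
              rw [← mul_sub, abs_mul])))
      _ = |t| * ∫ z, |W z - L z| ∂P := integral_const_mul _ _
      _ ≤ |t| * √(∫ z, (W z - L z) ^ 2 ∂P) :=
          mul_le_mul_of_nonneg_left (abs_integral_le_sqrt P hb) (abs_nonneg _)
      _ ≤ _ := by
          refine mul_le_mul_of_nonneg_left (Real.sqrt_le_sqrt ?_) (abs_nonneg _)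
          have e : ∀ z, (W z - L z) ^ 2 = (n : ℝ)⁻¹ * (neighbourVariation q z / n -
              linearization μ q z - (mV - n * m)) ^ 2 := fun z => by
            have : ((√(n : ℝ))⁻¹) ^ 2 = (n : ℝ)⁻¹ := by rw [inv_pow, Real.sq_sqrt hn'.le]
            rw [← this, ← mul_pow]
            simp only [W, L]; ring
          simp_rw [e]
          rw [integral_const_mul]
          calc _ ≤ (n : ℝ)⁻¹ * (7300 * (1 + neighbourDist μ (score μ q) n)) :=
                mul_le_mul_of_nonneg_left h1 (inv_nonneg.mpr hn'.le)
            _ = _ := by ring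
  calc _ ≤ ‖∫ z, cis (t * W z) ∂P - ∫ z, cis (t * L z) ∂P‖ +
        ‖∫ z, cis (t * L z) ∂P - Complex.exp (-(limitVariance μ q * t ^ 2 / 2 : ℝ))‖ :=
        norm_sub_le_norm_sub_add_norm_sub _ _ _
    _ ≤ _ := add_le_add h2 (hK n hn)

/-- The normalized variation is asymptotically normal, also after a rescaling. -/
theorem tendsto_integral_cis_mul_neighbourVariation {a : ℕ → ℝ} {b : ℝ}
    (ha : Tendsto a atTop (𝓝 b)) (t : ℝ) :
    Tendsto (fun n : ℕ => ∫ z : Fin n → ℝ × I, cis (t * (a n * ((√n)⁻¹ * (neighbourVariation q z / n -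
      ∫ w : Fin n → ℝ × I, neighbourVariation q w / n ∂(iid (Fin n) (joint μ))))))
      ∂(iid (Fin n) (joint μ))) atTop
      (𝓝 (Complex.exp (-(b ^ 2 * limitVariance μ q * t ^ 2 / 2 : ℝ)))) := by
  obtain ⟨K, hK0, hK⟩ := exists_variance_neighbourVariation_le (μ := μ) hq
  have h1 := tendsto_integral_cis_neighbourVariation (μ := μ) hq (t * b)
  have e : limitVariance μ q * (t * b) ^ 2 / 2 = b ^ 2 * limitVariance μ q * t ^ 2 / 2 := by ring
  rw [e] at h1
  refine (tendsto_iff_of_dist ?_).mp h1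
  have hbound : Tendsto (fun n => |t| * |a n - b| * √K) atTop (𝓝 0) := by
    have h2 : Tendsto (fun n => |a n - b|) atTop (𝓝 0) := by
      simpa using (ha.sub_const b).abs
    simpa using (h2.const_mul |t|).mul_const √K
  refine squeeze_zero' (Eventually.of_forall fun n => dist_nonneg) ?_ hbound
  filter_upwards [eventually_gt_atTop 0] with n hn
  set P := iid (Fin n) (joint μ)
  have hn' : (0 : ℝ) < n := by exact_mod_cast hn
  have hV := bddMeasurable_neighbourVariation_div hq n
  set mV := ∫ w : Fin n → ℝ × I, neighbourVariation q w / n ∂P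
  let W : (Fin n → ℝ × I) → ℝ := fun z => (√n)⁻¹ * (neighbourVariation q z / n - mV)
  have hW : BddMeasurable W := (hV.sub_const mV).const_mul _
  have i1 : ∀ c : ℝ, Integrable (fun z => cis (c * W z)) P := fun c =>
    integrable_of_norm_le _ (measurable_cis.comp (hW.measurable.const_mul c)) fun z => (norm_cis _).le
  have hE : ∫ z, |W z| ∂P ≤ √K := by
    refine (abs_integral_le_sqrt P hW).trans (Real.sqrt_le_sqrt ?_)
    have : ((√(n : ℝ))⁻¹) ^ 2 = (n : ℝ)⁻¹ := by rw [inv_pow, Real.sq_sqrt hn'.le]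
    simp only [W, mul_pow, this]
    rw [integral_const_mul, inv_mul_le_iff₀ hn', mul_comm]
    exact hK n hn
  have e2 : ∀ z, cis (t * (a n * W z)) = cis ((t * a n) * W z) := fun z => by rw [mul_assoc]
  change dist (∫ z, cis (t * b * W z) ∂P) (∫ z, cis (t * (a n * W z)) ∂P) ≤ _
  simp_rw [e2]
  rw [dist_eq_norm, ← integral_sub (i1 _) (i1 _)]
  calc _ ≤ ∫ z, |t| * |a n - b| * |W z| ∂P :=
        norm_integral_le_of_norm_le ((hW.abs.const_mul _).integrable _)
          (Eventually.of_forall fun z => (norm_cis_sub_cis_le _ _).trans (le_of_eq (by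
            rw [← sub_mul, ← mul_sub, abs_mul, abs_mul, abs_sub_comm])))
    _ = |t| * |a n - b| * ∫ z, |W z| ∂P := integral_const_mul _ _
    _ ≤ _ := mul_le_mul_of_nonneg_left hE (by positivity)

end Model

end RankBootstrap

namespace RankBootstrap

open unitInterval

/-! ### Positivity of the asymptotic variance -/

/-- If `|p u - p v|` splits into a sum of functions of `u` and `v`, then `p` is constant. -/
theorem ae_eq_integral_of_abs_sub_eq_add {E : Type*} [MeasurableSpace E] {ν : Measure E}
    [IsProbabilityMeasure ν] {p b : E → ℝ} (hp : BddMeasurable p)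
    (h : ∀ᵐ u ∂ν, ∀ᵐ v ∂ν, |p u - p v| = b u + b v) : ∀ᵐ u ∂ν, p u = ∫ v, p v ∂ν := by
  set c := ∫ v, p v ∂ν with hc
  have hi : Integrable (fun v => p v - c) ν := (hp.integrable ν).sub (integrable_const _)
  have h0 : ∫ v, (p v - c) ∂ν = 0 := by
    rw [integral_sub (hp.integrable ν) (integrable_const _)]; simp [hc]
  have hA : (∃ᵐ u ∂ν, p u ≤ c) := by
    by_contra hcon
    rw [not_frequently] at hcon
    have h1 : 0 ≤ᵐ[ν] fun v => p v - c := by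
      filter_upwards [hcon] with u hu
      simp only [Pi.zero_apply]; linarith
    have h2 := (integral_eq_zero_iff_of_nonneg_ae h1 hi).mp h0
    have h3 : ∀ᵐ u ∂ν, False := by
      filter_upwards [h2, hcon] with u hu hu'
      simp only [Pi.zero_apply] at hu
      linarith
    exact h3.exists.elim fun _ h => h
  have hB : ¬ (∃ᵐ u ∂ν, c < p u) := by
    intro hB
    -- Take $u,u'$ with $p\le c$ and $v,v'$ with $p>c$ such that the identity holds for the pairs
    -- used. Adding the mixed identities for $(u,v)$ and $(u',v')$ and subtracting those for
    -- $(u,u')$ and $(v,v')$ eliminates $b$ and yields $\min(p(v),p(v'))=\max(p(u),p(u'))$, which is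
    -- impossible.
    obtain ⟨u, hu, hGu⟩ := (hA.and_eventually h).exists
    obtain ⟨v, hv, hGv, huv⟩ := (hB.and_eventually (h.and hGu)).exists
    obtain ⟨u', hu', hGu', huu'⟩ := (hA.and_eventually (h.and hGu)).exists
    obtain ⟨v', hv', hvv', hu'v'⟩ := (hB.and_eventually (hGv.and hGu')).exists
    rw [abs_of_neg (by linarith)] at huv hu'v'
    rcases abs_cases (p u - p u') with ⟨h1, -⟩ | ⟨h1, -⟩ <;>
    rcases abs_cases (p v - p v') with ⟨h2, -⟩ | ⟨h2, -⟩ <;>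
    linarith
  rw [not_frequently] at hB
  have h1 : 0 ≤ᵐ[ν] fun v => c - p v := by
    filter_upwards [hB] with u hu
    simp only [Pi.zero_apply]; linarith
  have h2 : ∫ v, (c - p v) ∂ν = 0 := by
    rw [← neg_eq_zero, ← integral_neg]; simpa using h0
  have h3 := (integral_eq_zero_iff_of_nonneg_ae h1 ((integrable_const _).sub (hp.integrable ν))).mp h2
  filter_upwards [h3] with u hu
  simp only [Pi.zero_apply] at hu
  linarith

/-- Almost surely `Y` is a function of `F (Y)`, for the distribution function `F` of `Y`. -/
theorem exists_quantile (ν : Measure ℝ) [IsProbabilityMeasure ν] :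
    ∃ Q : ℝ → ℝ, Measurable Q ∧ ∀ᵐ y ∂ν, Q (ν.real (Set.Iic y)) = y := by
  let F : ℝ → ℝ := fun y => ν.real (Set.Iic y)
  have hF : Monotone F := fun a b hab => measureReal_mono (Set.Iic_subset_Iic.mpr hab)
  -- Extended real values keep $Q$ a monotone, hence measurable, supremum even where the set of $r$
  -- is empty or unbounded.
  let Q : ℝ → EReal := fun s => sSup {e : EReal | ∃ r : ℝ, F r < s ∧ e = r}
  have hQ : Monotone Q := fun s s' h => sSup_le_sSup fun e ⟨r, hr, he⟩ => ⟨r, hr.trans_le h, he⟩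
  refine ⟨fun s => (Q s).toReal, hQ.measurable.ereal_toReal, ?_⟩
  have hioc : ∀ r y : ℝ, r ≤ y → F y = F r → ν (Set.Ioc r y) = 0 := fun r y hry h => by
    have h1 : Set.Ioc r y = Set.Iic y \ Set.Iic r := by ext; simp [and_comm]
    have h2 : ν.real (Set.Ioc r y) = 0 := by
      rw [h1, measureReal_sdiff (Set.Iic_subset_Iic.mpr hry) measurableSet_Iic]
      change F y - F r = 0
      rw [h, sub_self]
    exact (measureReal_eq_zero_iff).mp h2
  -- A flat stretch of $F$ to the right of $r$ is covered locally by null intervals $(r,y']$; if it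
  -- has a largest point, the neighbourhood is taken within the stretch.
  have hnull : ∀ r : ℝ, ν {y | r < y ∧ F y = F r} = 0 := fun r => by
    refine measure_null_of_locally_null _ fun y hy => ?_
    by_cases hmax : ∀ y' ∈ {y | r < y ∧ F y = F r}, y' ≤ y
    · refine ⟨Set.Ioc r y, ?_, hioc r y hy.1.le hy.2⟩
      exact mem_of_superset self_mem_nhdsWithin fun y' hy' => ⟨hy'.1, hmax y' hy'⟩
    · push Not at hmax
      obtain ⟨y', hy', hlt⟩ := hmax
      exact ⟨Set.Ioc r y', mem_nhdsWithin_of_mem_nhds (Ioc_mem_nhds hy.1 hlt),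
        hioc r y' hy'.1.le hy'.2⟩
  -- Rational $r$ suffice, since a rational can be inserted below $y$. For such $y$, $F(r)<F(y)$
  -- exactly when $r<y$, so the supremum recovers $y$.
  have hgood : ∀ᵐ y ∂ν, ∀ r : ℚ, ¬ ((r : ℝ) < y ∧ F y = F r) := by
    rw [ae_all_iff]
    exact fun r => by simpa [ae_iff] using hnull r
  filter_upwards [hgood] with y hy
  have hiff : ∀ r : ℝ, F r < F y ↔ r < y := fun r => by
    constructor
    · intro h; by_contra hcon; exact absurd (hF (not_lt.mp hcon)) (not_le.mpr h)
    · intro h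
      obtain ⟨s, hs1, hs2⟩ := exists_rat_btwn h
      refine lt_of_le_of_lt (hF hs1.le) (lt_of_le_of_ne (hF hs2.le) fun e => hy s ⟨hs2, e.symm⟩)
  have hlub : IsLUB {e : EReal | ∃ r : ℝ, F r < F y ∧ e = r} (y : EReal) := by
    refine ⟨?_, fun b hb => ?_⟩
    · rintro e ⟨r, hr, rfl⟩
      exact EReal.coe_le_coe_iff.mpr ((hiff r).mp hr).le
    · by_contra hcon
      obtain ⟨r, h1, h2⟩ := EReal.lt_iff_exists_real_btwn.mp (not_le.mp hcon)
      exact absurd (hb ⟨r, (hiff r).mpr (EReal.coe_lt_coe_iff.mp h2), rfl⟩) (not_le.mpr h1)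
  change (Q (F y)).toReal = y
  rw [show Q (F y) = (y : EReal) from hlub.sSup_eq]
  rfl

section Model

variable {μ : Measure ℝ} {q : ℝ × I → ℝ} [IsProbabilityMeasure μ] (hq : Measurable q)
include hq

/-- The interaction part alone must be positive. If it vanished, almost every section of the score
would be constant, so that $F(Y)=g(X)$, and the quantile function would give $Y=Q(g(X))$. -/
theorem limitVariance_pos
    (hf : ¬ ∃ f : ℝ → ℝ, Measurable f ∧ ∀ᵐ w ∂(joint μ), q w = f w.1) :
    0 < limitVariance μ q := by
  by_contra hcon
  apply hf
  have := isProbabilityMeasure_lawY (μ := μ) hq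
  have hpb : BddMeasurable (score μ q) := bddMeasurable_score hq
  have hD := bddMeasurable_interactionVariance (μ := μ) hq
  have h1 : ∫ x, (∫ w : I × I, pairInteraction (score μ q) x w.1 w.2 ^ 2) ∂μ = 0 := by
    refine le_antisymm ?_ (integral_nonneg fun x => integral_nonneg fun w => sq_nonneg _)
    have h2 : ∫ x, (∫ w : I × I, pairInteraction (score μ q) x w.1 w.2 ^ 2) ∂μ ≤
        ∫ x, sectionVariance μ q x ∂μ :=
      integral_mono_bdd hD (bddMeasurable_sectionVariance hq) (Eventually.of_forall fun x =>
        le_add_of_nonneg_right (integral_nonneg fun _ => sq_nonneg _))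
    have h3 : 0 ≤ ∫ x, (pointMean μ q x - ∫ x, pointMean μ q x ∂μ) ^ 2 ∂μ :=
      integral_nonneg fun _ => sq_nonneg _
    unfold limitVariance at hcon
    linarith
  have h2 : ∀ᵐ x ∂μ, ∀ᵐ u : I, score μ q (x, u) = ∫ v : I, score μ q (x, v) := by
    have h3 := (integral_eq_zero_iff_of_nonneg (fun x => integral_nonneg fun w => sq_nonneg _)
      (hD.integrable μ)).mp h1
    filter_upwards [h3] with x hx
    have hdx : BddMeasurable fun w : I × I => pairInteraction (score μ q) x w.1 w.2 :=
      (bddMeasurable_pairInteraction hpb).comp (φ := fun w : I × I => (x, w)) (by fun_prop)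
    have h4 := (integral_eq_zero_iff_of_nonneg (fun w => sq_nonneg _)
      ((hdx.pow 2).integrable (volume : Measure (I × I)))).mp hx
    rw [Measure.volume_eq_prod] at h4
    refine ae_eq_integral_of_abs_sub_eq_add (bddMeasurable_section hpb x)
      (b := fun u => scatter (score μ q) (x, u) - meanScatter (score μ q) x / 2) ?_
    filter_upwards [Measure.ae_ae_of_ae_prod h4] with u hu
    filter_upwards [hu] with v hv
    have hv0 : pairInteraction (score μ q) x u v = 0 := by simpa using hv
    unfold pairInteraction at hv0
    rw [abs_sub_comm] at hv0
    linarith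
  obtain ⟨Q, hQm, hQ⟩ := exists_quantile (lawY μ q)
  let g : ℝ → ℝ := fun x => ∫ v : I, score μ q (x, v)
  have hg : BddMeasurable g :=
    .integral_right (F := fun (x : ℝ) (v : I) => score μ q (x, v)) hpb _
  refine ⟨fun x => Q (g x), hQm.comp hg.measurable, ?_⟩
  have h5 : ∀ᵐ w ∂(joint μ), score μ q w = g w.1 := by
    refine (Measure.ae_prod_iff_ae_ae (p := fun w : ℝ × I => score μ q w = g w.1)
      (measurableSet_eq_fun hpb.measurable (hg.measurable.comp measurable_fst))).mpr ?_
    exact h2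
  have h6 : ∀ᵐ w ∂(joint μ), Q ((lawY μ q).real (Set.Iic (q w))) = q w :=
    ae_of_ae_map hq.aemeasurable hQ
  filter_upwards [h5, h6] with w hw hw'
  rw [← hw]
  exact hw'.symm

end Model

end RankBootstrap

namespace RankBootstrap

open unitInterval

/-! ### Chatterjee's rank correlation as a statistic of the sample -/

section Pattern

variable {n : ℕ}

/-- The relative order of the coordinates of the points of a sample. -/
def orderPattern (z : Fin n → ℝ × ℝ) : Fin n → Fin n → Prop × Prop :=
  fun i j => ((z i).1 ≤ (z j).1, (z i).2 ≤ (z j).2)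

theorem measurable_orderPattern : Measurable (orderPattern (n := n)) := by
  refine measurable_pi_lambda _ fun i => measurable_pi_lambda _ fun j => ?_
  exact (measurableSet_setOfPred.mp (measurableSet_le (by fun_prop) (by fun_prop))).prodMk
    (measurableSet_setOfPred.mp (measurableSet_le (by fun_prop) (by fun_prop)))

/-- A statistic which depends on the relative order of the coordinates only takes finitely many
values, on measurable sets. -/
theorem bddMeasurable_of_orderPattern {f : (Fin n → ℝ × ℝ) → ℝ}
    (h : ∀ z z', orderPattern z = orderPattern z' → f z = f z') : BddMeasurable f := by
  obtain ⟨e, rfl⟩ := (Function.factorsThrough_iff f (f := orderPattern (n := n))).mp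
    fun z z' hz => h z z' hz
  have he : Measurable e := measurable_of_finite e
  obtain ⟨C, hC⟩ := (Set.finite_range fun a => |e a|).bddAbove
  exact ⟨he.comp measurable_orderPattern, C, fun z => hC ⟨_, rfl⟩⟩

theorem orderPattern_eq_iff {z z' : Fin n → ℝ × ℝ} : orderPattern z = orderPattern z' ↔
    ∀ i j, ((z i).1 ≤ (z j).1 ↔ (z' i).1 ≤ (z' j).1) ∧ ((z i).2 ≤ (z j).2 ↔ (z' i).2 ≤ (z' j).2) := by
  simp only [funext_iff, orderPattern, Prod.mk.injEq, eq_iff_iff]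

/-- The sorting permutation is determined by comparisons of the keys, and these involve the
$x$-coordinates only through their relative order. -/
theorem ordering_congr {z z' : Fin n → ℝ × ℝ} (h : orderPattern z = orderPattern z')
    (ρ : Equiv.Perm (Fin n)) : ordering z ρ = ordering z' ρ := by
  rw [orderPattern_eq_iff] at h
  have h1 : ∀ i j, (z i).1 ≤ (z j).1 ↔ (z' i).1 ≤ (z' j).1 := fun i j => (h i j).1
  have h2 : ∀ i j, (z i).1 = (z j).1 ↔ (z' i).1 = (z' j).1 := fun i j => by
    rw [le_antisymm_iff, le_antisymm_iff, h1, h1]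
  have h3 : ∀ i j, (z i).1 < (z j).1 ↔ (z' i).1 < (z' j).1 := fun i j => by
    rw [← not_le, ← not_le, h1]
  unfold ordering
  rw [Tuple.eq_sort_iff]
  have h4 := Tuple.eq_sort_iff.mp (Eq.refl (Tuple.sort fun i => toLex ((z i).1, ρ i)))
  refine ⟨fun i j hij => ?_, fun i j hij he => h4.2 i j hij ?_⟩
  · have := h4.1 hij
    simp only [Function.comp_apply, Prod.Lex.toLex_le_toLex] at this ⊢
    rwa [← h2, ← h3]
  · simp only [toLex_inj, Prod.mk.injEq] at he ⊢
    rwa [h2]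

theorem xi_congr {z z' : Fin n → ℝ × ℝ} (h : orderPattern z = orderPattern z')
    (ρ : Equiv.Perm (Fin n)) : xi z ρ = xi z' ρ := by
  classical
  have ho := ordering_congr h ρ
  rw [orderPattern_eq_iff] at h
  have h1 : ∀ i j, rearrangedY z ρ i ≤ rearrangedY z ρ j ↔
      rearrangedY z' ρ i ≤ rearrangedY z' ρ j := fun i j => by
    unfold rearrangedY; rw [ho]; exact (h _ _).2
  have h2 : ∀ i j, rearrangedY z ρ i = rearrangedY z ρ j ↔
      rearrangedY z' ρ i = rearrangedY z' ρ j := fun i j => by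
    rw [le_antisymm_iff, le_antisymm_iff, h1, h1]
  have hl : lowerRank (rearrangedY z ρ) = lowerRank (rearrangedY z' ρ) := by
    ext i; unfold lowerRank; simp_rw [h1]
  have hu : upperRank (rearrangedY z ρ) = upperRank (rearrangedY z' ρ) := by
    ext i; unfold upperRank; simp_rw [h1]
  have hi : Function.Injective (rearrangedY z ρ) ↔ Function.Injective (rearrangedY z' ρ) := by
    unfold Function.Injective; simp_rw [h2]
  unfold xi rankVariation
  simp only [hl, hu, hi]

theorem bddMeasurable_xi (ρ : Equiv.Perm (Fin n)) : BddMeasurable fun z : Fin n → ℝ × ℝ => xi z ρ :=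
  bddMeasurable_of_orderPattern fun _ _ h => xi_congr h ρ

instance : DiscreteMeasurableSpace (Equiv.Perm (Fin n)) := ⟨fun _ => trivial⟩

instance {m : ℕ} : DiscreteMeasurableSpace (Fin m ↪ Fin n) := ⟨fun _ => trivial⟩

theorem bddMeasurable_xi_uncurry :
    BddMeasurable fun v : (Fin n → ℝ × ℝ) × Equiv.Perm (Fin n) => xi v.1 v.2 := by
  choose C hC using fun ρ : Equiv.Perm (Fin n) => (bddMeasurable_xi ρ).bdd
  refine ⟨measurable_from_prod_countable_left fun ρ => (bddMeasurable_xi ρ).measurable,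
    ∑ ρ, |C ρ|, fun v => (hC v.2 v.1).trans ((le_abs_self _).trans
      (Finset.single_le_sum (f := fun ρ => |C ρ|) (fun _ _ => abs_nonneg _) (Finset.mem_univ _)))⟩

end Pattern

theorem strictMono_ordering {n : ℕ} {z : Fin n → ℝ × ℝ} (hz : Function.Injective fun i => (z i).1)
    (ρ : Equiv.Perm (Fin n)) : StrictMono fun i => (z (ordering z ρ i)).1 := by
  have h1 : Monotone fun i => (z (ordering z ρ i)).1 := fun i j hij => by
    have := Tuple.monotone_sort (fun i => toLex ((z i).1, ρ i)) hij
    simp only [Function.comp_apply, Prod.Lex.toLex_le_toLex] at this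
    rcases this with h | h
    · exact h.le
    · exact h.1.le
  exact h1.strictMono_of_injective (hz.comp (ordering z ρ).injective)

theorem lowerRank_rearrangedY {n : ℕ} (z : Fin n → ℝ × ℝ) (ρ : Equiv.Perm (Fin n)) (i : Fin n) :
    (lowerRank (rearrangedY z ρ) i : ℝ) = ∑ l, step (z l).2 (z (ordering z ρ i)).2 := by
  classical
  unfold lowerRank
  rw [Finset.card_filter]
  push_cast
  rw [← Equiv.sum_comp (ordering z ρ) fun l => step (z l).2 (z (ordering z ρ i)).2]
  rfl

/-- Without ties, the rank correlation is an affine function of the total variation of the ranks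
of neighbours, and does not depend on the tie-breaking. -/
theorem xi_eq_neighbourVariation {q : ℝ × I → ℝ} {n : ℕ} {w : Fin n → ℝ × I}
    (hx : Function.Injective fun i => (w i).1) (hy : Function.Injective fun i => q (w i))
    (ρ : Equiv.Perm (Fin n)) :
    xi (fun i => ((w i).1, q (w i))) ρ = 1 - 3 * neighbourVariation q w / ((n : ℝ) ^ 2 - 1) := by
  set z : Fin n → ℝ × ℝ := fun i => ((w i).1, q (w i)) with hz
  have h1 : Function.Injective (rearrangedY z ρ) := hy.comp (ordering z ρ).injective
  have h2 : rankVariation (rearrangedY z ρ) = neighbourVariation q w := by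
    unfold rankVariation neighbourVariation
    rw [adjSum_eq_sum_sorted _ (ordering z ρ) (strictMono_ordering (z := z) hx ρ)]
    refine Finset.sum_congr rfl fun i _ => ?_
    rw [lowerRank_rearrangedY, lowerRank_rearrangedY]
    rfl
  simp only [xi, if_pos h1, h2]

section Law

variable {Ω : Type*} [MeasurableSpace Ω] {P : Measure Ω} [IsProbabilityMeasure P]
  {X Y : ℕ → Ω → ℝ}

theorem measurable_sample (hX : ∀ k, Measurable (X k)) (hY : ∀ k, Measurable (Y k)) (n : ℕ) :
    Measurable (sample X Y n) :=
  measurable_pi_lambda _ fun i => (hX i).prodMk (hY i)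

variable (P X Y) in
/-- The law of a generic pair. -/
noncomputable def pairLaw : Measure (ℝ × ℝ) := P.map fun ω => (X 0 ω, Y 0 ω)

variable (hX : ∀ k, Measurable (X k)) (hY : ∀ k, Measurable (Y k))
include hX hY

theorem isProbabilityMeasure_pairLaw : IsProbabilityMeasure (pairLaw P X Y) :=
  Measure.isProbabilityMeasure_map ((hX 0).prodMk (hY 0)).aemeasurable

variable (hindep : iIndepFun (fun k ω => (X k ω, Y k ω)) P)
  (hident : ∀ k, IdentDistrib (fun ω => (X k ω, Y k ω)) (fun ω => (X 0 ω, Y 0 ω)) P P)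
include hindep hident

theorem map_sample (n : ℕ) : P.map (sample X Y n) = iid (Fin n) (pairLaw P X Y) := by
  have h1 : iIndepFun (fun (i : Fin n) ω => (X i ω, Y i ω)) P :=
    hindep.precomp (g := fun i : Fin n => (i : ℕ)) Fin.val_injective
  have h2 := (iIndepFun_iff_map_fun_eq_pi_map
    (fun i : Fin n => ((hX i).prodMk (hY i)).aemeasurable)).mp h1
  change P.map (fun ω (i : Fin n) => (X i ω, Y i ω)) = _
  rw [h2]
  congr 1
  ext1 i
  exact (hident i).map_eq

theorem integral_sampleMeasure {G : Type*} [NormedAddCommGroup G] [NormedSpace ℝ G]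
    [SecondCountableTopology G] [MeasurableSpace G] [BorelSpace G] {n : ℕ}
    {f : (Fin n → ℝ × ℝ) → Equiv.Perm (Fin n) → G} (hf : Measurable (Function.uncurry f))
    {C : ℝ} (hC : ∀ z ρ, ‖f z ρ‖ ≤ C) :
    ∫ p, f (sample X Y n p.1) p.2 ∂(sampleMeasure P n) =
      ∫ z, ∫ ρ, f z ρ ∂(tieMeasure n) ∂(iid (Fin n) (pairLaw P X Y)) := by
  have := isProbabilityMeasure_pairLaw (P := P) hX hY
  have hs := measurable_sample hX hY n
  have h1 : (sampleMeasure P n).map (Prod.map (sample X Y n) id) =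
      (iid (Fin n) (pairLaw P X Y)).prod (tieMeasure n) := by
    rw [← map_sample hX hY hindep hident n, sampleMeasure,
      ← Measure.map_prod_map _ _ hs measurable_id, Measure.map_id]
  rw [integral_integral (f := f) (Integrable.of_bound hf.aestronglyMeasurable C
    (Eventually.of_forall fun v => hC _ _)), ← h1,
    integral_map (hs.prodMap measurable_id).aemeasurable (by
      exact (hf.aestronglyMeasurable))]
  rfl

end Law

end RankBootstrap

namespace RankBootstrap

open unitInterval

/-! ### Asymptotic normality -/

/-- Disintegrate over the first coordinate and realize the conditional law as the image of the
uniform law on the unit interval, measurably in $x$. -/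
theorem exists_representation (l : Measure (ℝ × ℝ)) [IsProbabilityMeasure l] :
    ∃ q : ℝ × I → ℝ, Measurable q ∧ l = (joint l.fst).map fun w => (w.1, q w) := by
  obtain ⟨f, hf, hfκ⟩ := l.condKernel.exists_measurable_map_eq_unitInterval
  have hm : Measurable fun w : ℝ × I => (w.1, f w.1 w.2) := measurable_fst.prodMk hf
  refine ⟨fun w => f w.1 w.2, hf, ?_⟩
  conv_lhs => rw [← l.disintegrate l.condKernel]
  ext s hs
  rw [Measure.compProd_apply hs, Measure.map_apply hm hs, Measure.prod_apply (hm hs)]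
  refine lintegral_congr fun x => ?_
  have hfx : Measurable (f x) := hf.comp measurable_prodMk_left
  rw [← hfκ x, Measure.map_apply hfx (measurable_prodMk_left hs)]
  rfl

/-- Continuity of the joint distribution function in its first argument makes $P(U=a,V\le y)$ vanish
for each $y$; then $y\to\infty$ along the integers. -/
theorem measure_eq_of_continuous_cdf {Ω : Type*} [MeasurableSpace Ω] {P : Measure Ω}
    [IsProbabilityMeasure P] {U V : Ω → ℝ} (hU : Measurable U) (hV : Measurable V)
    (hc : Continuous fun p : ℝ × ℝ => P.real {ω | U ω ≤ p.1 ∧ V ω ≤ p.2}) (a : ℝ) :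
    P {ω | U ω = a} = 0 := by
  have hm : ∀ b y : ℝ, MeasurableSet {ω | U ω ≤ b ∧ V ω ≤ y} := fun b y =>
    (measurableSet_le hU measurable_const).inter (measurableSet_le hV measurable_const)
  have h1 : ∀ y : ℝ, P.real {ω | U ω = a ∧ V ω ≤ y} = 0 := fun y => by
    have hlim : Tendsto (fun b : ℝ => P.real {ω | U ω ≤ a ∧ V ω ≤ y} -
        P.real {ω | U ω ≤ b ∧ V ω ≤ y}) (𝓝[<] a) (𝓝 0) := by
      have hb : Continuous fun b : ℝ => P.real {ω | U ω ≤ b ∧ V ω ≤ y} :=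
        hc.comp (Continuous.prodMk_left y)
      have := ((hb.tendsto a).const_sub (P.real {ω | U ω ≤ a ∧ V ω ≤ y})).mono_left
        (nhdsWithin_le_nhds (s := Set.Iio a))
      rwa [sub_self] at this
    refine le_antisymm (ge_of_tendsto hlim ?_) measureReal_nonneg
    filter_upwards [self_mem_nhdsWithin] with b hb
    have hb : b < a := hb
    have hsub : {ω | U ω ≤ b ∧ V ω ≤ y} ⊆ {ω | U ω ≤ a ∧ V ω ≤ y} :=
      fun ω hω => ⟨hω.1.trans hb.le, hω.2⟩
    rw [← measureReal_sdiff hsub (hm b y)]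
    refine measureReal_mono fun ω hω => ⟨⟨hω.1.le, hω.2⟩, fun h => ?_⟩
    have := h.1
    rw [hω.1] at this
    exact absurd hb (not_lt.mpr this)
  have h2 : {ω | U ω = a} = ⋃ k : ℕ, {ω | U ω = a ∧ V ω ≤ k} := by
    ext ω
    simp only [Set.mem_ofPred_eq, Set.mem_iUnion]
    exact ⟨fun h => (exists_nat_ge (V ω)).imp fun k hk => ⟨h, hk⟩, fun ⟨k, hk⟩ => hk.1⟩
  rw [h2, measure_iUnion_null_iff]
  exact fun k => (measureReal_eq_zero_iff).mp (h1 k)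

section Sample

variable {Ω : Type*} [MeasurableSpace Ω] {P : Measure Ω} [IsProbabilityMeasure P]
  {X Y : ℕ → Ω → ℝ}

theorem iid_map {l : Measure (ℝ × ℝ)} {μ : Measure ℝ} [IsProbabilityMeasure μ] {q : ℝ × I → ℝ}
    (hq : Measurable q) (hl : l = (joint μ).map fun w => (w.1, q w)) (n : ℕ) :
    iid (Fin n) l = (iid (Fin n) (joint μ)).map fun w i => ((w i).1, q (w i)) := by
  have hm : Measurable fun w : ℝ × I => (w.1, q w) := measurable_fst.prodMk hq
  have : IsProbabilityMeasure ((joint μ).map fun w => (w.1, q w)) :=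
    Measure.isProbabilityMeasure_map hm.aemeasurable
  rw [hl]
  exact (Measure.pi_map_pi (μ := fun _ : Fin n => joint μ) (f := fun _ w => (w.1, q w))
    fun _ => hm.aemeasurable).symm

theorem ae_injective_snd {μ : Measure ℝ} [IsProbabilityMeasure μ] {q : ℝ × I → ℝ}
    (hq : Measurable q) [NullSingletonClass (lawY μ q)] (n : ℕ) :
    ∀ᵐ w ∂(iid (Fin n) (joint μ)), Function.Injective fun i => q (w i) := by
  have := isProbabilityMeasure_lawY (μ := μ) hq
  have h : Measure.map (fun (w : Fin n → ℝ × I) i => q (w i)) (iid (Fin n) (joint μ)) =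
      iid (Fin n) (lawY μ q) :=
    Measure.pi_map_pi (μ := fun _ : Fin n => joint μ) (f := fun _ w => q w)
      fun _ => hq.aemeasurable
  have h2 := ae_injective_of_noAtoms (ι := Fin n) (lawY μ q)
  rw [← h] at h2
  exact ae_of_ae_map (measurable_pi_lambda _ fun i =>
    hq.comp (measurable_pi_apply i)).aemeasurable h2

variable (hX : ∀ k, Measurable (X k)) (hY : ∀ k, Measurable (Y k))
  (hindep : iIndepFun (fun k ω => (X k ω, Y k ω)) P)
  (hident : ∀ k, IdentDistrib (fun ω => (X k ω, Y k ω)) (fun ω => (X 0 ω, Y 0 ω)) P P)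
include hX hY hindep hident

/-- Both marginals are free of atoms, so almost surely there are no ties, and the integral over the
tie-breaking is that of a constant. -/
theorem integral_comp_xiStat {μ : Measure ℝ} [IsProbabilityMeasure μ] [NullSingletonClass μ]
    {q : ℝ × I → ℝ} (hq : Measurable q) [NullSingletonClass (lawY μ q)]
    (hl : pairLaw P X Y = (joint μ).map fun w => (w.1, q w))
    {G : Type*} [NormedAddCommGroup G] [NormedSpace ℝ G] [CompleteSpace G]
    [SecondCountableTopology G] [MeasurableSpace G] [BorelSpace G] {g : ℝ → G} (hg : Measurable g)
    {n : ℕ} {C : ℝ} (hC : ∀ (z : Fin n → ℝ × ℝ) ρ, ‖g (xi z ρ)‖ ≤ C) :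
    ∫ p, g (xiStat X Y n p) ∂(sampleMeasure P n) =
      ∫ w : Fin n → ℝ × I, g (1 - 3 * neighbourVariation q w / ((n : ℝ) ^ 2 - 1))
        ∂(iid (Fin n) (joint μ)) := by
  have hgm : Measurable (Function.uncurry fun (z : Fin n → ℝ × ℝ) ρ => g (xi z ρ)) :=
    hg.comp bddMeasurable_xi_uncurry.measurable
  have h1 := integral_sampleMeasure hX hY hindep hident (f := fun z ρ => g (xi z ρ)) hgm hC
  have hm : Measurable fun (w : Fin n → ℝ × I) i => ((w i).1, q (w i)) :=
    measurable_pi_lambda _ fun i => ((measurable_pi_apply i).fst).prodMk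
      (hq.comp (measurable_pi_apply i))
  rw [iid_map hq hl, integral_map hm.aemeasurable (by
    exact (hgm.stronglyMeasurable.integral_prod_right (ν := tieMeasure n)).aestronglyMeasurable)] at h1
  refine h1.trans (integral_congr_ae ?_)
  filter_upwards [ae_injective_fst (ι := Fin n) (μ := μ), ae_injective_snd hq n] with w hw1 hw2
  simp [xi_eq_neighbourVariation hw1 hw2]

theorem measurable_xiStat (n : ℕ) : Measurable (xiStat X Y n) :=
  bddMeasurable_xi_uncurry.measurable.comp
    (((measurable_sample hX hY n).comp measurable_fst).prodMk measurable_snd)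

theorem TConvergesTo_of_representation {μ : Measure ℝ} [IsProbabilityMeasure μ]
    [NullSingletonClass μ] {q : ℝ × I → ℝ} (hq : Measurable q) [NullSingletonClass (lawY μ q)]
    (hl : pairLaw P X Y = (joint μ).map fun w => (w.1, q w)) {s : ℝ≥0}
    (hvar : ((s ^ 2 : ℝ≥0) : ℝ) = 9 * limitVariance μ q) : TConvergesTo P X Y s := by
  have hTm : ∀ n, Measurable (T P X Y n) := fun n =>
    ((measurable_xiStat hX hY hindep hident n).sub_const _).const_mul _
  refine ⟨fun n => (hTm n).aemeasurable, aemeasurable_id, ?_⟩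
  refine ProbabilityMeasure.tendsto_iff_tendsto_charFun.mpr fun t => ?_
  -- This is the factor between $T_n$ and the centred $V/n$ divided by $\sqrt n$; its limit explains
  -- the factor $9$ in `hvar`.
  have ha : Tendsto (fun n : ℕ => -3 * (n : ℝ) ^ 2 / ((n : ℝ) ^ 2 - 1)) atTop (𝓝 (-3)) := by
    have h1 : Tendsto (fun n : ℕ => 1 - ((n : ℝ) ^ 2)⁻¹) atTop (𝓝 1) := by
      have h2 : Tendsto (fun n : ℕ => ((n : ℝ) ^ 2)⁻¹) atTop (𝓝 0) :=
        ((tendsto_pow_atTop two_ne_zero).comp tendsto_natCast_atTop_atTop).inv_tendsto_atTop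
      simpa using h2.const_sub 1
    have h3 := (tendsto_const_nhds (x := (-3 : ℝ))).div h1 one_ne_zero
    rw [div_one] at h3
    refine h3.congr' ?_
    filter_upwards [eventually_gt_atTop 1] with n hn
    have hn1 : (1 : ℝ) < n := by exact_mod_cast hn
    have : (n : ℝ) ^ 2 - 1 ≠ 0 := by nlinarith
    simp only [Pi.div_apply]
    field_simp
  have key := tendsto_integral_cis_mul_neighbourVariation (μ := μ) hq ha t
  have hgauss : charFun ((gaussianReal 0 (s ^ 2)).map fun x : ℝ => x) t =
      Complex.exp (-((-3) ^ 2 * limitVariance μ q * t ^ 2 / 2 : ℝ)) := by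
    rw [Measure.map_id', charFun_gaussianReal]
    congr 1
    have : (((s ^ 2 : ℝ≥0) : ℝ) : ℂ) = ((9 * limitVariance μ q : ℝ) : ℂ) := by rw [hvar]
    rw [this]; push_cast; ring
  simp only [ProbabilityMeasure.coe_mk]
  rw [hgauss]
  refine key.congr' ?_
  filter_upwards [eventually_gt_atTop 1] with n hn
  have hn1 : (1 : ℝ) < n := by exact_mod_cast hn
  have hn0 : (n : ℝ) ^ 2 - 1 ≠ 0 := by nlinarith
  obtain ⟨C, hC⟩ := (bddMeasurable_xi_uncurry (n := n)).bdd
  have hE : ∫ p, xiStat X Y n p ∂(sampleMeasure P n) =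
      1 - 3 * (n * ∫ w : Fin n → ℝ × I, neighbourVariation q w / n ∂(iid (Fin n) (joint μ))) /
        ((n : ℝ) ^ 2 - 1) := by
    rw [integral_comp_xiStat hX hY hindep hident hq hl (g := fun x => x) measurable_id
      fun z ρ => hC (z, ρ)]
    have e : ∀ w : Fin n → ℝ × I, 1 - 3 * neighbourVariation q w / ((n : ℝ) ^ 2 - 1) =
        1 - 3 * n / ((n : ℝ) ^ 2 - 1) * (neighbourVariation q w / n) := fun w => by
      field_simp
    simp_rw [e]
    rw [integral_sub (integrable_const _)
      (((bddMeasurable_neighbourVariation_div hq n).const_mul _).integrable _),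
      integral_const_mul]
    simp only [integral_const, probReal_univ, smul_eq_mul, one_mul]
    ring
  set mV := ∫ w : Fin n → ℝ × I, neighbourVariation q w / n ∂(iid (Fin n) (joint μ))
  set m := ∫ p, xiStat X Y n p ∂(sampleMeasure P n) with hm
  rw [charFun_apply_real, integral_map (hTm n).aemeasurable (by fun_prop)]
  have h2 : ∀ p, Complex.exp (t * T P X Y n p * Complex.I) =
      (fun x : ℝ => cis (t * (√n * (x - m)))) (xiStat X Y n p) := fun p => by
    simp only [T, cis]; push_cast; congr 1; ring
  simp_rw [h2]
  rw [integral_comp_xiStat hX hY hindep hident hq hl (C := 1)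
    (g := fun x : ℝ => cis (t * (√n * (x - m)))) (measurable_cis.comp (by fun_prop))
    fun z ρ => (norm_cis _).le]
  congr 1; ext w
  congr 2
  rw [hE]
  have hs : √(n : ℝ) ^ 2 = n := Real.sq_sqrt (by linarith)
  have hs0 : √(n : ℝ) ≠ 0 := (Real.sqrt_pos.mpr (by linarith)).ne'
  field_simp
  rw [hs]
  ring

end Sample

end RankBootstrap

namespace RankBootstrap

/-! ### The variance of an average over subsamples -/

section Subsample

variable {E : Type*} [MeasurableSpace E] {μ : Measure E} [IsProbabilityMeasure μ]

theorem map_comp_injective {ι κ : Type*} [Fintype ι] [Fintype κ] {e : κ → ι}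
    (he : Function.Injective e) :
    (iid ι μ).map (fun z i => z (e i)) = iid κ μ := by
  have h1 : iIndepFun (fun (i : ι) (z : ι → E) => z i) (iid ι μ) :=
    iIndepFun_pi (μ := fun _ : ι => μ) (X := fun _ w => w) fun _ => aemeasurable_id
  have h2 := (iIndepFun_iff_map_fun_eq_pi_map fun i : κ =>
    (measurable_pi_apply (X := fun _ : ι => E) (e i)).aemeasurable).mp (h1.precomp he)
  refine h2.trans ?_
  congr 1
  ext1 i
  exact (measurePreserving_eval (fun _ : ι => μ) (e i)).map_eq

theorem integral_comp_injective {ι κ : Type*} [Fintype ι] [Fintype κ] {e : κ → ι}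
    (he : Function.Injective e) {f : (κ → E) → ℝ} (hf : Measurable f) :
    ∫ z, f (fun i => z (e i)) ∂(iid ι μ) = ∫ z, f z ∂(iid κ μ) := by
  rw [← map_comp_injective (μ := μ) he,
    integral_map (measurable_pi_lambda _ fun i => measurable_pi_apply (e i)).aemeasurable
      (by exact hf.aestronglyMeasurable)]

theorem exists_perm_extending {m n : ℕ} (e e' : Fin m ↪ Fin n) :
    ∃ π : Equiv.Perm (Fin n), ∀ i, π (e i) = e' i := by
  classical
  let f : {x // x ∈ Set.range e} ≃ {x // x ∈ Set.range e'} :=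
    (Equiv.ofInjective e e.injective).symm.trans (Equiv.ofInjective e' e'.injective)
  refine ⟨f.extendSubtype, fun i => ?_⟩
  rw [Equiv.extendSubtype_apply_of_mem f _ ⟨i, rfl⟩]
  have : (⟨e i, ⟨i, rfl⟩⟩ : {x // x ∈ Set.range e}) = Equiv.ofInjective e e.injective i := rfl
  change ((Equiv.ofInjective e' e'.injective)
    ((Equiv.ofInjective e e.injective).symm ⟨e i, ⟨i, rfl⟩⟩)).1 = e' i
  rw [this, Equiv.symm_apply_apply]
  rfl

/-- The average of `f` over all injections is the average over all permutations of a fixed one. -/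
theorem sum_embedding_eq_sum_perm {m n : ℕ} (e₀ : Fin m ↪ Fin n) (f : (Fin m ↪ Fin n) → ℝ) :
    (Fintype.card (Equiv.Perm (Fin n)) : ℝ) * ∑ e, f e =
      Fintype.card (Fin m ↪ Fin n) * ∑ π : Equiv.Perm (Fin n), f (e₀.trans π.toEmbedding) := by
  have h1 : ∀ π : Equiv.Perm (Fin n), ∑ e : Fin m ↪ Fin n, f (e.trans π.toEmbedding) = ∑ e, f e :=
    fun π => Equiv.sum_comp (Equiv.embeddingCongr (Equiv.refl (Fin m)) π) f
  -- Every injection is `e₀` followed by some permutation, which is absorbed by reindexing the sum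
  -- over the group.
  have h2 : ∀ e : Fin m ↪ Fin n, ∑ π : Equiv.Perm (Fin n), f (e.trans π.toEmbedding) =
      ∑ π : Equiv.Perm (Fin n), f (e₀.trans π.toEmbedding) := fun e => by
    obtain ⟨τ, hτ⟩ := exists_perm_extending e₀ e
    rw [← Equiv.sum_comp (Equiv.mulRight τ) fun π => f (e₀.trans π.toEmbedding)]
    refine Finset.sum_congr rfl fun π _ => ?_
    congr 1
    ext i
    simp [hτ]
  calc _ = ∑ π : Equiv.Perm (Fin n), ∑ e : Fin m ↪ Fin n, f (e.trans π.toEmbedding) := by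
        simp_rw [h1]
        rw [Finset.sum_const, Finset.card_univ, nsmul_eq_mul]
    _ = ∑ e : Fin m ↪ Fin n, ∑ π : Equiv.Perm (Fin n), f (e.trans π.toEmbedding) := Finset.sum_comm
    _ = _ := by
        simp_rw [h2]
        rw [Finset.sum_const, Finset.card_univ, nsmul_eq_mul]

/-- The average of `h` over all ordered subsamples of size `m`. -/
noncomputable def subsampleMean {m n : ℕ} (h : (Fin m → E) → ℝ) (z : Fin n → E) : ℝ :=
  (Fintype.card (Fin m ↪ Fin n) : ℝ)⁻¹ * ∑ e : Fin m ↪ Fin n, h fun i => z (e i)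

theorem bddMeasurable_subsampleMean {m n : ℕ} {h : (Fin m → E) → ℝ} (hh : BddMeasurable h) :
    BddMeasurable fun z : Fin n → E => subsampleMean h z :=
  (BddMeasurable.finsetSum _ fun e _ => hh.comp (φ := fun (z : Fin n → E) i => z (e i))
    (by fun_prop)).const_mul _

/-- The `j`-th of `k` disjoint blocks of length `m`. -/
def block {k m n : ℕ} (hk : k * m ≤ n) (j : Fin k) : Fin m ↪ Fin n where
  toFun i := Fin.castLE hk (finProdFinEquiv (j, i))
  inj' i i' h := by
    have := finProdFinEquiv.injective (Fin.castLE_injective hk h)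
    exact (Prod.mk.inj this).2

theorem block_ne {k m n : ℕ} (hk : k * m ≤ n) {j j' : Fin k} (hj : j ≠ j') (i i' : Fin m) :
    block hk j i ≠ block hk j' i' := fun h =>
  hj (Prod.mk.inj (finProdFinEquiv.injective (Fin.castLE_injective hk h))).1

theorem integral_sq_block_sum {k m n : ℕ} (hk : k * m ≤ n) {f : (Fin m → E) → ℝ}
    (hf : BddMeasurable f) (h0 : ∫ z, f z ∂(iid (Fin m) μ) = 0) :
    ∫ z : Fin n → E, (∑ j, f fun i => z (block hk j i)) ^ 2 ∂(iid (Fin n) μ) =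
      k * ∫ z, f z ^ 2 ∂(iid (Fin m) μ) := by
  have hb : ∀ j, BddMeasurable fun z : Fin n → E => f fun i => z (block hk j i) := fun j =>
    hf.comp (φ := fun (z : Fin n → E) i => z (block hk j i)) (by fun_prop)
  rw [integral_sq_sum_of_orthogonal _ Finset.univ hb]
  · simp_rw [fun j => integral_comp_injective (μ := μ) (block hk j).injective
      (f := fun z => f z ^ 2) (hf.measurable.pow_const 2)]
    simp
  · intro j _ j' _ hj
    have hd : ∀ j, DependsOn (fun z : Fin n → E => f fun i => z (block hk j i))
        ((Finset.univ.map (block hk j) : Finset (Fin n)) : Set (Fin n)) := fun j u v huv => by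
      simp only
      congr 1
      ext i
      exact huv _ (by simp)
    rw [integral_mul_of_dependsOn (hb j).measurable (hb j').measurable
      (s := Finset.univ.map (block hk j)) (t := Finset.univ.map (block hk j')) ?_ (hd j) (hd j'),
      integral_comp_injective (block hk j).injective hf.measurable, h0, zero_mul]
    rw [Finset.disjoint_left]
    intro a ha ha'
    simp only [Finset.mem_map, Finset.mem_univ, true_and] at ha ha'
    obtain ⟨i, rfl⟩ := ha
    obtain ⟨i', hi'⟩ := ha'
    exact block_ne hk hj i i' hi'.symm

/-- Hoeffding's argument: the mean over all subsamples equals the mean over permutations of the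
average over $k$ disjoint blocks. By convexity of the square its variance is at most that of one
block average, and disjoint blocks are independent. -/
theorem integral_sq_subsampleMean_sub_le {k m n : ℕ} (hk0 : 0 < k) (hk : k * m ≤ n)
    {h : (Fin m → E) → ℝ} (hh : BddMeasurable h) :
    ∫ z : Fin n → E, (subsampleMean h z - ∫ w, h w ∂(iid (Fin m) μ)) ^ 2 ∂(iid (Fin n) μ) ≤
      (∫ z, (h z - ∫ w, h w ∂(iid (Fin m) μ)) ^ 2 ∂(iid (Fin m) μ)) / k := by
  set c := ∫ w, h w ∂(iid (Fin m) μ) with hc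
  let f : (Fin m → E) → ℝ := fun z => h z - c
  have hf : BddMeasurable f := hh.sub_const c
  have hf0 : ∫ z, f z ∂(iid (Fin m) μ) = 0 := by
    simp only [f]
    rw [integral_sub (hh.integrable _) (integrable_const _)]
    simp [hc]
  have hkR : (0 : ℝ) < k := by exact_mod_cast hk0
  let N : ℝ := Fintype.card (Equiv.Perm (Fin n))
  have hN : 0 < N := Nat.cast_pos.mpr Fintype.card_pos
  have hM : (0 : ℝ) < Fintype.card (Fin m ↪ Fin n) := by
    exact_mod_cast Fintype.card_pos_iff.mpr ⟨block hk ⟨0, hk0⟩⟩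
  let S : Equiv.Perm (Fin n) → (Fin n → E) → ℝ := fun π z =>
    ∑ j : Fin k, f fun i => z (π (block hk j i))
  have hS : ∀ π, BddMeasurable (S π) := fun π => .finsetSum _ fun j _ =>
    hf.comp (φ := fun (z : Fin n → E) i => z (π (block hk j i))) (by fun_prop)
  have hrep : ∀ z : Fin n → E, subsampleMean h z - c = N⁻¹ * ∑ π, (k : ℝ)⁻¹ * S π z := fun z => by
    have h1 : subsampleMean h z - c =
        (Fintype.card (Fin m ↪ Fin n) : ℝ)⁻¹ * ∑ e : Fin m ↪ Fin n, f fun i => z (e i) := by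
      simp only [subsampleMean, f, Finset.sum_sub_distrib, mul_sub]
      rw [Finset.sum_const, Finset.card_univ, nsmul_eq_mul, ← mul_assoc, inv_mul_cancel₀ hM.ne',
        one_mul]
    have h2 : ∀ j, (Fintype.card (Fin m ↪ Fin n) : ℝ)⁻¹ * ∑ e : Fin m ↪ Fin n, f (fun i => z (e i)) =
        N⁻¹ * ∑ π : Equiv.Perm (Fin n), f fun i => z (π (block hk j i)) := fun j => by
      have := sum_embedding_eq_sum_perm (block hk j) fun e => f fun i => z (e i)
      rw [inv_mul_eq_iff_eq_mul₀ hM.ne']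
      have h3 : ∑ e : Fin m ↪ Fin n, f (fun i => z (e i)) =
        N⁻¹ * (N * ∑ e : Fin m ↪ Fin n, f (fun i => z (e i))) := by
        rw [← mul_assoc, inv_mul_cancel₀ hN.ne', one_mul]
      rw [h3, this]
      simp only [Function.Embedding.trans_apply, Equiv.coe_toEmbedding]
      ring
    have h4 : (k : ℝ) * (subsampleMean h z - c) = N⁻¹ * ∑ π, S π z := by
      simp only [S]
      rw [Finset.sum_comm, Finset.mul_sum]
      simp_rw [← h2]
      rw [Finset.sum_const, Finset.card_univ, Fintype.card_fin, nsmul_eq_mul, h1]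
    rw [← Finset.mul_sum, mul_left_comm, ← h4, ← mul_assoc, inv_mul_cancel₀ hkR.ne', one_mul]
  have hpt : ∀ z : Fin n → E, (subsampleMean h z - c) ^ 2 ≤
      N⁻¹ * ∑ π, ((k : ℝ)⁻¹) ^ 2 * S π z ^ 2 := fun z => by
    rw [hrep, mul_pow]
    have h1 := sq_sum_le_card_mul_sum_sq (s := Finset.univ)
      (f := fun π : Equiv.Perm (Fin n) => (k : ℝ)⁻¹ * S π z)
    rw [Finset.card_univ] at h1
    have h2 : ∀ π, ((k : ℝ)⁻¹) ^ 2 * S π z ^ 2 = ((k : ℝ)⁻¹ * S π z) ^ 2 := fun π =>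
      (mul_pow _ _ _).symm
    simp_rw [h2]
    calc (N⁻¹) ^ 2 * (∑ π, (k : ℝ)⁻¹ * S π z) ^ 2 ≤
          (N⁻¹) ^ 2 * (N * ∑ π, ((k : ℝ)⁻¹ * S π z) ^ 2) :=
          mul_le_mul_of_nonneg_left h1 (sq_nonneg _)
      _ = _ := by rw [sq, mul_assoc, inv_mul_cancel_left₀ hN.ne']
  have hint : ∀ π, ∫ z, S π z ^ 2 ∂(iid (Fin n) μ) = k * ∫ z, f z ^ 2 ∂(iid (Fin m) μ) := fun π => by
    rw [← integral_sq_block_sum (μ := μ) hk hf hf0]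
    exact integral_comp_injective (μ := μ) π.injective
      (f := fun z => (∑ j, f fun i => z (block hk j i)) ^ 2)
      ((BddMeasurable.finsetSum _ fun j _ => hf.comp
        (φ := fun (z : Fin n → E) i => z (block hk j i)) (by fun_prop)).measurable.pow_const 2)
  calc _ ≤ ∫ z, N⁻¹ * ∑ π, ((k : ℝ)⁻¹) ^ 2 * S π z ^ 2 ∂(iid (Fin n) μ) :=
        integral_mono_bdd (((bddMeasurable_subsampleMean hh).sub_const c).pow 2)
          ((BddMeasurable.finsetSum _ fun π _ => ((hS π).pow 2).const_mul _).const_mul _)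
          (Eventually.of_forall hpt)
    _ = (∫ z, f z ^ 2 ∂(iid (Fin m) μ)) / k := by
        rw [integral_const_mul, integral_finsetSum _ fun π _ =>
          (((hS π).pow 2).const_mul _).integrable _]
        simp_rw [integral_const_mul, hint]
        rw [Finset.sum_const, Finset.card_univ, nsmul_eq_mul]
        change N⁻¹ * (N * _) = _
        field_simp

end Subsample

end RankBootstrap

namespace RankBootstrap

/-! ### Uniform convergence of distribution functions -/

/-- A distribution function which is close to a Lipschitz one on a suitable finite set is uniformly
close to it, even after a small shift. -/
theorem exists_finset_close {F : ℝ → ℝ} {L : ℝ} (hF : Monotone F) (hF0 : ∀ x, 0 ≤ F x) (hF1 : ∀ x, F x ≤ 1)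
    (hbot : Tendsto F atBot (𝓝 0)) (htop : Tendsto F atTop (𝓝 1)) (hL : 0 < L)
    (hlip : ∀ x d, 0 ≤ d → F (x + d) ≤ F x + L * d) {ε : ℝ} (hε : 0 < ε) :
    ∃ (S : Finset ℝ) (d : ℝ), 0 < d ∧ ∀ G : ℝ → ℝ, Monotone G → (∀ x, 0 ≤ G x) → (∀ x, G x ≤ 1) →
      (∀ a ∈ S, |G a - F a| ≤ ε) → ∀ x δ, |δ| ≤ d → |G (x + δ) - F x| ≤ 3 * ε := by
  classical
  -- Outside $[A,B]$ the function $F$ is within $\varepsilon$ of its limits. Inside, a grid of mesh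
  -- $d=\varepsilon/L$ is used; one $\varepsilon$ each is spent on the grid values, the mesh and the
  -- shift.
  obtain ⟨A, hA⟩ := (hbot.eventually (gt_mem_nhds hε)).exists
  obtain ⟨B, hB⟩ := (htop.eventually (lt_mem_nhds (show 1 - ε < 1 by linarith))).exists
  set d := ε / L with hd
  have hd0 : 0 < d := div_pos hε hL
  have hlip' : ∀ x, F (x + d) ≤ F x + ε := fun x => by
    have := hlip x d hd0.le
    rwa [hd, mul_div_cancel₀ _ hL.ne'] at this
  set K := ⌈(B - A) / d⌉₊
  have hK : B ≤ A + K * d := by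
    have := (div_le_iff₀ hd0).mp (Nat.le_ceil ((B - A) / d))
    linarith
  refine ⟨(Finset.range (K + 1)).image fun k : ℕ => A + k * d, d, hd0, fun G hG hG0 hG1 hS x δ hδ => ?_⟩
  have hS' : ∀ k : ℕ, k ≤ K → |G (A + k * d) - F (A + k * d)| ≤ ε := fun k hk =>
    hS _ (Finset.mem_image.mpr ⟨k, Finset.mem_range.mpr (by omega), rfl⟩)
  obtain ⟨hδ1, hδ2⟩ := abs_le.mp hδ
  set y := x + δ with hy
  have hxy : F x ≤ F y + ε := (hF (by linarith)).trans (hlip' y)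
  have hyx : F y ≤ F x + ε := (hF (by linarith)).trans (hlip' x)
  rcases lt_or_ge y A with h | h
  · have h1 := hG h.le
    have h2 := hF h.le
    have h3 := hS' 0 (Nat.zero_le _)
    rw [Nat.cast_zero, zero_mul, add_zero] at h3
    have h4 := (abs_le.mp h3).2
    have := hG0 y
    have := hF0 x
    rw [abs_le]; constructor <;> linarith
  rcases lt_or_ge y (A + K * d) with h' | h'
  · set k := ⌊(y - A) / d⌋₊ with hk
    have h1 : A + k * d ≤ y := by
      have := (le_div_iff₀ hd0).mp (Nat.floor_le (div_nonneg (sub_nonneg.mpr h) hd0.le))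
      linarith
    have h2 : y ≤ A + k * d + d := by
      have := (div_lt_iff₀ hd0).mp (Nat.lt_floor_add_one ((y - A) / d))
      rw [← hk] at this
      linarith
    have h3 : k + 1 ≤ K := by
      have : (k : ℝ) < K := by
        by_contra! hc
        have := mul_le_mul_of_nonneg_right hc hd0.le
        linarith
      exact_mod_cast this
    have h4 := abs_le.mp (hS' k (by omega))
    have h5 := abs_le.mp (hS' (k + 1) h3)
    have e : A + ((k + 1 : ℕ) : ℝ) * d = A + k * d + d := by push_cast; ring
    rw [e] at h5
    have h6 := hlip' (A + k * d)
    have h7 := hF h1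
    have h8 := hF h2
    have h9 := hG h1
    have h10 := hG h2
    rw [abs_le]; constructor <;> linarith [h4.1, h4.2, h5.1, h5.2]
  · have h1 := hG h'
    have h2 := hF h'
    have h3 := hF hK
    have h4 := abs_le.mp (hS' K le_rfl)
    have := hG1 y
    have := hF1 x
    rw [abs_le]; constructor <;> linarith [h4.1, h4.2]

theorem gaussianPDFReal_le_one (x : ℝ) : gaussianPDFReal 0 1 x ≤ 1 := by
  have h1 : (1 : ℝ) ≤ √(2 * Real.pi * (1 : ℝ≥0)) := by
    rw [Real.one_le_sqrt, NNReal.coe_one]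
    nlinarith [Real.pi_gt_three]
  have h2 : Real.exp (-(x - 0) ^ 2 / (2 * (1 : ℝ≥0))) ≤ 1 := by
    rw [Real.exp_le_one_iff, NNReal.coe_one]
    nlinarith [sq_nonneg (x - 0)]
  calc gaussianPDFReal 0 1 x ≤ 1 * 1 :=
        mul_le_mul (inv_le_one_of_one_le₀ h1) h2 (Real.exp_pos _).le zero_le_one
    _ = 1 := one_mul 1

theorem cdf_gaussianReal_add_le (x : ℝ) {d : ℝ} (hd : 0 ≤ d) :
    cdf (gaussianReal 0 1) (x + d) ≤ cdf (gaussianReal 0 1) x + d := by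
  have h : gaussianReal 0 1 (Set.Ioc x (x + d)) ≤ ENNReal.ofReal d := by
    rw [gaussianReal_apply 0 one_ne_zero]
    calc ∫⁻ y in Set.Ioc x (x + d), gaussianPDF 0 1 y ≤ ∫⁻ y in Set.Ioc x (x + d), 1 :=
          lintegral_mono fun y => by
            rw [gaussianPDF, ← ENNReal.ofReal_one]
            exact ENNReal.ofReal_le_ofReal (gaussianPDFReal_le_one y)
      _ = ENNReal.ofReal d := by simp
  have h2 := ENNReal.toReal_mono ENNReal.ofReal_ne_top h
  rw [ENNReal.toReal_ofReal hd] at h2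
  rw [cdf_eq_real, cdf_eq_real, ← Set.Iic_union_Ioc_eq_Iic (show x ≤ x + d by linarith)]
  refine (measureReal_union_le _ _).trans ?_
  gcongr
  exact h2

theorem measureReal_gaussianReal_Iic {s : ℝ≥0} (hs : 0 < s) (x : ℝ) :
    (gaussianReal 0 (s ^ 2)).real (Set.Iic x) = cdf (gaussianReal 0 1) (x / s) := by
  have h1 := gaussianReal_map_const_mul (μ := 0) (v := 1) (s : ℝ)
  have h2 : (NNReal.mk ((s : ℝ) ^ 2) (sq_nonneg _)) * 1 = s ^ 2 := by
    rw [mul_one]; ext; simp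
  rw [h2, mul_zero] at h1
  rw [cdf_eq_real, ← h1, measureReal_def, measureReal_def,
    Measure.map_apply (measurable_const_mul _) measurableSet_Iic]
  congr 2
  ext y
  have hs' : (0 : ℝ) < s := hs
  simp only [Set.mem_preimage, Set.mem_Iic]
  rw [le_div_iff₀ hs', mul_comm]

theorem exists_finset_gaussian_close {s : ℝ≥0} (hs : 0 < s) {ε : ℝ} (hε : 0 < ε) :
    ∃ (S : Finset ℝ) (d : ℝ), 0 < d ∧ ∀ G : ℝ → ℝ, Monotone G → (∀ x, 0 ≤ G x) → (∀ x, G x ≤ 1) →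
      (∀ a ∈ S, |G a - cdf (gaussianReal 0 1) (a / s)| ≤ ε) →
      ∀ x δ, |δ| ≤ d → |G (x + δ) - cdf (gaussianReal 0 1) (x / s)| ≤ 3 * ε := by
  have hs' : (0 : ℝ) < s := hs
  refine exists_finset_close (L := (s : ℝ)⁻¹)
    (F := fun x => cdf (gaussianReal 0 1) (x / s)) (fun x y hxy => monotone_cdf _ (by gcongr))
    (fun x => cdf_nonneg _ _) (fun x => cdf_le_one _ _)
    ((tendsto_cdf_atBot _).comp (tendsto_id.atBot_div_const hs'))
    ((tendsto_cdf_atTop _).comp (tendsto_id.atTop_div_const hs')) (inv_pos.mpr hs')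
    (fun x d hd => ?_) hε
  simp only [add_div]
  refine (cdf_gaussianReal_add_le (x / s) (div_nonneg hd hs'.le)).trans_eq ?_
  rw [div_eq_inv_mul d]

/-- Portmanteau theorem; positivity of $\sigma$ makes the boundary point of the half-line a null set
of the limit. -/
theorem TConvergesTo.tendsto_measureReal_le {Ω : Type*} [MeasurableSpace Ω] {P : Measure Ω}
    [IsProbabilityMeasure P] {X Y : ℕ → Ω → ℝ} {s : ℝ≥0} (h : TConvergesTo P X Y s) (hs : 0 < s)
    (x : ℝ) : Tendsto (fun n => (sampleMeasure P n).real {p | T P X Y n p ≤ x}) atTop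
      (𝓝 (cdf (gaussianReal 0 1) (x / s))) := by
  have hs2 : s ^ 2 ≠ 0 := pow_ne_zero 2 hs.ne'
  have := nullSingletonClass_gaussianReal (μ := 0) hs2
  have key := ProbabilityMeasure.tendsto_measure_of_null_frontier_of_tendsto' h.tendsto
    (E := Set.Iic x) (by
      simp only [ProbabilityMeasure.coe_mk, Measure.map_id', frontier_Iic, measure_singleton])
  simp only [ProbabilityMeasure.coe_mk, Measure.map_id'] at key
  have key2 := (ENNReal.tendsto_toReal (measure_ne_top _ _)).comp key
  rw [← measureReal_gaussianReal_Iic hs]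
  refine key2.congr fun n => ?_
  simp only [Function.comp_apply]
  rw [Measure.map_apply_of_aemeasurable (h.forall_aemeasurable n) measurableSet_Iic]
  rfl

end RankBootstrap

namespace RankBootstrap

/-! ### Consistency of the bootstrap under a variance bound -/

theorem integral_uniformOn_univ {α : Type*} [Fintype α] [MeasurableSpace α]
    [DiscreteMeasurableSpace α] (g : α → ℝ) :
    ∫ a, g a ∂(uniformOn Set.univ) = (Fintype.card α : ℝ)⁻¹ * ∑ a, g a := by
  rw [uniformOn, ProbabilityTheory.cond, Measure.restrict_univ, integral_smul_measure,
    integral_count, Measure.count_univ]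
  simp

section Kernels

variable {m : ℕ}

/-- The rank correlation averaged over the tie-breaking. -/
noncomputable def meanXi (z : Fin m → ℝ × ℝ) : ℝ := ∫ ρ, xi z ρ ∂(tieMeasure m)

/-- The distribution function of `√m (ξ_m - c)` under the tie-breaking alone. -/
noncomputable def tieCDF (c x : ℝ) (z : Fin m → ℝ × ℝ) : ℝ :=
  (tieMeasure m).real {ρ | √(m : ℝ) * (xi z ρ - c) ≤ x}

theorem bddMeasurable_meanXi : BddMeasurable (meanXi (m := m)) :=
  bddMeasurable_of_orderPattern fun z z' h => by simp only [meanXi, xi_congr h]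

theorem bddMeasurable_tieCDF (c x : ℝ) : BddMeasurable (tieCDF (m := m) c x) :=
  bddMeasurable_of_orderPattern fun z z' h => by simp only [tieCDF, xi_congr h]

theorem tieCDF_nonneg (c x : ℝ) (z : Fin m → ℝ × ℝ) : 0 ≤ tieCDF c x z := measureReal_nonneg

theorem tieCDF_le_one (c x : ℝ) (z : Fin m → ℝ × ℝ) : tieCDF c x z ≤ 1 := measureReal_le_one

theorem tieCDF_mono (c : ℝ) (z : Fin m → ℝ × ℝ) : Monotone fun x => tieCDF c x z :=
  fun _ _ h => measureReal_mono fun _ hρ => le_trans hρ h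

theorem measureReal_eq_integral_indicator {α : Type*} [MeasurableSpace α] (ν : Measure α) {s : Set α}
    (hs : MeasurableSet s) : ν.real s = ∫ a, s.indicator (fun _ => (1 : ℝ)) a ∂ν :=
  (integral_indicator_one hs).symm

variable {n : ℕ}

theorem integral_bootMeasure (h : m ≤ n) (f : (Fin m ↪ Fin n) → Equiv.Perm (Fin m) → ℝ) :
    ∫ b, f b.1 b.2 ∂(bootMeasure m n) =
      (Fintype.card (Fin m ↪ Fin n) : ℝ)⁻¹ * ∑ e, ∫ ρ, f e ρ ∂(tieMeasure m) := by
  have : Nonempty (Fin m ↪ Fin n) := ⟨Fin.castLEEmb h⟩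
  rw [bootMeasure, integral_prod (fun b : (Fin m ↪ Fin n) × Equiv.Perm (Fin m) => f b.1 b.2)
    Integrable.of_finite, integral_uniformOn_univ]

theorem integral_bootXi (h : m ≤ n) (z : Fin n → ℝ × ℝ) :
    ∫ b, bootXi z b ∂(bootMeasure m n) = subsampleMean (meanXi (m := m)) z :=
  integral_bootMeasure h fun e ρ => xi (fun i => z (e i)) ρ

/-- Replacing the random centring by a deterministic $c$ moves all data dependence of the centring
into the argument. For each fixed argument what remains is a U-statistic of degree $m$ with bounded
kernel. -/
theorem bootCDF_eq (h : m ≤ n) (c : ℝ) (z : Fin n → ℝ × ℝ) (x : ℝ) :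
    bootCDF m z x = subsampleMean
      (tieCDF (m := m) c (x + √(m : ℝ) * (subsampleMean (meanXi (m := m)) z - c))) z := by
  have h1 : ∀ b : (Fin m ↪ Fin n) × Equiv.Perm (Fin m), bootT z b ≤ x ↔
      √(m : ℝ) * (xi (fun i => z (b.1 i)) b.2 - c) ≤
        x + √(m : ℝ) * (subsampleMean (meanXi (m := m)) z - c) := fun b => by
    rw [bootT, integral_bootXi h, bootXi]
    constructor <;> intro h <;> linarith
  unfold bootCDF
  simp_rw [h1]
  rw [measureReal_eq_integral_indicator _ (Set.toFinite _).measurableSet]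
  refine (integral_bootMeasure h fun e ρ => Set.indicator
    {ρ | √(m : ℝ) * (xi (fun i => z (e i)) ρ - c) ≤
        x + √(m : ℝ) * (subsampleMean (meanXi (m := m)) z - c)} (fun _ => (1 : ℝ)) ρ).trans ?_
  unfold subsampleMean
  congr 1
  refine Finset.sum_congr rfl fun e _ => ?_
  rw [← measureReal_eq_integral_indicator _ (Set.toFinite _).measurableSet]
  rfl

end Kernels

theorem measureReal_le_abs_le {Ω : Type*} [MeasurableSpace Ω] {P : Measure Ω}
    [IsProbabilityMeasure P] {f : Ω → ℝ} (hf : BddMeasurable f) {t : ℝ} (ht : 0 < t) :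
    P.real {z | t ≤ |f z|} ≤ (∫ z, f z ^ 2 ∂P) / t ^ 2 := by
  have h1 := mul_meas_ge_le_integral_of_nonneg (μ := P) (f := fun z => f z ^ 2)
    (Eventually.of_forall fun z => sq_nonneg _) ((hf.pow 2).integrable P) (t ^ 2)
  rw [le_div_iff₀ (by positivity), mul_comm]
  refine le_trans (mul_le_mul_of_nonneg_left (measureReal_mono fun z hz => ?_) (sq_nonneg t)) h1
  have hz : t ≤ |f z| := hz
  change t ^ 2 ≤ f z ^ 2
  rw [← sq_abs (f z)]
  gcongr

section Consistency

variable {Ω : Type*} [MeasurableSpace Ω] {P : Measure Ω} [IsProbabilityMeasure P]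
  {X Y : ℕ → Ω → ℝ}

variable (P X Y) in
/-- The expectation of the rank correlation of a sample of size `m`. -/
noncomputable def expXi (m : ℕ) : ℝ := ∫ z, meanXi z ∂(iid (Fin m) (pairLaw P X Y))

variable (P X Y) in
/-- The variance of the rank correlation, averaged over the tie-breaking. -/
noncomputable def varXi (m : ℕ) : ℝ :=
  ∫ z, (meanXi z - expXi P X Y m) ^ 2 ∂(iid (Fin m) (pairLaw P X Y))

variable (hX : ∀ k, Measurable (X k)) (hY : ∀ k, Measurable (Y k))
  (hindep : iIndepFun (fun k ω => (X k ω, Y k ω)) P)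
  (hident : ∀ k, IdentDistrib (fun ω => (X k ω, Y k ω)) (fun ω => (X 0 ω, Y 0 ω)) P P)
include hX hY hindep hident

theorem integral_xiStat (m : ℕ) : ∫ p, xiStat X Y m p ∂(sampleMeasure P m) = expXi P X Y m := by
  obtain ⟨C, hC⟩ := (bddMeasurable_xi_uncurry (n := m)).bdd
  exact integral_sampleMeasure hX hY hindep hident (f := fun z ρ => xi z ρ)
    bddMeasurable_xi_uncurry.measurable (C := C) fun z ρ => hC (z, ρ)

/-- The kernel of the U-statistic has the distribution function of $T_m$ as its mean, provided that
the centring constant is the true expectation of $\xi_m$. -/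
theorem integral_tieCDF (m : ℕ) (x : ℝ) :
    ∫ z, tieCDF (m := m) (expXi P X Y m) x z ∂(iid (Fin m) (pairLaw P X Y)) =
      (sampleMeasure P m).real {p | T P X Y m p ≤ x} := by
  have hs : MeasurableSet {v : (Fin m → ℝ × ℝ) × Equiv.Perm (Fin m) |
      √(m : ℝ) * (xi v.1 v.2 - expXi P X Y m) ≤ x} :=
    measurableSet_le ((bddMeasurable_xi_uncurry.measurable.sub_const _).const_mul _)
      measurable_const
  have h1 := integral_sampleMeasure hX hY hindep hident (n := m) (C := 1)
    (f := fun z ρ => Set.indicator {v : (Fin m → ℝ × ℝ) × Equiv.Perm (Fin m) |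
      √(m : ℝ) * (xi v.1 v.2 - expXi P X Y m) ≤ x} (fun _ => (1 : ℝ)) (z, ρ))
    (measurable_const.indicator hs) fun z ρ => by
      refine (norm_indicator_le_norm_self _ _).trans ?_
      simp
  have hTm : MeasurableSet {p | T P X Y m p ≤ x} :=
    measurableSet_le (((measurable_xiStat hX hY hindep hident m).sub_const _).const_mul _)
      measurable_const
  rw [measureReal_eq_integral_indicator _ hTm]
  refine Eq.trans (integral_congr_ae (Eventually.of_forall fun z => ?_)) (h1.symm.trans
    (integral_congr_ae (Eventually.of_forall fun p => ?_)))
  · simp only [tieCDF]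
    rw [measureReal_eq_integral_indicator _ (Set.toFinite _).measurableSet]
    rfl
  · simp only [T, integral_xiStat hX hY hindep hident]
    rfl

/-- Chebyshev's inequality for the U-statistics at the finitely many grid points and for the shift.
Outside the exceptional event each grid value is within $2\eta$ of the normal one, half from
fluctuation and half from `hT`, and the shift is below $d$. -/
theorem exists_bad_set {s : ℝ≥0} (S : Finset ℝ) {d η : ℝ} (hd : 0 < d) (hη : 0 < η)
    (hS : ∀ G : ℝ → ℝ, Monotone G → (∀ x, 0 ≤ G x) → (∀ x, G x ≤ 1) →
      (∀ a ∈ S, |G a - cdf (gaussianReal 0 1) (a / s)| ≤ 2 * η) →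
      ∀ x δ, |δ| ≤ d → |G (x + δ) - cdf (gaussianReal 0 1) (x / s)| ≤ 3 * (2 * η))
    {m n : ℕ} (hm : 0 < m) (hmn : m ≤ n)
    (hT : ∀ a ∈ S, |(sampleMeasure P m).real {p | T P X Y m p ≤ a} -
      cdf (gaussianReal 0 1) (a / s)| ≤ η) :
    P.real {ω | 7 * η ≤ kolmogorovError s m (sample X Y n ω)} ≤
      (S.card / η ^ 2) * (2 * (m / n)) + (2 / d ^ 2) * (m ^ 2 * varXi P X Y m / n) := by
  have := isProbabilityMeasure_pairLaw (P := P) hX hY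
  set l := pairLaw P X Y
  set c := expXi P X Y m with hc
  set k := n / m
  have hk0 : 0 < k := Nat.div_pos hmn hm
  have hk : k * m ≤ n := Nat.div_mul_le_self n m
  have hmR : (0 : ℝ) < m := by exact_mod_cast hm
  have hnR : (0 : ℝ) < n := by exact_mod_cast hm.trans_le hmn
  have hkR : (0 : ℝ) < k := by exact_mod_cast hk0
  -- Since $k=\lfloor n/m\rfloor\ge1$, one has $n<(k+1)m\le2km$.
  have hkinv : (k : ℝ)⁻¹ ≤ 2 * (m / n) := by
    have h1 : n < (k + 1) * m := by
      have := Nat.lt_div_mul_add (a := n) hm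
      rwa [add_mul, one_mul]
    have h2 : (n : ℝ) ≤ 2 * k * m := by
      have h3 : n ≤ 2 * k * m := h1.le.trans (Nat.mul_le_mul_right m (by omega))
      exact_mod_cast h3
    rw [inv_le_iff_one_le_mul₀ hkR, mul_comm (2 : ℝ), div_mul_eq_mul_div, div_mul_eq_mul_div,
      le_div_iff₀ hnR]
    nlinarith
  let g : ℝ → (Fin n → ℝ × ℝ) → ℝ := fun a z =>
    subsampleMean (tieCDF (m := m) c a) z - ∫ w, tieCDF (m := m) c a w ∂(iid (Fin m) l)
  let D : (Fin n → ℝ × ℝ) → ℝ := fun z => √(m : ℝ) * (subsampleMean (meanXi (m := m)) z - c)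
  have hg : ∀ a, BddMeasurable (g a) := fun a =>
    (bddMeasurable_subsampleMean (bddMeasurable_tieCDF c a)).sub_const _
  have hD : BddMeasurable D :=
    ((bddMeasurable_subsampleMean bddMeasurable_meanXi).sub_const _).const_mul _
  have hg2 : ∀ a, ∫ z, g a z ^ 2 ∂(iid (Fin n) l) ≤ 2 * (m / n) := fun a => by
    refine (integral_sq_subsampleMean_sub_le hk0 hk (bddMeasurable_tieCDF c a)).trans ?_
    refine le_trans ?_ hkinv
    rw [div_eq_mul_inv]
    refine mul_le_of_le_one_left (inv_pos.mpr hkR).le ?_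
    rw [integral_sq_sub_integral _ (bddMeasurable_tieCDF c a)]
    refine (sub_le_self _ (sq_nonneg _)).trans
      (integral_le_const ((bddMeasurable_tieCDF c a).pow 2) (Eventually.of_forall fun z => ?_))
    exact pow_le_one₀ (tieCDF_nonneg _ _ _) (tieCDF_le_one _ _ _)
  have hD2 : ∫ z, D z ^ 2 ∂(iid (Fin n) l) ≤ 2 * (m ^ 2 * varXi P X Y m / n) := by
    simp only [D, mul_pow]
    rw [integral_const_mul, Real.sq_sqrt hmR.le]
    have h1 := integral_sq_subsampleMean_sub_le (μ := l) hk0 hk (bddMeasurable_meanXi (m := m))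
    have hv : 0 ≤ varXi P X Y m := integral_nonneg fun z => sq_nonneg _
    calc _ ≤ (m : ℝ) * (varXi P X Y m / k) := mul_le_mul_of_nonneg_left h1 hmR.le
      _ ≤ m * (varXi P X Y m * (2 * (m / n))) := by
          rw [div_eq_mul_inv]; gcongr
      _ = _ := by ring
  let A : Set (Fin n → ℝ × ℝ) := (⋃ a ∈ S, {z | η ≤ |g a z|}) ∪ {z | d ≤ |D z|}
  -- The supremum is at most $6\eta$, strictly below $7\eta$, which turns the inclusion into a
  -- contradiction.
  have hgood : ∀ z ∉ A, kolmogorovError s m z ≤ 6 * η := fun z hz => by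
    simp only [A, Set.mem_union, Set.mem_iUnion, Set.mem_ofPred_eq, not_or, not_exists,
      not_le] at hz
    refine ciSup_le fun x => ?_
    rw [bootCDF_eq hmn c]
    refine (hS (fun x => subsampleMean (tieCDF (m := m) c x) z) (fun x y hxy => ?_) (fun x => ?_)
      (fun x => ?_) (fun a ha => ?_) x (D z) hz.2.le).trans_eq (by ring)
    · exact mul_le_mul_of_nonneg_left (Finset.sum_le_sum fun e _ => tieCDF_mono c _ hxy)
        (by positivity)
    · exact mul_nonneg (by positivity) (Finset.sum_nonneg fun e _ => tieCDF_nonneg _ _ _)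
    · refine (mul_le_mul_of_nonneg_left (Finset.sum_le_sum fun e _ => tieCDF_le_one _ _ _)
        (by positivity)).trans ?_
      rw [Finset.sum_const, Finset.card_univ, nsmul_eq_mul, mul_one]
      exact inv_mul_le_one
    · have h1 := (hz.1 a ha).le
      have h2 := hT a ha
      rw [← integral_tieCDF hX hY hindep hident] at h2
      have h3 := abs_add_le (g a z) (∫ w, tieCDF (m := m) c a w ∂(iid (Fin m) l) -
        cdf (gaussianReal 0 1) (a / s))
      simp only [g, sub_add_sub_cancel] at h3 h1
      exact h3.trans (by linarith)
  have hsub : {ω | 7 * η ≤ kolmogorovError s m (sample X Y n ω)} ⊆ sample X Y n ⁻¹' A :=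
    fun ω hω => by
      by_contra hc
      have h1 := hgood _ hc
      have h2 : 7 * η ≤ kolmogorovError s m (sample X Y n ω) := hω
      linarith
  have hA : MeasurableSet A := by
    refine (Finset.measurableSet_biUnion S fun a _ => ?_).union ?_
    · exact measurableSet_le measurable_const (hg a).abs.measurable
    · exact measurableSet_le measurable_const hD.abs.measurable
  calc _ ≤ P.real (sample X Y n ⁻¹' A) := measureReal_mono hsub
    _ = (iid (Fin n) l).real A := by
        rw [← map_sample hX hY hindep hident n,
          map_measureReal_apply (measurable_sample hX hY n) hA]
    _ ≤ (iid (Fin n) l).real (⋃ a ∈ S, {z | η ≤ |g a z|}) + (iid (Fin n) l).real {z | d ≤ |D z|} :=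
        measureReal_union_le _ _
    _ ≤ ∑ a ∈ S, (iid (Fin n) l).real {z | η ≤ |g a z|} + (iid (Fin n) l).real {z | d ≤ |D z|} := by
        gcongr
        exact measureReal_biUnion_finset_le _ _
    _ ≤ ∑ a ∈ S, (2 * (m / n) : ℝ) / η ^ 2 + 2 * (m ^ 2 * varXi P X Y m / n) / d ^ 2 := by
        gcongr with a ha
        · exact (measureReal_le_abs_le (hg a) hη).trans (by gcongr; exact hg2 a)
        · exact (measureReal_le_abs_le hD hd).trans (by gcongr)
    _ = _ := by
        rw [Finset.sum_const, nsmul_eq_mul]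
        ring

theorem BootstrapConsistent.of_varXi {s : ℝ≥0} (hs : 0 < s) (hT : TConvergesTo P X Y s) {m : ℕ → ℕ}
    (hm : Tendsto m atTop atTop) (hmn : Tendsto (fun n => (m n : ℝ) / n) atTop (𝓝 0))
    (hv : Tendsto (fun n => (m n : ℝ) ^ 2 * varXi P X Y (m n) / n) atTop (𝓝 0)) :
    BootstrapConsistent P X Y s m := by
  refine tendstoInMeasure_iff_measureReal_norm.mpr fun ε hε => ?_
  obtain ⟨S, d, hd, hS⟩ := exists_finset_gaussian_close hs (ε := 2 * (ε / 7)) (by positivity)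
  have hη : 0 < ε / 7 := by positivity
  have hlim : Tendsto (fun n => ((S.card : ℝ) / (ε / 7) ^ 2) * (2 * ((m n : ℝ) / n)) +
      (2 / d ^ 2) * ((m n : ℝ) ^ 2 * varXi P X Y (m n) / n)) atTop (𝓝 0) := by
    have := ((hmn.const_mul 2).const_mul ((S.card : ℝ) / (ε / 7) ^ 2)).add (hv.const_mul (2 / d ^ 2))
    simpa using this
  refine squeeze_zero' (Eventually.of_forall fun n => measureReal_nonneg) ?_ hlim
  have hev : ∀ᶠ k in atTop, ∀ a ∈ S, |(sampleMeasure P k).real {p | T P X Y k p ≤ a} -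
      cdf (gaussianReal 0 1) (a / s)| ≤ ε / 7 := by
    rw [Filter.eventually_all_finset]
    intro a _
    have := (hT.tendsto_measureReal_le hs a).eventually (Metric.closedBall_mem_nhds _ hη)
    filter_upwards [this] with k hk
    exact hk
  filter_upwards [hm.eventually hev, hm.eventually (eventually_gt_atTop 0), eventually_gt_atTop 0,
    hmn.eventually (gt_mem_nhds zero_lt_one)] with n h1 h2 h3 h4
  have h5 : m n ≤ n := by
    rw [div_lt_one (by exact_mod_cast h3)] at h4
    exact_mod_cast h4.le
  refine le_trans (le_of_eq ?_) (exists_bad_set hX hY hindep hident S hd hη hS h2 h5 h1)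
  congr 1
  ext ω
  have h6 : 0 ≤ kolmogorovError s (m n) (sample X Y n ω) := Real.iSup_nonneg fun x => abs_nonneg _
  simp only [Set.mem_ofPred_eq, sub_zero, Real.norm_eq_abs, abs_of_nonneg h6]
  rw [mul_div_cancel₀ _ (by norm_num : (7 : ℝ) ≠ 0)]

end Consistency

end RankBootstrap

namespace RankBootstrap

/-! ### Boundedness of the rank correlation -/

theorem sum_abs_sub_le_two_mul_sum {n : ℕ} {b : Fin n → ℝ} (hb : ∀ i, 0 ≤ b i) :
    ∑ i : Fin (n - 1), |b ⟨i.val + 1, by omega⟩ - b ⟨i.val, by omega⟩| ≤ 2 * ∑ i, b i := by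
  cases n with
  | zero => simp
  | succ k =>
    have h1 : ∑ i : Fin k, b i.succ ≤ ∑ i, b i := by
      rw [Fin.sum_univ_succ]; linarith [hb 0]
    have h2 : ∑ i : Fin k, b i.castSucc ≤ ∑ i, b i := by
      rw [Fin.sum_univ_castSucc]; linarith [hb (Fin.last k)]
    calc _ ≤ ∑ i : Fin k, (b i.succ + b i.castSucc) := Finset.sum_le_sum fun i _ => by
          have h3 := hb i.succ
          have h4 := hb i.castSucc
          change |b i.succ - b i.castSucc| ≤ _
          rw [abs_le]; constructor <;> linarith
      _ ≤ _ := by rw [Finset.sum_add_distrib]; linarith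

/-- Write ranks as sums of the sequences $b_j(i)=1\{y_j\le y_i\}$. Such a 0-1 sequence switches at
most twice per one and at most twice per zero, that is at most $2l_j$ and at most $2(n-l_j)$ times.
Weighting these bounds by $n-l_j$ and $l_j$ gives $4l_j(n-l_j)$. Ties are allowed, so the quotient
defining $\xi_n$ is bounded in the tied case too. -/
theorem natCast_mul_rankVariation_le {n : ℕ} (y : Fin n → ℝ) :
    (n : ℝ) * rankVariation y ≤
      4 * ∑ i, (upperRank y i : ℝ) * ((n : ℝ) - (upperRank y i : ℝ)) := by
  classical
  let b : Fin n → Fin n → ℝ := fun j i => if y j ≤ y i then 1 else 0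
  have hr : ∀ i, (lowerRank y i : ℝ) = ∑ j, b j i := fun i => by
    unfold lowerRank; simp [b]
  have hl : ∀ j, (upperRank y j : ℝ) = ∑ i, b j i := fun j => by
    unfold upperRank; simp [b]
  have hb0 : ∀ j i, 0 ≤ b j i := fun j i => by simp only [b]; split_ifs <;> norm_num
  have hb1 : ∀ j i, 0 ≤ 1 - b j i := fun j i => by simp only [b]; split_ifs <;> norm_num
  let c : Fin n → ℝ := fun j =>
    ∑ i : Fin (n - 1), |b j ⟨i.val + 1, by omega⟩ - b j ⟨i.val, by omega⟩|
  have hc1 : ∀ j, c j ≤ 2 * upperRank y j := fun j => by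
    rw [hl]; exact sum_abs_sub_le_two_mul_sum (hb0 j)
  have hc2 : ∀ j, c j ≤ 2 * (n - upperRank y j) := fun j => by
    have h := sum_abs_sub_le_two_mul_sum (hb1 j)
    rw [Finset.sum_sub_distrib, ← hl] at h
    simp only [sub_sub_sub_cancel_left, Finset.sum_const, Finset.card_univ, Fintype.card_fin,
      nsmul_eq_mul, mul_one] at h
    refine le_trans (Finset.sum_le_sum fun i _ => ?_) h
    rw [abs_sub_comm]
  have hln : ∀ j, (upperRank y j : ℝ) ≤ n := fun j => by
    have h := Finset.card_le_univ (Finset.univ.filter fun i => y j ≤ y i)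
    rw [Fintype.card_fin] at h
    exact_mod_cast h
  have hrv : rankVariation y ≤ ∑ j, c j := by
    unfold rankVariation
    rw [Finset.sum_comm]
    refine Finset.sum_le_sum fun i _ => ?_
    rw [hr, hr, ← Finset.sum_sub_distrib]
    exact Finset.abs_sum_le_sum_abs _ _
  calc (n : ℝ) * rankVariation y ≤ n * ∑ j, c j := by gcongr
    _ = ∑ j, n * c j := Finset.mul_sum _ _ _
    _ ≤ ∑ j, 4 * ((upperRank y j : ℝ) * (n - upperRank y j)) := Finset.sum_le_sum fun j _ => by
        have h1 := mul_le_mul_of_nonneg_left (hc1 j) (sub_nonneg.mpr (hln j))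
        have h2 := mul_le_mul_of_nonneg_left (hc2 j) (Nat.cast_nonneg (α := ℝ) (upperRank y j))
        linarith
    _ = _ := (Finset.mul_sum _ _ _).symm

theorem rankVariation_nonneg {n : ℕ} (y : Fin n → ℝ) : 0 ≤ rankVariation y :=
  Finset.sum_nonneg fun _ _ => abs_nonneg _

theorem rankVariation_le {n : ℕ} (y : Fin n → ℝ) : rankVariation y ≤ ((n - 1 : ℕ) : ℝ) * n := by
  classical
  have h : ∀ i, (lowerRank y i : ℝ) ≤ n := fun i => by
    have h := Finset.card_le_univ (Finset.univ.filter fun j => y j ≤ y i)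
    rw [Fintype.card_fin] at h
    exact_mod_cast h
  calc rankVariation y ≤ ∑ _i : Fin (n - 1), (n : ℝ) := Finset.sum_le_sum fun i _ => by
        have h1 := h ⟨i.val + 1, by omega⟩
        have h2 := h ⟨i.val, by omega⟩
        have h3 := Nat.cast_nonneg (α := ℝ) (lowerRank y ⟨i.val + 1, by omega⟩)
        have h4 := Nat.cast_nonneg (α := ℝ) (lowerRank y ⟨i.val, by omega⟩)
        rw [abs_le]; constructor <;> linarith
    _ = _ := by simp

theorem abs_one_sub_xi_le {n : ℕ} (z : Fin n → ℝ × ℝ) (ρ : Equiv.Perm (Fin n)) :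
    |1 - xi z ρ| ≤ 3 := by
  classical
  have h0 := rankVariation_nonneg (rearrangedY z ρ)
  simp only [xi]
  split_ifs with h
  · rw [sub_sub_cancel]
    -- For $n\le1$ the denominator $n^2-1$ is not positive, but the variation is an empty sum.
    rcases Nat.lt_or_ge n 2 with hn | hn
    · have h1 := rankVariation_le (rearrangedY z ρ)
      rw [Nat.sub_eq_zero_of_le (by omega), Nat.cast_zero, zero_mul] at h1
      rw [le_antisymm h1 h0]
      norm_num
    · have hn2 : (2 : ℝ) ≤ n := by exact_mod_cast hn
      have h1 := rankVariation_le (rearrangedY z ρ)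
      rw [Nat.cast_sub (by omega), Nat.cast_one] at h1
      have h2 : (0 : ℝ) < (n : ℝ) ^ 2 - 1 := by nlinarith
      rw [abs_of_nonneg (by positivity), div_le_iff₀ h2]
      nlinarith
  · rw [sub_sub_cancel]
    set S := ∑ i, (upperRank (rearrangedY z ρ) i : ℝ) * (n - upperRank (rearrangedY z ρ) i)
    have h1 : n * rankVariation (rearrangedY z ρ) ≤ 4 * S := natCast_mul_rankVariation_le _
    have h2 : 0 ≤ n * rankVariation (rearrangedY z ρ) := by positivity
    have h3 : 0 ≤ S := by linarith
    rw [abs_of_nonneg (by positivity)]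
    -- The inequality is used in a form valid also for a zero denominator, where the quotient is
    -- $0$.
    exact (div_le_of_le_mul₀ (by positivity) zero_le_two (by linarith)).trans (by norm_num)

theorem abs_one_sub_meanXi_le {n : ℕ} (z : Fin n → ℝ × ℝ) : |1 - meanXi z| ≤ 3 := by
  have h1 : 1 - meanXi z = ∫ ρ, (1 - xi z ρ) ∂(tieMeasure n) := by
    rw [integral_sub (integrable_const _) Integrable.of_finite]
    simp [meanXi]
  rw [h1, ← Real.norm_eq_abs]
  refine (norm_integral_le_of_norm_le_const (C := 3) (Eventually.of_forall fun ρ =>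
    abs_one_sub_xi_le z ρ)).trans ?_
  simp

section Consistency

variable {Ω : Type*} [MeasurableSpace Ω] {P : Measure Ω} [IsProbabilityMeasure P]
  {X Y : ℕ → Ω → ℝ} (hX : ∀ k, Measurable (X k)) (hY : ∀ k, Measurable (Y k))
include hX hY

theorem varXi_le (m : ℕ) : varXi P X Y m ≤ 9 := by
  have := isProbabilityMeasure_pairLaw (P := P) hX hY
  have hb := bddMeasurable_meanXi (m := m)
  have h1 := integral_sq_sub_integral (iid (Fin m) (pairLaw P X Y)) (hb.sub_const 1)
  have h2 : ∫ z, (meanXi z - 1) ∂(iid (Fin m) (pairLaw P X Y)) = expXi P X Y m - 1 := by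
    rw [integral_sub (hb.integrable _) (integrable_const _)]
    simp [expXi]
  rw [h2] at h1
  simp only [sub_sub_sub_cancel_right] at h1
  rw [varXi, h1]
  refine (sub_le_self _ (sq_nonneg _)).trans
    (integral_le_const ((hb.sub_const 1).pow 2) (Eventually.of_forall fun z => ?_))
  have h3 := abs_one_sub_meanXi_le z
  rw [abs_sub_comm] at h3
  rw [← sq_abs]
  nlinarith [abs_nonneg (meanXi z - 1)]

variable (hindep : iIndepFun (fun k ω => (X k ω, Y k ω)) P)
  (hident : ∀ k, IdentDistrib (fun ω => (X k ω, Y k ω)) (fun ω => (X 0 ω, Y 0 ω)) P P)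
include hindep hident

/-- With only a bounded variance available, the shift needs $m^2/n\to0$, which is exactly $m=o(\sqrt
n)$. -/
theorem BootstrapConsistent.of_isLittleO_sqrt {s : ℝ≥0} (hs : 0 < s) (hT : TConvergesTo P X Y s)
    {m : ℕ → ℕ} (hm : Tendsto m atTop atTop)
    (hmn : (fun n => (m n : ℝ)) =o[atTop] (fun n : ℕ => √(n : ℝ))) :
    BootstrapConsistent P X Y s m := by
  have h1 : Tendsto (fun n => (m n : ℝ) / √(n : ℝ)) atTop (𝓝 0) := hmn.tendsto_div_nhds_zero
  have h2 : Tendsto (fun n => (m n : ℝ) ^ 2 / n) atTop (𝓝 0) := by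
    have := h1.pow 2
    rw [zero_pow two_ne_zero] at this
    refine this.congr fun n => ?_
    rw [div_pow, Real.sq_sqrt (Nat.cast_nonneg n)]
  refine BootstrapConsistent.of_varXi hX hY hindep hident hs hT hm ?_ ?_
  · refine squeeze_zero (fun n => by positivity) (fun n => ?_) h2
    gcongr
    exact_mod_cast Nat.le_self_pow two_ne_zero (m n)
  · refine squeeze_zero (fun n => ?_) (fun n => ?_) (by simpa using h2.mul_const 9)
    · exact div_nonneg (mul_nonneg (sq_nonneg _) (integral_nonneg fun z => sq_nonneg _))
        (Nat.cast_nonneg n)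
    · rw [div_mul_eq_mul_div]
      gcongr
      exact varXi_le hX hY (m n)

end Consistency

end RankBootstrap

namespace RankBootstrap

open unitInterval

/-! ### The continuous case -/

section Continuous

variable {Ω : Type*} [MeasurableSpace Ω] {P : Measure Ω} [IsProbabilityMeasure P]
  {X Y : ℕ → Ω → ℝ}

/-- Almost surely `meanXi` is affine in $V/m$ with slope of order $1/m$, and $V/m$ has variance
$O(m)$. The restriction $m\ge2$ keeps $m^2-1$ comparable to $m^2$. -/
theorem exists_varXi_le {μ : Measure ℝ} [IsProbabilityMeasure μ]
    [NullSingletonClass μ] {q : ℝ × I → ℝ} (hq : Measurable q) [NullSingletonClass (lawY μ q)]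
    (hl : pairLaw P X Y = (joint μ).map fun w => (w.1, q w)) :
    ∃ K, 0 ≤ K ∧ ∀ m, 2 ≤ m → varXi P X Y m ≤ K / m := by
  have hmq : Measurable fun w : ℝ × I => (w.1, q w) := measurable_fst.prodMk hq
  have : IsProbabilityMeasure (pairLaw P X Y) := by
    rw [hl]; exact Measure.isProbabilityMeasure_map hmq.aemeasurable
  obtain ⟨K, hK0, hK⟩ := exists_variance_neighbourVariation_le (μ := μ) hq
  refine ⟨36 * K, by positivity, fun m hm => ?_⟩
  set e := ∫ w : Fin m → ℝ × I, neighbourVariation q w / m ∂(iid (Fin m) (joint μ)) with he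
  set a := 1 - 3 * (m * e) / ((m : ℝ) ^ 2 - 1)
  have hm2 : (2 : ℝ) ≤ m := by exact_mod_cast hm
  have hm0 : (0 : ℝ) < m := by linarith
  have hd : (m : ℝ) ^ 2 / 2 ≤ (m : ℝ) ^ 2 - 1 := by nlinarith
  have hd0 : (0 : ℝ) < (m : ℝ) ^ 2 - 1 := by nlinarith
  have hb := bddMeasurable_meanXi (m := m)
  have h1 : varXi P X Y m ≤ ∫ z, (meanXi z - a) ^ 2 ∂(iid (Fin m) (pairLaw P X Y)) := by
    rw [integral_sq_sub_const _ hb a]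
    exact le_add_of_nonneg_right (sq_nonneg _)
  have hw : Measurable fun (w : Fin m → ℝ × I) i => ((w i).1, q (w i)) :=
    measurable_pi_lambda _ fun i => hmq.comp (measurable_pi_apply i)
  have h2 : ∫ z, (meanXi z - a) ^ 2 ∂(iid (Fin m) (pairLaw P X Y)) =
      ∫ w : Fin m → ℝ × I, (3 * m / ((m : ℝ) ^ 2 - 1)) ^ 2 * (neighbourVariation q w / m - e) ^ 2
        ∂(iid (Fin m) (joint μ)) := by
    rw [iid_map hq hl, integral_map hw.aemeasurable
      ((hb.sub_const a).pow 2).measurable.aestronglyMeasurable]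
    refine integral_congr_ae ?_
    filter_upwards [ae_injective_fst (ι := Fin m) (μ := μ), ae_injective_snd hq m] with w hw1 hw2
    have h3 : meanXi (fun i => ((w i).1, q (w i))) =
        1 - 3 * neighbourVariation q w / ((m : ℝ) ^ 2 - 1) := by
      simp [meanXi, xi_eq_neighbourVariation hw1 hw2]
    rw [h3, ← mul_pow, ← neg_sq]
    congr 1
    simp only [a]
    field_simp
    ring
  rw [h2, integral_const_mul] at h1
  refine h1.trans ?_
  have h4 : 3 * m / ((m : ℝ) ^ 2 - 1) ≤ 6 / m := by
    rw [div_le_div_iff₀ hd0 hm0]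
    nlinarith
  calc _ ≤ (6 / (m : ℝ)) ^ 2 * (K * m) := by
        gcongr
        exact hK m (by omega)
    _ = 36 * K / m := by field_simp; ring

variable (hX : ∀ k, Measurable (X k)) (hY : ∀ k, Measurable (Y k))
  (hindep : iIndepFun (fun k ω => (X k ω, Y k ω)) P)
  (hident : ∀ k, IdentDistrib (fun ω => (X k ω, Y k ω)) (fun ω => (X 0 ω, Y 0 ω)) P P)
include hX hY hindep hident

theorem BootstrapConsistent.of_representation {μ : Measure ℝ} [IsProbabilityMeasure μ]
    [NullSingletonClass μ] {q : ℝ × I → ℝ} (hq : Measurable q) [NullSingletonClass (lawY μ q)]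
    (hl : pairLaw P X Y = (joint μ).map fun w => (w.1, q w)) {s : ℝ≥0} (hs : 0 < s)
    (hT : TConvergesTo P X Y s) {m : ℕ → ℕ} (hm : Tendsto m atTop atTop)
    (hmn : (fun n => (m n : ℝ)) =o[atTop] (fun n : ℕ => (n : ℝ))) :
    BootstrapConsistent P X Y s m := by
  obtain ⟨K, hK0, hK⟩ := exists_varXi_le hq hl
  have h1 : Tendsto (fun n => (m n : ℝ) / n) atTop (𝓝 0) := hmn.tendsto_div_nhds_zero
  refine BootstrapConsistent.of_varXi hX hY hindep hident hs hT hm h1 ?_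
  refine squeeze_zero' (Eventually.of_forall fun n => ?_) ?_ (by simpa using h1.const_mul K)
  · exact div_nonneg (mul_nonneg (sq_nonneg _) (integral_nonneg fun z => sq_nonneg _))
      (Nat.cast_nonneg n)
  · filter_upwards [hm.eventually (eventually_ge_atTop 2)] with n hn
    have h2 : (0 : ℝ) < m n := by exact_mod_cast (show 0 < m n by omega)
    rw [← mul_div_assoc]
    refine div_le_div_of_nonneg_right ?_ (Nat.cast_nonneg n)
    calc (m n : ℝ) ^ 2 * varXi P X Y (m n) ≤ (m n : ℝ) ^ 2 * (K / m n) := by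
          gcongr; exact hK _ hn
      _ = K * m n := by field_simp

/-- In the continuous case, unless `Y` is a function of `X`, the rank correlation is asymptotically
normal and the bootstrap is consistent. -/
theorem exists_TConvergesTo_and_consistent
    (hc : Continuous fun p : ℝ × ℝ => P.real {ω | X 0 ω ≤ p.1 ∧ Y 0 ω ≤ p.2})
    (hf : ¬ ∃ f : ℝ → ℝ, Measurable f ∧ Y 0 =ᵐ[P] fun ω => f (X 0 ω)) :
    ∃ s : ℝ≥0, 0 < s ∧ TConvergesTo P X Y s ∧ ∀ m : ℕ → ℕ, Tendsto m atTop atTop →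
      (fun n => (m n : ℝ)) =o[atTop] (fun n : ℕ => (n : ℝ)) → BootstrapConsistent P X Y s m := by
  have := isProbabilityMeasure_pairLaw (P := P) hX hY
  have hXY : Measurable fun ω => (X 0 ω, Y 0 ω) := (hX 0).prodMk (hY 0)
  obtain ⟨q, hq, hl⟩ := exists_representation (pairLaw P X Y)
  have hmq : Measurable fun w : ℝ × I => (w.1, q w) := measurable_fst.prodMk hq
  have hfst : NullSingletonClass (pairLaw P X Y).fst := ⟨fun a => by
    rw [Measure.fst_apply (measurableSet_singleton a), pairLaw,
      Measure.map_apply hXY (measurable_fst (measurableSet_singleton a))]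
    exact measure_eq_of_continuous_cdf (hX 0) (hY 0) hc a⟩
  have hsnd : NullSingletonClass (lawY (pairLaw P X Y).fst q) := ⟨fun a => by
    -- The law of $q(x,u)$ is the second marginal of the pair, so continuity in the second argument
    -- excludes its atoms.
    have h1 : lawY (pairLaw P X Y).fst q = (pairLaw P X Y).map Prod.snd := by
      conv_rhs => rw [hl]
      rw [Measure.map_map measurable_snd hmq]
      rfl
    rw [h1, Measure.map_apply measurable_snd (measurableSet_singleton a), pairLaw,
      Measure.map_apply hXY (measurable_snd (measurableSet_singleton a))]
    refine measure_eq_of_continuous_cdf (hY 0) (hX 0) ?_ a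
    refine (hc.comp continuous_swap).congr fun p => ?_
    simp only [Function.comp_apply, Prod.fst_swap, Prod.snd_swap, and_comm]⟩
  have hv : 0 < limitVariance (pairLaw P X Y).fst q := by
    refine limitVariance_pos hq fun ⟨f, hfm, hfq⟩ => hf ⟨f, hfm, ?_⟩
    have h1 : ∀ᵐ v ∂(pairLaw P X Y), v.2 = f v.1 := by
      rw [hl]
      exact (ae_map_iff hmq.aemeasurable (measurableSet_eq_fun measurable_snd
        (hfm.comp measurable_fst))).mpr hfq
    exact ae_of_ae_map hXY.aemeasurable h1
  -- The witness is $\sigma=3\sqrt{\mathrm{limitVariance}}$; the factor $3$ is that of the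
  -- definition of $\xi_n$ for distinct $Y$-values.
  have hs : 0 < NNReal.sqrt (9 * limitVariance (pairLaw P X Y).fst q).toNNReal := by
    rw [NNReal.sqrt_pos, Real.toNNReal_pos]; positivity
  have hT : TConvergesTo P X Y (NNReal.sqrt (9 * limitVariance (pairLaw P X Y).fst q).toNNReal) :=
    TConvergesTo_of_representation hX hY hindep hident hq hl (by
      rw [NNReal.sq_sqrt, Real.coe_toNNReal _ (by positivity)])
  exact ⟨_, hs, hT, fun m hm hmn =>
    BootstrapConsistent.of_representation hX hY hindep hident hq hl hs hT hm hmn⟩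

end Continuous

end RankBootstrap

theorem theorem1 {Ω : Type*} [MeasurableSpace Ω] (P : Measure Ω) [IsProbabilityMeasure P]
    (X Y : ℕ → Ω → ℝ) (hX : ∀ k, Measurable (X k)) (hY : ∀ k, Measurable (Y k))
    (hindep : iIndepFun (fun k ω => (X k ω, Y k ω)) P)
    (hident : ∀ k, IdentDistrib (fun ω => (X k ω, Y k ω)) (fun ω => (X 0 ω, Y 0 ω)) P P) :
    (∀ σ : ℝ≥0, 0 < σ → RankBootstrap.TConvergesTo P X Y σ →
      ∀ m : ℕ → ℕ, Tendsto m atTop atTop →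
        (fun n => (m n : ℝ)) =o[atTop] (fun n : ℕ => √(n : ℝ)) →
        RankBootstrap.BootstrapConsistent P X Y σ m) ∧
    (Continuous (fun p : ℝ × ℝ => P.real {ω | X 0 ω ≤ p.1 ∧ Y 0 ω ≤ p.2}) →
      (¬ ∃ f : ℝ → ℝ, Measurable f ∧ Y 0 =ᵐ[P] fun ω => f (X 0 ω)) →
      ∃ σ : ℝ≥0, 0 < σ ∧ RankBootstrap.TConvergesTo P X Y σ ∧
        ∀ m : ℕ → ℕ, Tendsto m atTop atTop →
          (fun n => (m n : ℝ)) =o[atTop] (fun n : ℕ => (n : ℝ)) →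
          RankBootstrap.BootstrapConsistent P X Y σ m) :=
  ⟨fun _ hs hT _ hm hmn =>
      RankBootstrap.BootstrapConsistent.of_isLittleO_sqrt hX hY hindep hident hs hT hm hmn,
    RankBootstrap.exists_TConvergesTo_and_consistent hX hY hindep hident⟩
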